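/- Let $\Delta=\{x\in\mathbf R^m : L_j(x)\ge 0,\ j=1,\dots,d\}$ be a Delzant polytope: $\Delta$ is compact with nonempty interior, $L_j(x)=\langle\nu_j,x\rangle+b_j$ with $\nu_j\in\mathbf Z^m$, each $L_j$ cuts out a facet $F_j$ of $\Delta$ (different $j$ giving different facets), and at each vertex the normals $\nu_j$ of the facets containing it form a $\mathbf Z$-basis of $\mathbf Z^m$. Let $d\mu$ be Lebesgue measure and let $d\sigma$ be the measure on $\partial\Delta$ with $\nu_j\wedge d\sigma=\pm d\mu$ on $F_j$ (i.e. $|\nu_j|^{-1}$ times Euclidean area). Let $f$ be an affine function, positive on $\Delta$, and let $n\in\mathbf R\setminus\{0,1,2\}$. Put $$c_{\Delta,f,-2,n}=2\,\frac{\int_{\partial\Delta}f^{1-n}\,d\sigma}{\int_\Delta f^{-1-n}\,d\mu},\qquad \mathrm{DF}_{\Delta,f,n}(\phi)=2\int_{\partial\Delta}f^{1-n}\phi\,d\sigma-c_{\Delta,f,-2,n}\int_\Delta f^{-1-n}\phi\,d\mu .$$ A symplectic potential on $\Delta$ is a function $u$ on $\Delta$ such that $u-\frac12\sum_j L_j\log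 L_j$ is smooth on $\Delta$ (up to the boundary, with $0\log 0=0$), the Hessian $(u_{,ij})$ is positive definite in the interior $\Delta^\circ$, and $\det(u_{,ij})=(\delta\prod_jL_j)^{-1}$ on $\Delta^\circ$ for some positive smooth function $\delta$ on $\Delta$. With $\mathbf H^u=(u_{,ij})^{-1}$, it defines the toric Kähler metric $$g_J=\sum_{i,j}u_{,ij}\,d\mu_i\,d\mu_j+\sum_{i,j}\mathbf H^u_{ij}\,d\theta_i\,d\theta_j$$ in the action-angle coordinates $(\mu,\theta)$, $\mu\in\Delta^\circ$. For a Riemannian metric $g$ with scalar curvature $s_g$ and Hodge Laplacian $\Delta_g$, and a positive function $f$, the $(g,f,k,n)$-scalar curvature is $$s_{g,f,k,n}=f^{-k}\Big\{s_g+k(n-1)\frac1f\Delta_gf+\frac k4(n-1)(4+2k-kn)\frac1{f^2}|df|_g^2\Big\}.$$ Suppose that there is a symplectic potential $u$ on $\Delta$ whose $(g_J,f,-2,n)$-scalar curvature is a constant $c$. Then $c=c_{\Delta,f,-2,n}$, and $\mathrm{DF}_{\Delta,f,n}(\phi)\ge 0$ for every smooth convex function $\phi$ on $\Delta$, with equality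 if and only if $\phi$ is affine on $\Delta$. -/

import Mathlib

open MeasureTheory Set
open scoped ContDiff

noncomputable section

/-! ### Riemannian geometry in a coordinate chart

A metric in coordinates `x ∈ ℝ^ι` is a matrix-valued function `g = (g_{ij})`. -/

namespace ChartMetric

variable {ι : Type} [Fintype ι] [DecidableEq ι]

/-- The partial derivative `∂F/∂x_i`. -/
def pderiv (i : ι) (F : EuclideanSpace ℝ ι → ℝ) (x : EuclideanSpace ℝ ι) : ℝ :=
  fderiv ℝ F x (EuclideanSpace.single i 1)

/-- The Hessian matrix `(∂²F/∂x_i∂x_j)`. -/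
def hessian (F : EuclideanSpace ℝ ι → ℝ) (x : EuclideanSpace ℝ ι) : Matrix ι ι ℝ :=
  Matrix.of fun i j => pderiv i (pderiv j F) x

/-- The Christoffel symbol `Γ^k_{ij}` of the Levi-Civita connection. -/
def christoffel (g : EuclideanSpace ℝ ι → Matrix ι ι ℝ) (k i j : ι)
    (x : EuclideanSpace ℝ ι) : ℝ :=
  (1 / 2) * ∑ l, (g x)⁻¹ k l *
    (pderiv i (fun y => g y j l) x + pderiv j (fun y => g y i l) x - pderiv l (fun y => g y i j) x)

/-- The Ricci tensor
`R_{ij} = ∂_k Γ^k_{ij} - ∂_j Γ^k_{ik} + Γ^k_{kl} Γ^l_{ij} - Γ^k_{jl} Γ^l_{ik}`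
(summed over repeated indices). -/
def ricci (g : EuclideanSpace ℝ ι → Matrix ι ι ℝ) (i j : ι) (x : EuclideanSpace ℝ ι) : ℝ :=
  (∑ k, (pderiv k (christoffel g k i j) x - pderiv j (christoffel g k i k) x)) +
    ∑ k, ∑ l, (christoffel g k k l x * christoffel g l i j x
      - christoffel g k j l x * christoffel g l i k x)

/-- The scalar curvature `s_g = g^{ij} R_{ij}` (the unit two-sphere has `s_g = 2`). -/
def scalarCurvature (g : EuclideanSpace ℝ ι → Matrix ι ι ℝ) (x : EuclideanSpace ℝ ι) : ℝ :=
  ∑ i, ∑ j, (g x)⁻¹ i j * ricci g i j x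

/-- The Hodge Laplacian on functions, `Δ_g F = - g^{ij} (∂_i ∂_j F - Γ^k_{ij} ∂_k F)`
(nonnegative spectrum). -/
def hodgeLaplacian (g : EuclideanSpace ℝ ι → Matrix ι ι ℝ) (F : EuclideanSpace ℝ ι → ℝ)
    (x : EuclideanSpace ℝ ι) : ℝ :=
  -∑ i, ∑ j, (g x)⁻¹ i j *
    (pderiv i (pderiv j F) x - ∑ k, christoffel g k i j x * pderiv k F x)

/-- The squared norm `|dF|_g² = g^{ij} ∂_i F ∂_j F`. -/
def normSqDifferential (g : EuclideanSpace ℝ ι → Matrix ι ι ℝ) (F : EuclideanSpace ℝ ι → ℝ)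
    (x : EuclideanSpace ℝ ι) : ℝ :=
  ∑ i, ∑ j, (g x)⁻¹ i j * pderiv i F x * pderiv j F x

/-- The `(g,f,k,n)`-scalar curvature
`f^{-k} { s_g + k(n-1) f^{-1} Δ_g f + (k/4)(n-1)(4+2k-kn) f^{-2} |df|_g² }`. -/
def gfknScalarCurvature (g : EuclideanSpace ℝ ι → Matrix ι ι ℝ) (f : EuclideanSpace ℝ ι → ℝ)
    (k n : ℝ) (x : EuclideanSpace ℝ ι) : ℝ :=
  f x ^ (-k) * (scalarCurvature g x + k * (n - 1) * (1 / f x) * hodgeLaplacian g f x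
    + k / 4 * (n - 1) * (4 + 2 * k - k * n) * (1 / f x ^ 2) * normSqDifferential g f x)

end ChartMetric

/-! ### Delzant polytopes -/

/-- The affine function `L(x) = ⟨ν, x⟩ + b` with integral linear part `ν`. -/
def integralAffine {m : ℕ} (ν : Fin m → ℤ) (b : ℝ) (x : EuclideanSpace ℝ (Fin m)) : ℝ :=
  ∑ i, (ν i : ℝ) * x i + b

/-- The polyhedron `{x | L_j(x) ≥ 0 for all j}`, `L_j(x) = ⟨ν_j, x⟩ + b_j`. -/
def polyhedron {m d : ℕ} (ν : Fin d → Fin m → ℤ) (b : Fin d → ℝ) :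
    Set (EuclideanSpace ℝ (Fin m)) :=
  {x | ∀ j, 0 ≤ integralAffine (ν j) (b j) x}

/-- A Delzant polytope in `ℝ^m` with `d` facets: a compact polytope `{x | L_j(x) ≥ 0 for all j}`
with nonempty interior, irredundantly described by affine functions `L_j` with integral linear
parts `ν_j` (the inward normals), such that at every vertex the normals of the facets through that
vertex form a `ℤ`-basis of `ℤ^m`. (Every facet contains a vertex, so each `ν_j` is primitive.) -/
structure DelzantPolytope (m d : ℕ) where
  /-- the inward integral normals `ν_j` -/
  normal : Fin d → Fin m → ℤ
  /-- the constants `b_j` -/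
  offset : Fin d → ℝ
  bounded : Bornology.IsBounded (polyhedron normal offset)
  nonempty_interior : (interior (polyhedron normal offset)).Nonempty
  /-- each `L_j` defines a facet, and no other `L_k` defines the same facet -/
  facet : ∀ j, ∃ x ∈ polyhedron normal offset, integralAffine (normal j) (offset j) x = 0 ∧
    ∀ k, k ≠ j → 0 < integralAffine (normal k) (offset k) x
  linearIndependent_vertex : ∀ v ∈ (polyhedron normal offset).extremePoints ℝ,
    LinearIndependent ℤ
      (fun j : {j : Fin d // integralAffine (normal j) (offset j) v = 0} => normal j)
  span_vertex : ∀ v ∈ (polyhedron normal offset).extremePoints ℝ,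
    Submodule.span ℤ (range
      (fun j : {j : Fin d // integralAffine (normal j) (offset j) v = 0} => normal j)) = ⊤

namespace DelzantPolytope

variable {m d : ℕ} (P : DelzantPolytope m d)

/-- The polytope `Δ` as a closed subset of `ℝ^m`. -/
def carrier : Set (EuclideanSpace ℝ (Fin m)) := polyhedron P.normal P.offset

/-- The defining affine function `L_j(x) = ⟨ν_j, x⟩ + b_j`. -/
def L (j : Fin d) (x : EuclideanSpace ℝ (Fin m)) : ℝ :=
  integralAffine (P.normal j) (P.offset j) x

/-- The facet `F_j = Δ ∩ {L_j = 0}`. -/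
def facetSet (j : Fin d) : Set (EuclideanSpace ℝ (Fin m)) := {x ∈ P.carrier | P.L j x = 0}

/-- The Euclidean length `|ν_j|` of the `j`-th normal. -/
def normalLength (j : Fin d) : ℝ := Real.sqrt (∑ i, (P.normal j i : ℝ) ^ 2)

open scoped MeasureTheory in
/-- The measure `dσ` on `∂Δ = ⋃_j F_j` normalized by `ν_j ∧ dσ = ± dμ` on `F_j`, that is,
`|ν_j|⁻¹` times the Euclidean `(m-1)`-dimensional area on each facet `F_j`. -/
def boundaryMeasure : Measure (EuclideanSpace ℝ (Fin m)) :=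
  ∑ j, ENNReal.ofReal (P.normalLength j)⁻¹ • (μHE[m - 1]).restrict (P.facetSet j)

/-- The constant `c_{Δ,f,-2,n} = 2 ∫_{∂Δ} f^{1-n} dσ / ∫_Δ f^{-1-n} dμ`. -/
def constC (f : EuclideanSpace ℝ (Fin m) →ᵃ[ℝ] ℝ) (n : ℝ) : ℝ :=
  2 * (∫ x, f x ^ (1 - n) ∂P.boundaryMeasure) / ∫ x in P.carrier, f x ^ (-1 - n)

/-- The Donaldson–Futaki invariant
`DF_{Δ,f,n}(φ) = 2 ∫_{∂Δ} f^{1-n} φ dσ - c_{Δ,f,-2,n} ∫_Δ f^{-1-n} φ dμ`. -/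
def donaldsonFutaki (f : EuclideanSpace ℝ (Fin m) →ᵃ[ℝ] ℝ) (n : ℝ)
    (φ : EuclideanSpace ℝ (Fin m) → ℝ) : ℝ :=
  2 * (∫ x, f x ^ (1 - n) * φ x ∂P.boundaryMeasure)
    - P.constC f n * ∫ x in P.carrier, f x ^ (-1 - n) * φ x

/-- Symplectic potentials on `Δ`, i.e. the functions that define smooth torus-invariant compatible
complex structures on the compact toric manifold of `Δ`: `u` is the sum of
`½ ∑_j L_j log L_j` and a function smooth up to the boundary of `Δ`, its Hessian is positive
definite in the interior, and there `det Hess u = (δ ∏_j L_j)⁻¹` with `δ` positive and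
smooth up to the boundary. -/
structure IsSymplecticPotential (u : EuclideanSpace ℝ (Fin m) → ℝ) : Prop where
  exists_smooth : ∃ h : EuclideanSpace ℝ (Fin m) → ℝ, ContDiffOn ℝ ∞ h P.carrier ∧
    ∀ x ∈ P.carrier, u x = (1 / 2) * ∑ j, P.L j x * Real.log (P.L j x) + h x
  posDef : ∀ x ∈ interior P.carrier, (ChartMetric.hessian u x).PosDef
  exists_det : ∃ δ : EuclideanSpace ℝ (Fin m) → ℝ, ContDiffOn ℝ ∞ δ P.carrier ∧
    (∀ x ∈ P.carrier, 0 < δ x) ∧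
    ∀ x ∈ interior P.carrier, (ChartMetric.hessian u x).det = (δ x * ∏ j, P.L j x)⁻¹

end DelzantPolytope

/-! ### The toric Kähler metric in action-angle coordinates -/

/-- The moment (action) coordinates `μ` of a point with action-angle coordinates `(μ, θ)`. -/
def momentCoord {m : ℕ} (z : EuclideanSpace ℝ (Fin m ⊕ Fin m)) : EuclideanSpace ℝ (Fin m) :=
  WithLp.toLp 2 fun i => z (Sum.inl i)

/-- The toric Kähler metric
`g_J = ∑ u_{,ij} dμ_i dμ_j + ∑ H^u_{ij} dθ_i dθ_j`, `H^u = (Hess u)⁻¹`, in the action-angle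
coordinates `(μ, θ)`, with `θ ∈ ℝ^m` in the universal cover of the torus. -/
def toricMetric {m : ℕ} (u : EuclideanSpace ℝ (Fin m) → ℝ)
    (z : EuclideanSpace ℝ (Fin m ⊕ Fin m)) : Matrix (Fin m ⊕ Fin m) (Fin m ⊕ Fin m) ℝ :=
  Matrix.fromBlocks (ChartMetric.hessian u (momentCoord z)) 0 0
    (ChartMetric.hessian u (momentCoord z))⁻¹

end

/-! Write `U = Hess u` and `H = U⁻¹`. In action-angle coordinates the metric depends only on `μ` and
its two blocks `U`, `H` are mutually inverse, so it has volume density one. Together with the total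
symmetry of `∂U` this reduces the scalar curvature to Abreu's expression `-∑ ∂_i ∂_j H_ij`
(`scalarCurvature_blockMetric`). For affine `f` the Laplacian and gradient terms with `k = -2` are
exactly those that the Leibniz rule produces from a factor `f^(1-n)`, so the weighted curvature is
`-f^(1+n) ∑ ∂_i ∂_j (f^(1-n) H_ij)` (`gfknScalarCurvature_blockMetric`). Constancy is thus a linear
equation for `H`: `∑ ∂_i ∂_j (f^(1-n) H_ij) = -c f^(-1-n)` on the interior.

Multiply this equation by `φ` and integrate by parts twice. The matrix `H` extends smoothly to the
closed polytope, and on the facet `F_k` it satisfies `H ν_k = 0` and `div (H ν_k) = 2`. Hence the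
boundary contributes exactly `2 ∫ f^(1-n) φ dσ`, and `2 ∫ f^(1-n) φ dσ - c ∫ f^(-1-n) φ dμ = ∫
f^(1-n) tr(H Hess φ) dμ` (`futaki_eq_integral_trace`). Taking `φ = 1` identifies `c`. For convex `φ`
the trace pairs a positive definite matrix with a positive semidefinite one, so it is nonnegative,
and it vanishes identically only if `Hess φ = 0`, that is, if `φ` is affine.

Two analytic ingredients remain. The divergence theorem on the polytope (`integral_div_eq`) comes
from a smooth cutoff in the `L_j / ε`: its gradient lives in slabs `ε ≤ L_k ≤ 2ε` that collapse onto
the facets with weight `|ν_k|⁻¹`, the normalization of `dσ`. The boundary behaviour of `H` comes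
from writing `U` as a smooth matrix plus the rank-one poles `ν_k ν_kᵀ / (2 L_k)`. Rank one makes
each minor have at most simple poles along the facets, so the formula for `det U` gives a smooth
inverse (`exists_inv_extension`). Isolating the `k`-th pole in `H U = 1` then gives both boundary
conditions (`exists_normal_eq_mul`). -/

noncomputable section

set_option linter.unusedSectionVars false

namespace ChartMetric

/-! ### Calculus of partial derivatives in a chart. -/

section PartialDerivatives

variable {ι : Type} [Fintype ι] [DecidableEq ι] {F G : EuclideanSpace ℝ ι → ℝ}
  {x : EuclideanSpace ℝ ι}

lemma pderiv_congr (i : ι) (h : F =ᶠ[nhds x] G) : pderiv i F x = pderiv i G x := by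
  simp only [pderiv, h.fderiv_eq]

lemma pderiv_congr_of_eqOn {O : Set (EuclideanSpace ℝ ι)} (hO : IsOpen O) (hx : x ∈ O) (i : ι)
    (h : EqOn F G O) : pderiv i F x = pderiv i G x :=
  pderiv_congr i (h.eventuallyEq_of_mem (hO.mem_nhds hx))

@[simp]
lemma pderiv_const (i : ι) (c : ℝ) : pderiv i (fun _ => c) x = 0 := by
  simp [pderiv]

lemma pderiv_add (i : ι) (hF : DifferentiableAt ℝ F x) (hG : DifferentiableAt ℝ G x) :
    pderiv i (fun y => F y + G y) x = pderiv i F x + pderiv i G x := by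
  simp only [pderiv, fderiv_fun_add hF hG, add_apply]

lemma pderiv_sub (i : ι) (hF : DifferentiableAt ℝ F x) (hG : DifferentiableAt ℝ G x) :
    pderiv i (fun y => F y - G y) x = pderiv i F x - pderiv i G x := by
  simp only [pderiv, fderiv_fun_sub hF hG, sub_apply]

lemma pderiv_mul (i : ι) (hF : DifferentiableAt ℝ F x) (hG : DifferentiableAt ℝ G x) :
    pderiv i (fun y => F y * G y) x = pderiv i F x * G x + F x * pderiv i G x := by
  simp only [pderiv, fderiv_fun_mul hF hG, add_apply,
    smul_apply, smul_eq_mul]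
  ring

lemma pderiv_const_mul (i : ι) (c : ℝ) (hF : DifferentiableAt ℝ F x) :
    pderiv i (fun y => c * F y) x = c * pderiv i F x := by
  simp [pderiv_mul i (differentiableAt_const c) hF]

lemma pderiv_sum (i : ι) {κ : Type*} (s : Finset κ) {F : κ → EuclideanSpace ℝ ι → ℝ}
    (hF : ∀ k ∈ s, DifferentiableAt ℝ (F k) x) :
    pderiv i (fun y => ∑ k ∈ s, F k y) x = ∑ k ∈ s, pderiv i (F k) x := by
  simp only [pderiv, fderiv_fun_sum hF, sum_apply]

lemma fderiv_apply_eq_sum_pderiv (v : EuclideanSpace ℝ ι) :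
    fderiv ℝ F x v = ∑ i, v i * pderiv i F x := by
  have hv : v = ∑ i, v i • EuclideanSpace.single i (1 : ℝ) := by
    ext j
    simp [Finset.sum_apply, Pi.single_apply]
  conv_lhs => rw [hv]
  simp [pderiv, map_sum]

lemma contDiffOn_pderiv {O : Set (EuclideanSpace ℝ ι)} (hO : IsOpen O) (i : ι)
    (hF : ContDiffOn ℝ ∞ F O) : ContDiffOn ℝ ∞ (pderiv i F) O :=
  (hF.fderiv_of_isOpen hO (by simp)).clm_apply contDiffOn_const

lemma differentiableAt_of_contDiffOn {O : Set (EuclideanSpace ℝ ι)} (hO : IsOpen O)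
    (hF : ContDiffOn ℝ ∞ F O) (hx : x ∈ O) : DifferentiableAt ℝ F x :=
  (hF.contDiffAt (hO.mem_nhds hx)).differentiableAt (by simp)

lemma pderiv_pderiv_comm {O : Set (EuclideanSpace ℝ ι)} (hO : IsOpen O)
    (hF : ContDiffOn ℝ ∞ F O) (hx : x ∈ O) (i j : ι) :
    pderiv i (pderiv j F) x = pderiv j (pderiv i F) x := by
  have hd : DifferentiableAt ℝ (fderiv ℝ F) x :=
    ((hF.fderiv_of_isOpen (m := ∞) hO (by simp)).contDiffAt (hO.mem_nhds hx)).differentiableAt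
      (by simp)
  have hsymm : IsSymmSndFDerivAt ℝ F x :=
    (hF.contDiffAt (hO.mem_nhds hx)).isSymmSndFDerivAt (by
      rw [minSmoothness_of_isRCLikeNormedField]; exact WithTop.coe_le_coe.2 (le_top (a := (2 : ℕ∞))))
  have key : ∀ k l : ι, pderiv k (pderiv l F) x =
      fderiv ℝ (fderiv ℝ F) x (EuclideanSpace.single k 1) (EuclideanSpace.single l 1) := by
    intro k l
    unfold pderiv
    rw [fderiv_clm_apply hd (differentiableAt_const _)]
    simp
  rw [key, key, hsymm]

end PartialDerivatives

end ChartMetric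

/-! ### Functions that depend only on the moment coordinates. -/

section MomentCoordinates

open ChartMetric

variable {m : ℕ}

/-- The projection to the moment coordinates as a continuous linear map. -/
def momentCoordL (m : ℕ) : EuclideanSpace ℝ (Fin m ⊕ Fin m) →L[ℝ] EuclideanSpace ℝ (Fin m) :=
  LinearMap.toContinuousLinearMap
    { toFun := momentCoord
      map_add' := fun _ _ => rfl
      map_smul' := fun _ _ => rfl }

@[simp]
lemma momentCoordL_apply (z : EuclideanSpace ℝ (Fin m ⊕ Fin m)) :
    momentCoordL m z = momentCoord z := rfl

lemma continuous_momentCoord :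
    Continuous (momentCoord : EuclideanSpace ℝ (Fin m ⊕ Fin m) → _) :=
  (momentCoordL m).continuous

/-- The embedding of the moment coordinates as the slice `θ = 0`. -/
def momentSection (m : ℕ) : EuclideanSpace ℝ (Fin m) →L[ℝ] EuclideanSpace ℝ (Fin m ⊕ Fin m) :=
  LinearMap.toContinuousLinearMap
    { toFun := fun x => WithLp.toLp 2 (Sum.elim x 0)
      map_add' := fun x y => by ext (i | i) <;> simp
      map_smul' := fun c x => by ext (i | i) <;> simp }

@[simp]
lemma momentCoord_momentSection (x : EuclideanSpace ℝ (Fin m)) :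
    momentCoord (momentSection m x) = x := rfl

lemma momentCoord_single_inl (i : Fin m) :
    momentCoord (EuclideanSpace.single (Sum.inl i) (1 : ℝ)) = EuclideanSpace.single i 1 := by
  ext j
  simp [momentCoord]

lemma momentCoord_single_inr (i : Fin m) :
    momentCoord (EuclideanSpace.single (Sum.inr i) (1 : ℝ)) = 0 := by
  ext j
  simp [momentCoord]

/-- No differentiability hypothesis is needed: an affine section through `z` recovers `F` from the
composite, so the two are differentiable together, and otherwise both derivatives take the default
value `0`. -/
lemma fderiv_comp_momentCoord (F : EuclideanSpace ℝ (Fin m) → ℝ)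
    (z : EuclideanSpace ℝ (Fin m ⊕ Fin m)) :
    fderiv ℝ (fun w => F (momentCoord w)) z = (fderiv ℝ F (momentCoord z)).comp (momentCoordL m) := by
  by_cases hF : DifferentiableAt ℝ F (momentCoord z)
  · have h := fderiv_comp (g := F) (f := momentCoordL m) z (by simpa using hF)
      (momentCoordL m).differentiableAt
    rw [ContinuousLinearMap.fderiv] at h
    exact h
  · have hG : ¬ DifferentiableAt ℝ (fun w => F (momentCoord w)) z := by
      intro hG
      apply hF
      have hs : DifferentiableAt ℝ (fun x => momentSection m (x - momentCoord z) + z)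
          (momentCoord z) := by fun_prop
      have h := DifferentiableAt.comp (momentCoord z)
        (g := fun w => F (momentCoord w))
        (f := fun x => momentSection m (x - momentCoord z) + z) (by simpa using hG) hs
      have heq : (fun w => F (momentCoord w)) ∘ (fun x => momentSection m (x - momentCoord z) + z)
          = F := by
        funext x
        have : momentCoord (momentSection m (x - momentCoord z) + z) = x := by
          rw [← momentCoordL_apply, map_add, momentCoordL_apply, momentCoord_momentSection,
            momentCoordL_apply, sub_add_cancel]
        simp only [Function.comp_apply, this]
      rwa [heq] at h
    rw [fderiv_zero_of_not_differentiableAt hF, fderiv_zero_of_not_differentiableAt hG]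
    simp

lemma pderiv_inl_comp_momentCoord (F : EuclideanSpace ℝ (Fin m) → ℝ) (i : Fin m)
    (z : EuclideanSpace ℝ (Fin m ⊕ Fin m)) :
    pderiv (Sum.inl i) (fun w => F (momentCoord w)) z = pderiv i F (momentCoord z) := by
  simp [pderiv, fderiv_comp_momentCoord, momentCoord_single_inl]

lemma pderiv_inr_comp_momentCoord (F : EuclideanSpace ℝ (Fin m) → ℝ) (i : Fin m)
    (z : EuclideanSpace ℝ (Fin m ⊕ Fin m)) :
    pderiv (Sum.inr i) (fun w => F (momentCoord w)) z = 0 := by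
  simp [pderiv, fderiv_comp_momentCoord, momentCoord_single_inr]

variable {O : Set (EuclideanSpace ℝ (Fin m))} {Fz : EuclideanSpace ℝ (Fin m ⊕ Fin m) → ℝ}
  {F : EuclideanSpace ℝ (Fin m) → ℝ} {z : EuclideanSpace ℝ (Fin m ⊕ Fin m)}

lemma pderiv_inl_of_eqOn (hO : IsOpen O) (h : ∀ w, momentCoord w ∈ O → Fz w = F (momentCoord w))
    (hz : momentCoord z ∈ O) (i : Fin m) :
    pderiv (Sum.inl i) Fz z = pderiv i F (momentCoord z) := by
  rw [← pderiv_inl_comp_momentCoord]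
  exact pderiv_congr_of_eqOn (hO.preimage continuous_momentCoord) hz _ fun w hw => h w hw

lemma pderiv_inr_of_eqOn (hO : IsOpen O) (h : ∀ w, momentCoord w ∈ O → Fz w = F (momentCoord w))
    (hz : momentCoord z ∈ O) (i : Fin m) :
    pderiv (Sum.inr i) Fz z = 0 := by
  rw [← pderiv_inr_comp_momentCoord F i z]
  exact pderiv_congr_of_eqOn (hO.preimage continuous_momentCoord) hz _ fun w hw => h w hw

end MomentCoordinates

/-! ### Christoffel symbols of the block metric of a Hessian and its inverse. -/

namespace ChartMetric

variable {m : ℕ}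

/-- The metric `∑ U_{ij} dμ_i dμ_j + ∑ H_{ij} dθ_i dθ_j` with coefficients depending only on `μ`. -/
def blockMetric (U H : EuclideanSpace ℝ (Fin m) → Matrix (Fin m) (Fin m) ℝ)
    (z : EuclideanSpace ℝ (Fin m ⊕ Fin m)) : Matrix (Fin m ⊕ Fin m) (Fin m ⊕ Fin m) ℝ :=
  Matrix.fromBlocks (U (momentCoord z)) 0 0 (H (momentCoord z))

/-- A smooth symmetric matrix function `U` whose first derivatives are totally symmetric (as for a
Hessian), together with its inverse `H`. -/
structure IsHessianPair (U H : EuclideanSpace ℝ (Fin m) → Matrix (Fin m) (Fin m) ℝ)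
    (O : Set (EuclideanSpace ℝ (Fin m))) : Prop where
  isOpen : IsOpen O
  contDiffOn_left : ∀ i j, ContDiffOn ℝ ∞ (fun x => U x i j) O
  contDiffOn_right : ∀ i j, ContDiffOn ℝ ∞ (fun x => H x i j) O
  mul_eq_one : ∀ x ∈ O, U x * H x = 1
  left_symm : ∀ x ∈ O, ∀ i j, U x i j = U x j i
  right_symm : ∀ x ∈ O, ∀ i j, H x i j = H x j i
  pderiv_symm : ∀ x ∈ O, ∀ i j k,
    pderiv i (fun y => U y j k) x = pderiv j (fun y => U y i k) x

section BlockEntries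

variable (U H : EuclideanSpace ℝ (Fin m) → Matrix (Fin m) (Fin m) ℝ) (a b i : Fin m)
  (z : EuclideanSpace ℝ (Fin m ⊕ Fin m))

lemma pderiv_inl_blockMetric_inl_inl :
    pderiv (Sum.inl i) (fun y => blockMetric U H y (Sum.inl a) (Sum.inl b)) z =
      pderiv i (fun y => U y a b) (momentCoord z) :=
  pderiv_inl_comp_momentCoord (fun x => U x a b) i z

lemma pderiv_inl_blockMetric_inr_inr :
    pderiv (Sum.inl i) (fun y => blockMetric U H y (Sum.inr a) (Sum.inr b)) z =
      pderiv i (fun y => H y a b) (momentCoord z) :=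
  pderiv_inl_comp_momentCoord (fun x => H x a b) i z

lemma pderiv_inr_blockMetric_inl_inl :
    pderiv (Sum.inr i) (fun y => blockMetric U H y (Sum.inl a) (Sum.inl b)) z = 0 :=
  pderiv_inr_comp_momentCoord (fun x => U x a b) i z

lemma pderiv_inr_blockMetric_inr_inr :
    pderiv (Sum.inr i) (fun y => blockMetric U H y (Sum.inr a) (Sum.inr b)) z = 0 :=
  pderiv_inr_comp_momentCoord (fun x => H x a b) i z

lemma pderiv_blockMetric_inl_inr (k : Fin m ⊕ Fin m) :
    pderiv k (fun y => blockMetric U H y (Sum.inl a) (Sum.inr b)) z = 0 := by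
  simp [blockMetric]

lemma pderiv_blockMetric_inr_inl (k : Fin m ⊕ Fin m) :
    pderiv k (fun y => blockMetric U H y (Sum.inr a) (Sum.inl b)) z = 0 := by
  simp [blockMetric]

end BlockEntries

/-- `∑_l A_{cl} ∂_l B_{ab}`. -/
def raisedDeriv (A B : EuclideanSpace ℝ (Fin m) → Matrix (Fin m) (Fin m) ℝ) (c a b : Fin m)
    (x : EuclideanSpace ℝ (Fin m)) : ℝ :=
  ∑ l, A x c l * pderiv l (fun y => B y a b) x

/-- `∑_l A_{cl} ∂_a B_{lb}`. -/
def mulDeriv (A B : EuclideanSpace ℝ (Fin m) → Matrix (Fin m) (Fin m) ℝ) (a c b : Fin m)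
    (x : EuclideanSpace ℝ (Fin m)) : ℝ :=
  ∑ l, A x c l * pderiv a (fun y => B y l b) x

namespace IsHessianPair

variable {U H : EuclideanSpace ℝ (Fin m) → Matrix (Fin m) (Fin m) ℝ}
  {O : Set (EuclideanSpace ℝ (Fin m))} (h : IsHessianPair U H O)
  {x : EuclideanSpace ℝ (Fin m)} {z : EuclideanSpace ℝ (Fin m ⊕ Fin m)}
include h

lemma mul_eq_one' (hx : x ∈ O) : H x * U x = 1 :=
  mul_eq_one_comm.1 (h.mul_eq_one x hx)

lemma diffAt_left (hx : x ∈ O) (i j : Fin m) : DifferentiableAt ℝ (fun x => U x i j) x :=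
  differentiableAt_of_contDiffOn h.isOpen (h.contDiffOn_left i j) hx

lemma diffAt_right (hx : x ∈ O) (i j : Fin m) : DifferentiableAt ℝ (fun x => H x i j) x :=
  differentiableAt_of_contDiffOn h.isOpen (h.contDiffOn_right i j) hx

lemma diffAt_pderiv_left (hx : x ∈ O) (k i j : Fin m) :
    DifferentiableAt ℝ (pderiv k fun x => U x i j) x :=
  differentiableAt_of_contDiffOn h.isOpen (contDiffOn_pderiv h.isOpen k (h.contDiffOn_left i j)) hx

lemma diffAt_pderiv_right (hx : x ∈ O) (k i j : Fin m) :
    DifferentiableAt ℝ (pderiv k fun x => H x i j) x :=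
  differentiableAt_of_contDiffOn h.isOpen
    (contDiffOn_pderiv h.isOpen k (h.contDiffOn_right i j)) hx

lemma pderiv_left_symm (hx : x ∈ O) (k i j : Fin m) :
    pderiv k (fun y => U y i j) x = pderiv k (fun y => U y j i) x :=
  pderiv_congr_of_eqOn h.isOpen hx k fun y hy => h.left_symm y hy i j

lemma pderiv_right_symm (hx : x ∈ O) (k i j : Fin m) :
    pderiv k (fun y => H y i j) x = pderiv k (fun y => H y j i) x :=
  pderiv_congr_of_eqOn h.isOpen hx k fun y hy => h.right_symm y hy i j

lemma inv_blockMetric (hz : momentCoord z ∈ O) :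
    (blockMetric U H z)⁻¹ =
      Matrix.fromBlocks (H (momentCoord z)) 0 0 (U (momentCoord z)) := by
  apply Matrix.inv_eq_right_inv
  rw [blockMetric, Matrix.fromBlocks_multiply]
  simp [h.mul_eq_one _ hz, h.mul_eq_one' hz]

/-- Total symmetry of `∂U` makes the three terms of the Christoffel symbol equal up to sign, so a
single one survives. -/
lemma christoffel_inl_inl_inl (hz : momentCoord z ∈ O) (c a b : Fin m) :
    christoffel (blockMetric U H) (Sum.inl c) (Sum.inl a) (Sum.inl b) z =
      1 / 2 * raisedDeriv H U c a b (momentCoord z) := by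
  simp only [christoffel, h.inv_blockMetric hz, Fintype.sum_sum_type, Matrix.fromBlocks_apply₁₁,
    Matrix.fromBlocks_apply₁₂, pderiv_inl_blockMetric_inl_inl, Matrix.zero_apply, zero_mul,
    Finset.sum_const_zero, add_zero, raisedDeriv]
  congr 1
  refine Finset.sum_congr rfl fun l _ => ?_
  rw [h.pderiv_symm _ hz a b l, h.pderiv_left_symm hz b a l, h.pderiv_symm _ hz b l a,
    h.pderiv_left_symm hz l b a]
  ring

lemma christoffel_inl_inr_inr (hz : momentCoord z ∈ O) (c a b : Fin m) :
    christoffel (blockMetric U H) (Sum.inl c) (Sum.inr a) (Sum.inr b) z =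
      -(1 / 2) * raisedDeriv H H c a b (momentCoord z) := by
  simp only [christoffel, h.inv_blockMetric hz, Fintype.sum_sum_type, Matrix.fromBlocks_apply₁₁,
    Matrix.fromBlocks_apply₁₂, pderiv_inl_blockMetric_inr_inr, pderiv_blockMetric_inr_inl,
    Matrix.zero_apply, zero_mul, Finset.sum_const_zero, add_zero, raisedDeriv, zero_sub, mul_neg,
    Finset.sum_neg_distrib, neg_mul]

/-- Symbols with an odd number of angle indices vanish, as the isometry `θ ↦ -θ` predicts. -/
lemma christoffel_inl_inl_inr (hz : momentCoord z ∈ O) (c a b : Fin m) :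
    christoffel (blockMetric U H) (Sum.inl c) (Sum.inl a) (Sum.inr b) z = 0 := by
  simp [christoffel, h.inv_blockMetric hz, Fintype.sum_sum_type, pderiv_inr_blockMetric_inl_inl,
    pderiv_blockMetric_inr_inl, pderiv_blockMetric_inl_inr]

lemma christoffel_inl_inr_inl (hz : momentCoord z ∈ O) (c a b : Fin m) :
    christoffel (blockMetric U H) (Sum.inl c) (Sum.inr a) (Sum.inl b) z = 0 := by
  simp [christoffel, h.inv_blockMetric hz, Fintype.sum_sum_type, pderiv_inr_blockMetric_inl_inl,
    pderiv_blockMetric_inr_inl, pderiv_blockMetric_inl_inr]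

lemma christoffel_inr_inl_inl (hz : momentCoord z ∈ O) (c a b : Fin m) :
    christoffel (blockMetric U H) (Sum.inr c) (Sum.inl a) (Sum.inl b) z = 0 := by
  simp [christoffel, h.inv_blockMetric hz, Fintype.sum_sum_type, pderiv_inr_blockMetric_inl_inl,
    pderiv_blockMetric_inl_inr]

lemma christoffel_inr_inr_inr (hz : momentCoord z ∈ O) (c a b : Fin m) :
    christoffel (blockMetric U H) (Sum.inr c) (Sum.inr a) (Sum.inr b) z = 0 := by
  simp [christoffel, h.inv_blockMetric hz, Fintype.sum_sum_type, pderiv_inr_blockMetric_inr_inr]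

lemma christoffel_inr_inl_inr (hz : momentCoord z ∈ O) (c a b : Fin m) :
    christoffel (blockMetric U H) (Sum.inr c) (Sum.inl a) (Sum.inr b) z =
      1 / 2 * mulDeriv U H a c b (momentCoord z) := by
  simp [christoffel, h.inv_blockMetric hz, Fintype.sum_sum_type,
    pderiv_inl_blockMetric_inr_inr, pderiv_blockMetric_inl_inr, mulDeriv,
    h.pderiv_right_symm hz a b]

lemma christoffel_inr_inr_inl (hz : momentCoord z ∈ O) (c a b : Fin m) :
    christoffel (blockMetric U H) (Sum.inr c) (Sum.inr a) (Sum.inl b) z =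
      1 / 2 * mulDeriv U H b c a (momentCoord z) := by
  simp [christoffel, h.inv_blockMetric hz, Fintype.sum_sum_type,
    pderiv_inl_blockMetric_inr_inr, pderiv_blockMetric_inr_inl, pderiv_blockMetric_inl_inr,
    mulDeriv, h.pderiv_right_symm hz b a]

lemma raisedDeriv_eq_mulDeriv (hx : x ∈ O) (c a b : Fin m) :
    raisedDeriv H U c a b x = mulDeriv H U a c b x :=
  Finset.sum_congr rfl fun l _ => by rw [h.pderiv_symm _ hx l a b]

/-- The Leibniz rule applied to `U H = 1`; every formula for `∂H` below comes from it. -/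
lemma pderiv_mul_eq_zero (hx : x ∈ O) (k i j : Fin m) :
    ∑ l, (pderiv k (fun y => U y i l) x * H x l j + U x i l * pderiv k (fun y => H y l j) x) = 0 := by
  have h1 : pderiv k (fun y => ∑ l, U y i l * H y l j) x = 0 := by
    rw [pderiv_congr_of_eqOn (G := fun _ => (1 : Matrix (Fin m) (Fin m) ℝ) i j) h.isOpen hx k]
    · simp
    · intro y hy
      simp only [← h.mul_eq_one y hy, Matrix.mul_apply]
  rw [pderiv_sum k _ fun l _ => (h.diffAt_left hx i l).fun_mul (h.diffAt_right hx l j)] at h1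
  rw [← h1]
  exact Finset.sum_congr rfl fun l _ =>
    (pderiv_mul k (h.diffAt_left hx i l) (h.diffAt_right hx l j)).symm

/-- `U ∂_k H = - (∂_k U) H`. -/
lemma mulDeriv_left (hx : x ∈ O) (k i j : Fin m) :
    mulDeriv U H k i j x = -∑ l, pderiv k (fun y => U y i l) x * H x l j := by
  have := h.pderiv_mul_eq_zero hx k i j
  rw [Finset.sum_add_distrib] at this
  simp only [mulDeriv]
  linarith

/-- `U ∂_k H = - (H ∂_k U)ᵀ`. -/
lemma mulDeriv_left_eq_neg_mulDeriv_right (hx : x ∈ O) (k i j : Fin m) :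
    mulDeriv U H k i j x = -mulDeriv H U k j i x := by
  rw [h.mulDeriv_left hx, mulDeriv]
  congr 1
  refine Finset.sum_congr rfl fun l _ => ?_
  rw [h.pderiv_left_symm hx k i l, h.right_symm x hx l j, mul_comm]

/-- `∂_k H = - H (∂_k U) H`. -/
lemma pderiv_right (hx : x ∈ O) (k i j : Fin m) :
    pderiv k (fun y => H y i j) x =
      -∑ a, ∑ b, H x i a * pderiv k (fun y => U y a b) x * H x b j := by
  have h1 : ∑ a, H x i a * mulDeriv U H k a j x = pderiv k (fun y => H y i j) x := by
    simp only [mulDeriv, Finset.mul_sum, ← mul_assoc]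
    rw [Finset.sum_comm]
    simp only [← Finset.sum_mul, ← Matrix.mul_apply, h.mul_eq_one' hx, Matrix.one_apply]
    simp
  rw [← h1, ← Finset.sum_neg_distrib]
  refine Finset.sum_congr rfl fun a _ => ?_
  rw [h.mulDeriv_left hx, mul_neg, Finset.mul_sum]
  simp only [mul_assoc]

/-- The vector `∑_l H_{cl} tr(H ∂_l U)` is minus the divergence of `H`. -/
lemma sum_right_mul_raisedDeriv (hx : x ∈ O) (c : Fin m) :
    ∑ a, ∑ b, H x a b * raisedDeriv H U c a b x = -∑ j, pderiv j (fun y => H y c j) x := by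
  simp only [h.pderiv_right hx, Finset.sum_neg_distrib, neg_neg, raisedDeriv, Finset.mul_sum]
  rw [Finset.sum_comm]
  refine Finset.sum_congr rfl fun b _ => ?_
  rw [Finset.sum_comm]
  refine Finset.sum_congr rfl fun l _ => Finset.sum_congr rfl fun a _ => ?_
  rw [h.pderiv_symm x hx l a b, h.pderiv_left_symm hx a l b, h.pderiv_symm x hx a b l,
    h.pderiv_left_symm hx b a l]
  ring

lemma trace_mulDeriv (hx : x ∈ O) (k : Fin m) :
    ∑ a, mulDeriv U H k a a x = -∑ a, mulDeriv H U k a a x := by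
  simp only [h.mulDeriv_left_eq_neg_mulDeriv_right hx, Finset.sum_neg_distrib]

/-- Since `tr(U ∂_l H) = -tr(H ∂_l U)`, this is the negative of the contraction in
`sum_right_mul_raisedDeriv`. -/
lemma sum_left_mul_raisedDeriv (hx : x ∈ O) (c : Fin m) :
    ∑ a, ∑ b, U x a b * raisedDeriv H H c a b x = ∑ j, pderiv j (fun y => H y c j) x := by
  have h1 : ∑ a, ∑ b, U x a b * raisedDeriv H H c a b x =
      ∑ l, H x c l * ∑ a, mulDeriv U H l a a x := by
    simp only [raisedDeriv, mulDeriv, Finset.mul_sum]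
    rw [Finset.sum_comm_cycle]
    refine Finset.sum_congr rfl fun l _ => Finset.sum_congr rfl fun a _ =>
      Finset.sum_congr rfl fun b _ => ?_
    rw [h.pderiv_right_symm hx l a b]
    ring
  have h2 : ∑ a, ∑ b, H x a b * raisedDeriv H U c a b x =
      ∑ l, H x c l * ∑ a, mulDeriv H U l a a x := by
    simp only [raisedDeriv, mulDeriv, Finset.mul_sum]
    rw [Finset.sum_comm_cycle]
    refine Finset.sum_congr rfl fun l _ => Finset.sum_congr rfl fun a _ =>
      Finset.sum_congr rfl fun b _ => ?_
    rw [h.pderiv_left_symm hx l a b]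
    ring
  have h3 := h.sum_right_mul_raisedDeriv hx c
  rw [h1]
  simp only [h.trace_mulDeriv hx, mul_neg, Finset.sum_neg_distrib]
  rw [← h2, h3, neg_neg]

/-- The contracted symbol is the logarithmic derivative of the volume density, which is constant
because `det U · det H = 1`. In the computation the two blocks contribute opposite traces. -/
lemma sum_christoffel_left (hz : momentCoord z ∈ O) (i : Fin m ⊕ Fin m) :
    ∑ k, christoffel (blockMetric U H) k k i z = 0 := by
  rw [Fintype.sum_sum_type]
  obtain i | i := i
  · simp only [h.christoffel_inl_inl_inl hz, h.christoffel_inr_inr_inl hz, ← Finset.mul_sum,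
      h.trace_mulDeriv hz]
    have : ∀ c, raisedDeriv H U c c i (momentCoord z) = mulDeriv H U i c c (momentCoord z) := by
      intro c
      refine Finset.sum_congr rfl fun l _ => ?_
      rw [h.pderiv_left_symm hz l c i, h.pderiv_symm _ hz l i c]
    simp only [this]
    ring
  · simp [h.christoffel_inl_inl_inr hz, h.christoffel_inr_inr_inr hz]

lemma sum_christoffel_right (hz : momentCoord z ∈ O) (i : Fin m ⊕ Fin m) :
    ∑ k, christoffel (blockMetric U H) k i k z = 0 := by
  rw [← h.sum_christoffel_left hz i, Fintype.sum_sum_type, Fintype.sum_sum_type]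
  obtain i | i := i
  · simp only [h.christoffel_inl_inl_inl hz, h.christoffel_inr_inr_inl hz,
      h.christoffel_inr_inl_inr hz, raisedDeriv]
    congr 1
    refine Finset.sum_congr rfl fun c _ => ?_
    congr 1
    exact Finset.sum_congr rfl fun l _ => by rw [h.pderiv_left_symm hz l i c]
  · simp [h.christoffel_inl_inl_inr hz, h.christoffel_inr_inr_inr hz, h.christoffel_inl_inr_inl hz]

end IsHessianPair

end ChartMetric

/-! ### Ricci tensor and Abreu's formula. -/

namespace ChartMetric

variable {m : ℕ}

lemma differentiableAt_of_eqOn_momentCoord {O : Set (EuclideanSpace ℝ (Fin m))} (hO : IsOpen O)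
    {Fz : EuclideanSpace ℝ (Fin m ⊕ Fin m) → ℝ} {F : EuclideanSpace ℝ (Fin m) → ℝ}
    {z : EuclideanSpace ℝ (Fin m ⊕ Fin m)}
    (h : ∀ w, momentCoord w ∈ O → Fz w = F (momentCoord w)) (hz : momentCoord z ∈ O)
    (hF : DifferentiableAt ℝ F (momentCoord z)) : DifferentiableAt ℝ Fz z := by
  have h1 : DifferentiableAt ℝ (fun w => F (momentCoord w)) z :=
    DifferentiableAt.comp z (g := F) (f := momentCoordL m) hF (momentCoordL m).differentiableAt
  refine h1.congr_of_eventuallyEq ?_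
  filter_upwards [(hO.preimage continuous_momentCoord).mem_nhds hz] with w hw using h w hw

lemma sum_left_mul_raisedDeriv_eq
    (U H : EuclideanSpace ℝ (Fin m) → Matrix (Fin m) (Fin m) ℝ) (x : EuclideanSpace ℝ (Fin m)) (c a b : Fin m) :
    ∑ l, U x a l * raisedDeriv H H c l b x = ∑ l, H x c l * mulDeriv U H l a b x := by
  simp only [raisedDeriv, mulDeriv, Finset.mul_sum]
  rw [Finset.sum_comm]
  refine Finset.sum_congr rfl fun l _ => Finset.sum_congr rfl fun a _ => ?_
  ring

namespace IsHessianPair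

variable {U H : EuclideanSpace ℝ (Fin m) → Matrix (Fin m) (Fin m) ℝ}
  {O : Set (EuclideanSpace ℝ (Fin m))} (h : IsHessianPair U H O)
  {x : EuclideanSpace ℝ (Fin m)} {z : EuclideanSpace ℝ (Fin m ⊕ Fin m)}
include h

lemma diffAt_raisedDeriv_right_left (hx : x ∈ O) (c a b : Fin m) :
    DifferentiableAt ℝ (raisedDeriv H U c a b) x :=
  DifferentiableAt.fun_sum fun l _ =>
    (h.diffAt_right hx c l).fun_mul (h.diffAt_pderiv_left hx l a b)

lemma diffAt_raisedDeriv_right_right (hx : x ∈ O) (c a b : Fin m) :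
    DifferentiableAt ℝ (raisedDeriv H H c a b) x :=
  DifferentiableAt.fun_sum fun l _ =>
    (h.diffAt_right hx c l).fun_mul (h.diffAt_pderiv_right hx l a b)

lemma diffAt_mulDeriv (hx : x ∈ O) (c a b : Fin m) :
    DifferentiableAt ℝ (mulDeriv U H c a b) x :=
  DifferentiableAt.fun_sum fun l _ =>
    (h.diffAt_left hx a l).fun_mul (h.diffAt_pderiv_right hx c l b)

lemma diffAt_christoffel (hz : momentCoord z ∈ O) (k i j : Fin m ⊕ Fin m) :
    DifferentiableAt ℝ (christoffel (blockMetric U H) k i j) z := by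
  obtain k | k := k <;> obtain i | i := i <;> obtain j | j := j
  · exact differentiableAt_of_eqOn_momentCoord h.isOpen
      (fun w hw => h.christoffel_inl_inl_inl hw k i j) hz
      ((h.diffAt_raisedDeriv_right_left hz k i j).const_mul _)
  · exact differentiableAt_of_eqOn_momentCoord (F := fun _ => 0) h.isOpen
      (fun w hw => h.christoffel_inl_inl_inr hw k i j) hz (differentiableAt_const _)
  · exact differentiableAt_of_eqOn_momentCoord (F := fun _ => 0) h.isOpen
      (fun w hw => h.christoffel_inl_inr_inl hw k i j) hz (differentiableAt_const _)
  · exact differentiableAt_of_eqOn_momentCoord h.isOpen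
      (fun w hw => h.christoffel_inl_inr_inr hw k i j) hz
      ((h.diffAt_raisedDeriv_right_right hz k i j).const_mul _)
  · exact differentiableAt_of_eqOn_momentCoord (F := fun _ => 0) h.isOpen
      (fun w hw => h.christoffel_inr_inl_inl hw k i j) hz (differentiableAt_const _)
  · exact differentiableAt_of_eqOn_momentCoord h.isOpen
      (fun w hw => h.christoffel_inr_inl_inr hw k i j) hz
      ((h.diffAt_mulDeriv hz i k j).const_mul _)
  · exact differentiableAt_of_eqOn_momentCoord h.isOpen
      (fun w hw => h.christoffel_inr_inr_inl hw k i j) hz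
      ((h.diffAt_mulDeriv hz j k i).const_mul _)
  · exact differentiableAt_of_eqOn_momentCoord (F := fun _ => 0) h.isOpen
      (fun w hw => h.christoffel_inr_inr_inr hw k i j) hz (differentiableAt_const _)

/-- The Ricci tensor of a metric of constant volume density. -/
lemma ricci_eq (hz : momentCoord z ∈ O) (i j : Fin m ⊕ Fin m) :
    ricci (blockMetric U H) i j z =
      ∑ k, pderiv k (christoffel (blockMetric U H) k i j) z -
        ∑ k, ∑ l, christoffel (blockMetric U H) k j l z * christoffel (blockMetric U H) l i k z := by
  have h1 : ∑ k, pderiv j (christoffel (blockMetric U H) k i k) z = 0 := by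
    rw [← pderiv_sum j _ fun k _ => h.diffAt_christoffel hz k i k]
    rw [pderiv_congr_of_eqOn (G := fun _ => 0) (h.isOpen.preimage continuous_momentCoord) hz]
    · simp
    · exact fun w hw => h.sum_christoffel_right hw i
  have h2 : ∑ k, ∑ l, christoffel (blockMetric U H) k k l z * christoffel (blockMetric U H) l i j z
      = 0 := by
    rw [Finset.sum_comm]
    simp [← Finset.sum_mul, h.sum_christoffel_left hz]
  simp only [ricci, Finset.sum_sub_distrib, h1, h2]
  ring

lemma ricci_inl_inl (hz : momentCoord z ∈ O) (a b : Fin m) :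
    ricci (blockMetric U H) (Sum.inl a) (Sum.inl b) z =
      1 / 2 * ∑ c, pderiv c (raisedDeriv H U c a b) (momentCoord z) -
        1 / 2 * ∑ c, ∑ d, mulDeriv U H b c d (momentCoord z) * mulDeriv U H a d c (momentCoord z) := by
  have h1 : ∀ c, pderiv (Sum.inl c) (christoffel (blockMetric U H) (Sum.inl c) (Sum.inl a)
      (Sum.inl b)) z = 1 / 2 * pderiv c (raisedDeriv H U c a b) (momentCoord z) := by
    intro c
    rw [pderiv_inl_of_eqOn (F := fun x => 1 / 2 * raisedDeriv H U c a b x) h.isOpen (fun w hw => h.christoffel_inl_inl_inl hw c a b) hz,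
      pderiv_const_mul _ _ (h.diffAt_raisedDeriv_right_left hz c a b)]
  have h2 : ∀ c, pderiv (Sum.inr c) (christoffel (blockMetric U H) (Sum.inr c) (Sum.inl a)
      (Sum.inl b)) z = 0 := fun c =>
    pderiv_inr_of_eqOn (F := fun _ => 0) h.isOpen
      (fun w hw => h.christoffel_inr_inl_inl hw c a b) hz c
  -- The moment and angle indices give the same quadratic term: `H ∂U` and `U ∂H` are negative
  -- transposes of each other, and the signs cancel in a product of two. Two quarters make the
  -- coefficient `1/2`.
  have h3 : ∑ c, ∑ d, raisedDeriv H U c b d (momentCoord z) * raisedDeriv H U d a c (momentCoord z)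
      = ∑ c, ∑ d, mulDeriv U H b c d (momentCoord z) * mulDeriv U H a d c (momentCoord z) := by
    rw [Finset.sum_comm]
    refine Finset.sum_congr rfl fun c _ => Finset.sum_congr rfl fun d _ => ?_
    rw [h.raisedDeriv_eq_mulDeriv hz, h.raisedDeriv_eq_mulDeriv hz,
      h.mulDeriv_left_eq_neg_mulDeriv_right hz, h.mulDeriv_left_eq_neg_mulDeriv_right hz]
    ring
  rw [h.ricci_eq hz]
  simp only [Fintype.sum_sum_type, h1, h2, h.christoffel_inl_inl_inl hz,
    h.christoffel_inl_inl_inr hz, h.christoffel_inr_inl_inl hz, h.christoffel_inr_inl_inr hz,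
    zero_mul, add_zero, zero_add, Finset.sum_const_zero]
  have h4 : ∀ p q : ℝ, 1 / 2 * p * (1 / 2 * q) = 1 / 4 * (p * q) := fun p q => by ring
  simp only [h4, ← Finset.mul_sum, h3]
  ring

lemma ricci_inr_inr (hz : momentCoord z ∈ O) (a b : Fin m) :
    ricci (blockMetric U H) (Sum.inr a) (Sum.inr b) z =
      -(1 / 2) * ∑ c, pderiv c (raisedDeriv H H c a b) (momentCoord z) +
        1 / 4 * (∑ c, ∑ d,
            raisedDeriv H H c b d (momentCoord z) * mulDeriv U H c d a (momentCoord z) +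
          ∑ c, ∑ d,
            mulDeriv U H d c b (momentCoord z) * raisedDeriv H H d a c (momentCoord z)) := by
  have h1 : ∀ c, pderiv (Sum.inl c) (christoffel (blockMetric U H) (Sum.inl c) (Sum.inr a)
      (Sum.inr b)) z = -(1 / 2) * pderiv c (raisedDeriv H H c a b) (momentCoord z) := by
    intro c
    rw [pderiv_inl_of_eqOn (F := fun x => -(1 / 2) * raisedDeriv H H c a b x) h.isOpen (fun w hw => h.christoffel_inl_inr_inr hw c a b) hz,
      pderiv_const_mul _ _ (h.diffAt_raisedDeriv_right_right hz c a b)]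
  have h2 : ∀ c, pderiv (Sum.inr c) (christoffel (blockMetric U H) (Sum.inr c) (Sum.inr a)
      (Sum.inr b)) z = 0 := fun c =>
    pderiv_inr_of_eqOn (F := fun _ => 0) h.isOpen
      (fun w hw => h.christoffel_inr_inr_inr hw c a b) hz c
  rw [h.ricci_eq hz]
  simp only [Fintype.sum_sum_type, h1, h2, h.christoffel_inl_inr_inr hz,
    h.christoffel_inl_inr_inl hz, h.christoffel_inr_inr_inl hz, h.christoffel_inr_inr_inr hz,
    zero_mul, add_zero, zero_add, Finset.sum_const_zero]
  have h4 : ∀ p q : ℝ, -(1 / 2) * p * (1 / 2 * q) = -(1 / 4) * (p * q) := fun p q => by ring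
  have h5 : ∀ p q : ℝ, 1 / 2 * p * (-(1 / 2) * q) = -(1 / 4) * (p * q) := fun p q => by ring
  simp only [h4, h5, ← Finset.mul_sum]
  ring

/-- Contraction with `U` moves the raised index and turns the quadratic part of the angular Ricci
block into that of the moment block. With the weights `1/4` and `-1/2` of the two blocks, the factor
`2` makes the quadratic terms cancel in the scalar curvature. -/
lemma sum_left_mul_quadratic (hx : x ∈ O) :
    ∑ a, ∑ b, U x a b * (∑ c, ∑ d, raisedDeriv H H c b d x * mulDeriv U H c d a x +
        ∑ c, ∑ d, mulDeriv U H d c b x * raisedDeriv H H d a c x) =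
      2 * ∑ a, ∑ b, H x a b * ∑ c, ∑ d, mulDeriv U H b c d x * mulDeriv U H a d c x := by
  have h1 : ∑ a, ∑ b, U x a b * ∑ c, ∑ d, raisedDeriv H H c b d x * mulDeriv U H c d a x =
      ∑ a, ∑ b, H x a b * ∑ c, ∑ d, mulDeriv U H b c d x * mulDeriv U H a d c x := by
    calc _ = ∑ c, ∑ a, ∑ d, (∑ b, U x a b * raisedDeriv H H c b d x) * mulDeriv U H c d a x := by
          simp only [Finset.mul_sum, Finset.sum_mul, mul_assoc]
          conv_rhs => rw [Finset.sum_comm]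
          refine Finset.sum_congr rfl fun a _ => ?_
          conv_rhs => rw [Finset.sum_comm_cycle]
      _ = _ := by
          simp only [sum_left_mul_raisedDeriv_eq, Finset.mul_sum, Finset.sum_mul, mul_assoc]
          refine Finset.sum_congr rfl fun a _ => ?_
          rw [Finset.sum_comm_cycle]
  have h2 : ∑ a, ∑ b, U x a b * ∑ c, ∑ d, mulDeriv U H d c b x * raisedDeriv H H d a c x =
      ∑ a, ∑ b, U x a b * ∑ c, ∑ d, raisedDeriv H H c b d x * mulDeriv U H c d a x := by
    rw [Finset.sum_comm]
    refine Finset.sum_congr rfl fun a _ => Finset.sum_congr rfl fun b _ => ?_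
    rw [h.left_symm x hx b a, Finset.sum_comm]
    simp only [mul_comm]
  simp only [mul_add, Finset.sum_add_distrib]
  rw [h2, h1]
  ring

/-- **Abreu's formula**: the scalar curvature is `-∑ ∂_i ∂_j H_{ij}`. -/
theorem scalarCurvature_blockMetric (hz : momentCoord z ∈ O) :
    scalarCurvature (blockMetric U H) z =
      -∑ i, ∑ j, pderiv i (pderiv j fun y => H y i j) (momentCoord z) := by
  set x := momentCoord z with hxdef
  -- Here and in `e2` the two contraction identities with the divergence of `H` are differentiated
  -- once more; the second-derivative terms are those of the two Ricci blocks.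
  have e1 : ∀ c, ∑ a, ∑ b, (pderiv c (fun y => H y a b) x * raisedDeriv H U c a b x +
      H x a b * pderiv c (raisedDeriv H U c a b) x) =
      -∑ j, pderiv c (pderiv j fun y => H y c j) x := by
    intro c
    have := pderiv_congr_of_eqOn (F := fun y => ∑ a, ∑ b, H y a b * raisedDeriv H U c a b y)
      (G := fun y => -1 * ∑ j, pderiv j (fun y => H y c j) y) h.isOpen hz c (fun y hy => by
        simp only [h.sum_right_mul_raisedDeriv hy c, neg_mul, one_mul])
    rw [pderiv_const_mul _ _ (DifferentiableAt.fun_sum fun j _ => h.diffAt_pderiv_right hz _ _ _),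
      pderiv_sum _ _ (fun j _ => h.diffAt_pderiv_right hz _ _ _),
      pderiv_sum _ _ (fun a _ => DifferentiableAt.fun_sum fun b _ =>
        (h.diffAt_right hz a b).fun_mul (h.diffAt_raisedDeriv_right_left hz c a b)), neg_one_mul]
      at this
    rw [← this]
    refine Finset.sum_congr rfl fun a _ => ?_
    rw [pderiv_sum _ _ (fun b _ =>
        (h.diffAt_right hz a b).fun_mul (h.diffAt_raisedDeriv_right_left hz c a b))]
    exact Finset.sum_congr rfl fun b _ =>
      (pderiv_mul _ (h.diffAt_right hz a b) (h.diffAt_raisedDeriv_right_left hz c a b)).symm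
  have e2 : ∀ c, ∑ a, ∑ b, (pderiv c (fun y => U y a b) x * raisedDeriv H H c a b x +
      U x a b * pderiv c (raisedDeriv H H c a b) x) =
      ∑ j, pderiv c (pderiv j fun y => H y c j) x := by
    intro c
    have := pderiv_congr_of_eqOn (F := fun y => ∑ a, ∑ b, U y a b * raisedDeriv H H c a b y)
      (G := fun y => ∑ j, pderiv j (fun y => H y c j) y) h.isOpen hz c (fun y hy => by
        simp only [h.sum_left_mul_raisedDeriv hy c])
    rw [pderiv_sum _ _ (fun j _ => h.diffAt_pderiv_right hz _ _ _),
      pderiv_sum _ _ (fun a _ => DifferentiableAt.fun_sum fun b _ =>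
        (h.diffAt_left hz a b).fun_mul (h.diffAt_raisedDeriv_right_right hz c a b))]
      at this
    rw [← this]
    refine Finset.sum_congr rfl fun a _ => ?_
    rw [pderiv_sum _ _ (fun b _ =>
        (h.diffAt_left hz a b).fun_mul (h.diffAt_raisedDeriv_right_right hz c a b))]
    exact Finset.sum_congr rfl fun b _ =>
      (pderiv_mul _ (h.diffAt_left hz a b) (h.diffAt_raisedDeriv_right_right hz c a b)).symm
  -- The products of first derivatives in `e1` and `e2` agree after exchanging the summation indices
  -- `c` and `l`, by symmetry of `H`. They drop out of the difference of the two identities.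
  have e3 : ∑ c, ∑ a, ∑ b, pderiv c (fun y => H y a b) x * raisedDeriv H U c a b x =
      ∑ c, ∑ a, ∑ b, pderiv c (fun y => U y a b) x * raisedDeriv H H c a b x := by
    simp only [raisedDeriv, Finset.mul_sum]
    have : ∀ T : Fin m → Fin m → Fin m → Fin m → ℝ,
        ∑ c, ∑ a, ∑ b, ∑ l, T c a b l = ∑ c, ∑ a, ∑ b, ∑ l, T l a b c := by
      intro T
      calc _ = ∑ c, ∑ l, ∑ a, ∑ b, T c a b l := by
            refine Finset.sum_congr rfl fun c _ => ?_
            rw [Finset.sum_comm_cycle]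
        _ = ∑ l, ∑ c, ∑ a, ∑ b, T c a b l := Finset.sum_comm
        _ = _ := by
            refine Finset.sum_congr rfl fun c _ => ?_
            rw [← Finset.sum_comm_cycle]
    rw [this]
    refine Finset.sum_congr rfl fun c _ => Finset.sum_congr rfl fun a _ =>
      Finset.sum_congr rfl fun b _ => Finset.sum_congr rfl fun l _ => ?_
    rw [h.right_symm x hz l c]
    ring
  have e4 := h.sum_left_mul_quadratic hz
  simp only [scalarCurvature, Fintype.sum_sum_type, h.inv_blockMetric hz,
    Matrix.fromBlocks_apply₁₁, Matrix.fromBlocks_apply₁₂, Matrix.fromBlocks_apply₂₁,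
    Matrix.fromBlocks_apply₂₂, Matrix.zero_apply, zero_mul, Finset.sum_const_zero, add_zero,
    zero_add, h.ricci_inl_inl hz, h.ricci_inr_inr hz]
  rw [← hxdef]
  have e1' := Finset.sum_congr (rfl : (Finset.univ : Finset (Fin m)) = _) fun c _ => e1 c
  have e2' := Finset.sum_congr (rfl : (Finset.univ : Finset (Fin m)) = _) fun c _ => e2 c
  simp only [Finset.sum_add_distrib, Finset.sum_neg_distrib] at e1' e2'
  have f1 : ∑ a, ∑ b, H x a b * ∑ c, pderiv c (raisedDeriv H U c a b) x =
      ∑ c, ∑ a, ∑ b, H x a b * pderiv c (raisedDeriv H U c a b) x := by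
    simp only [Finset.mul_sum]
    rw [Finset.sum_comm_cycle]
  have f2 : ∑ a, ∑ b, U x a b * ∑ c, pderiv c (raisedDeriv H H c a b) x =
      ∑ c, ∑ a, ∑ b, U x a b * pderiv c (raisedDeriv H H c a b) x := by
    simp only [Finset.mul_sum]
    rw [Finset.sum_comm_cycle]
  have g1 : ∀ p q r : ℝ, p * (1 / 2 * q - 1 / 2 * r) = 1 / 2 * (p * q) - 1 / 2 * (p * r) :=
    fun p q r => by ring
  have g2 : ∀ p q r : ℝ, p * (-(1 / 2) * q + 1 / 4 * r) = -(1 / 2) * (p * q) + 1 / 4 * (p * r) :=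
    fun p q r => by ring
  simp only [g1, g2, Finset.sum_sub_distrib, Finset.sum_add_distrib, ← Finset.mul_sum, e4]
  rw [f1, f2]
  linarith

end IsHessianPair

end ChartMetric

/-! ### The weighted scalar curvature for affine `f`. -/

namespace ChartMetric

variable {m : ℕ}

lemma pderiv_rpow {ι : Type} [Fintype ι] [DecidableEq ι] {F : EuclideanSpace ℝ ι → ℝ}
    {x : EuclideanSpace ℝ ι} (i : ι) (p : ℝ) (hF : DifferentiableAt ℝ F x) (hx : 0 < F x) :
    pderiv i (fun y => F y ^ p) x = p * F x ^ (p - 1) * pderiv i F x := by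
  rw [pderiv, (hF.hasFDerivAt.rpow_const (p := p) (Or.inl hx.ne')).fderiv]
  simp [pderiv]

lemma hasFDerivAt_affineMap {E : Type*} [NormedAddCommGroup E] [NormedSpace ℝ E]
    [FiniteDimensional ℝ E] (f : E →ᵃ[ℝ] ℝ) (x : E) :
    HasFDerivAt f (LinearMap.toContinuousLinearMap f.linear) x := by
  have h := ((LinearMap.toContinuousLinearMap f.linear).hasFDerivAt (x := x)).add_const (f 0)
  refine h.congr_of_eventuallyEq (Filter.Eventually.of_forall fun y => ?_)
  have := congrFun f.decomp y
  simpa using this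

lemma contDiff_affineMap {E : Type*} [NormedAddCommGroup E] [NormedSpace ℝ E]
    [FiniteDimensional ℝ E] (f : E →ᵃ[ℝ] ℝ) : ContDiff ℝ ∞ f := by
  have h := ((LinearMap.toContinuousLinearMap f.linear).contDiff (n := ∞)).add
    (contDiff_const (c := f 0))
  have e : (f : E → ℝ) = fun y => LinearMap.toContinuousLinearMap f.linear y + f 0 := by
    funext y
    simpa using congrFun f.decomp y
  rw [e]
  exact h

lemma pderiv_affineMap {ι : Type} [Fintype ι] [DecidableEq ι]
    (f : EuclideanSpace ℝ ι →ᵃ[ℝ] ℝ) (i : ι) (x : EuclideanSpace ℝ ι) :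
    pderiv i f x = f.linear (EuclideanSpace.single i 1) := by
  rw [pderiv, (hasFDerivAt_affineMap f x).fderiv]
  rfl

namespace IsHessianPair

variable {U H : EuclideanSpace ℝ (Fin m) → Matrix (Fin m) (Fin m) ℝ}
  {O : Set (EuclideanSpace ℝ (Fin m))} (h : IsHessianPair U H O)
  {x : EuclideanSpace ℝ (Fin m)} {z : EuclideanSpace ℝ (Fin m ⊕ Fin m)}
include h

/-- The second derivatives of `f` vanish, so only traces of Christoffel symbols remain; the moment
block and the angle block each contribute half of the divergence of `H`. -/
lemma hodgeLaplacian_affine (f : EuclideanSpace ℝ (Fin m) →ᵃ[ℝ] ℝ) (hz : momentCoord z ∈ O) :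
    hodgeLaplacian (blockMetric U H) (fun w => f (momentCoord w)) z =
      -∑ i, ∑ j, f.linear (EuclideanSpace.single i 1) *
        pderiv j (fun y => H y i j) (momentCoord z) := by
  have d1 : ∀ k, pderiv (Sum.inl k) (fun w => f (momentCoord w)) =
      fun _ => f.linear (EuclideanSpace.single k 1) := fun k => by
    funext w
    rw [pderiv_inl_comp_momentCoord f, pderiv_affineMap]
  have d2 : ∀ k, pderiv (Sum.inr k) (fun w => f (momentCoord w)) = fun _ => 0 := fun k => by
    funext w
    rw [pderiv_inr_comp_momentCoord f]
  have e1 : ∀ c, ∑ a, ∑ b, H (momentCoord z) a b * (1 / 2 * raisedDeriv H U c a b (momentCoord z)) =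
      -(1 / 2) * ∑ j, pderiv j (fun y => H y c j) (momentCoord z) := fun c => by
    have := h.sum_right_mul_raisedDeriv hz c
    simp only [mul_left_comm _ (1 / 2 : ℝ), ← Finset.mul_sum, this]
    ring
  have e2 : ∀ c, ∑ a, ∑ b, U (momentCoord z) a b *
      (-(1 / 2) * raisedDeriv H H c a b (momentCoord z)) =
      -(1 / 2) * ∑ j, pderiv j (fun y => H y c j) (momentCoord z) := fun c => by
    have := h.sum_left_mul_raisedDeriv hz c
    simp only [mul_left_comm _ (-(1 / 2) : ℝ), ← Finset.mul_sum, this]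
  have swap : ∀ (A : Matrix (Fin m) (Fin m) ℝ) (T : Fin m → Fin m → Fin m → ℝ) (v : Fin m → ℝ),
      ∑ a, ∑ b, A a b * ∑ c, T c a b * v c = ∑ c, v c * ∑ a, ∑ b, A a b * T c a b := by
    intro A T v
    simp only [Finset.mul_sum]
    rw [Finset.sum_comm_cycle]
    refine Finset.sum_congr rfl fun c _ => Finset.sum_congr rfl fun a _ =>
      Finset.sum_congr rfl fun b _ => by ring
  simp only [hodgeLaplacian, Fintype.sum_sum_type, h.inv_blockMetric hz, d1, d2,
    Matrix.fromBlocks_apply₁₁, Matrix.fromBlocks_apply₁₂, Matrix.fromBlocks_apply₂₁,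
    Matrix.fromBlocks_apply₂₂, Matrix.zero_apply, zero_mul, mul_zero, Finset.sum_const_zero,
    add_zero, zero_add, pderiv_const, zero_sub, neg_zero, h.christoffel_inl_inl_inl hz,
    h.christoffel_inl_inr_inr hz, mul_neg, Finset.sum_neg_distrib]
  rw [swap, swap _ fun c a b => -(1 / 2) * raisedDeriv H H c a b (momentCoord z)]
  simp only [e1, e2, ← Finset.mul_sum]
  rw [← neg_add, ← Finset.sum_add_distrib, neg_neg, ← Finset.sum_neg_distrib]
  exact Finset.sum_congr rfl fun c _ => by ring

lemma normSqDifferential_affine (f : EuclideanSpace ℝ (Fin m) →ᵃ[ℝ] ℝ) (hz : momentCoord z ∈ O) :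
    normSqDifferential (blockMetric U H) (fun w => f (momentCoord w)) z =
      ∑ i, ∑ j, H (momentCoord z) i j * f.linear (EuclideanSpace.single i 1) *
        f.linear (EuclideanSpace.single j 1) := by
  have d1 : ∀ k, pderiv (Sum.inl k) (fun w => f (momentCoord w)) z =
      f.linear (EuclideanSpace.single k 1) := fun k => by
    rw [pderiv_inl_comp_momentCoord f, pderiv_affineMap]
  have d2 : ∀ k, pderiv (Sum.inr k) (fun w => f (momentCoord w)) z = 0 := fun k =>
    pderiv_inr_comp_momentCoord f k z
  simp [normSqDifferential, Fintype.sum_sum_type, h.inv_blockMetric hz, d1, d2]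

lemma pderiv_rpow_mul_right (f : EuclideanSpace ℝ (Fin m) →ᵃ[ℝ] ℝ) (p : ℝ) (hx : x ∈ O)
    (hf : 0 < f x) (k i j : Fin m) :
    pderiv k (fun y => f y ^ p * H y i j) x =
      p * f.linear (EuclideanSpace.single k 1) * (f x ^ (p - 1) * H x i j) +
        f x ^ p * pderiv k (fun y => H y i j) x := by
  have hd := (contDiff_affineMap f).differentiable (by simp) x
  rw [pderiv_mul _ (hd.rpow_const (Or.inl hf.ne')) (h.diffAt_right hx i j),
    pderiv_rpow _ _ hd hf, pderiv_affineMap]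
  ring

lemma pderiv_pderiv_rpow_mul_right (f : EuclideanSpace ℝ (Fin m) →ᵃ[ℝ] ℝ) (p : ℝ)
    (hf : ∀ x ∈ O, 0 < f x) (hx : x ∈ O) (i j : Fin m) :
    pderiv i (pderiv j fun y => f y ^ p * H y i j) x =
      p * (p - 1) * f x ^ (p - 2) * (H x i j * f.linear (EuclideanSpace.single i 1) *
        f.linear (EuclideanSpace.single j 1)) +
      p * f x ^ (p - 1) * (f.linear (EuclideanSpace.single j 1) * pderiv i (fun y => H y i j) x) +
      p * f x ^ (p - 1) * (f.linear (EuclideanSpace.single i 1) * pderiv j (fun y => H y i j) x) +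
      f x ^ p * pderiv i (pderiv j fun y => H y i j) x := by
  have hd := (contDiff_affineMap f).differentiable (by simp) x
  have hr := fun q : ℝ => hd.rpow_const (p := q) (Or.inl (hf x hx).ne')
  rw [pderiv_congr_of_eqOn h.isOpen hx i
    fun y hy => h.pderiv_rpow_mul_right f p hy (hf y hy) j i j]
  rw [pderiv_add _ (((hr _).fun_mul (h.diffAt_right hx i j)).const_mul _)
      ((hr _).fun_mul (h.diffAt_pderiv_right hx j i j)),
    pderiv_const_mul _ _ ((hr _).fun_mul (h.diffAt_right hx i j)),
    h.pderiv_rpow_mul_right f (p - 1) hx (hf x hx),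
    pderiv_mul _ (hr _) (h.diffAt_pderiv_right hx j i j), pderiv_rpow _ _ hd (hf x hx),
    pderiv_affineMap, show p - 1 - 1 = p - 2 by ring]
  ring

/-- The `(g,f,-2,n)`-scalar curvature for an affine function `f` of the moment coordinates is
`- f^{1+n} ∑ ∂_i ∂_j (f^{1-n} H_{ij})`. -/
theorem gfknScalarCurvature_blockMetric (f : EuclideanSpace ℝ (Fin m) →ᵃ[ℝ] ℝ) (n : ℝ)
    (hf : ∀ x ∈ O, 0 < f x) (hz : momentCoord z ∈ O) :
    gfknScalarCurvature (blockMetric U H) (fun w => f (momentCoord w)) (-2) n z =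
      -(f (momentCoord z) ^ (1 + n) * ∑ i, ∑ j,
        pderiv i (pderiv j fun y => f y ^ (1 - n) * H y i j) (momentCoord z)) := by
  have hpos := hf _ hz
  rw [gfknScalarCurvature, h.scalarCurvature_blockMetric hz, h.hodgeLaplacian_affine f hz,
    h.normSqDifferential_affine f hz]
  simp only [h.pderiv_pderiv_rpow_mul_right f (1 - n) hf hz, Finset.sum_add_distrib,
    ← Finset.mul_sum]
  have hsw : ∑ i, ∑ j, f.linear (EuclideanSpace.single j 1) *
        pderiv i (fun y => H y i j) (momentCoord z) =
      ∑ i, ∑ j, f.linear (EuclideanSpace.single i 1) *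
        pderiv j (fun y => H y i j) (momentCoord z) := by
    rw [Finset.sum_comm]
    exact Finset.sum_congr rfl fun i _ => Finset.sum_congr rfl fun j _ => by
      rw [h.pderiv_right_symm hz j j i]
  simp only [hsw]
  simp only [← Finset.mul_sum]
  set t := f (momentCoord z)
  generalize (∑ i, f.linear (EuclideanSpace.single i 1) *
        ∑ j, pderiv j (fun y => H y i j) (momentCoord z)) = A
  generalize (∑ i, ∑ j, pderiv i (pderiv j fun y => H y i j) (momentCoord z)) = B
  generalize (∑ i, ∑ j, H (momentCoord z) i j * f.linear (EuclideanSpace.single i 1) *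
        f.linear (EuclideanSpace.single j 1)) = C
  -- The prefactor `t ^ (1 + n)` turns the three powers from the Leibniz rule into `t²`, `t` and
  -- `1`. The coefficients then match because at `k = -2` one has `k(n-1) = 2(1-n)` and
  -- `(k/4)(n-1)(4+2k-kn) = n(1-n)`.
  have r1 : t ^ (1 + n) * t ^ (1 - n) = t ^ 2 := by
    rw [← Real.rpow_add hpos, ← Real.rpow_natCast]; norm_num
  have r2 : t ^ (1 + n) * t ^ (1 - n - 1) = t := by
    rw [← Real.rpow_add hpos]; ring_nf; exact Real.rpow_one t
  have r3 : t ^ (1 + n) * t ^ (1 - n - 2) = 1 := by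
    rw [← Real.rpow_add hpos]; ring_nf; exact Real.rpow_zero t
  have r4 : t ^ (-(-2) : ℝ) = t ^ 2 := by
    rw [← Real.rpow_natCast]; norm_num
  rw [r4]
  have expand : t ^ (1 + n) * ((1 - n) * (1 - n - 1) * t ^ (1 - n - 2) * C +
      (1 - n) * t ^ (1 - n - 1) * A + (1 - n) * t ^ (1 - n - 1) * A + t ^ (1 - n) * B) =
      (1 - n) * (1 - n - 1) * (t ^ (1 + n) * t ^ (1 - n - 2)) * C +
      2 * (1 - n) * (t ^ (1 + n) * t ^ (1 - n - 1)) * A + (t ^ (1 + n) * t ^ (1 - n)) * B := by ring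
  rw [expand, r1, r2, r3]
  field_simp
  ring

end IsHessianPair

end ChartMetric

/-! ### Convex geometry of the polytope. -/

namespace DelzantPolytope

variable {m d : ℕ} (P : DelzantPolytope m d)

/-- The inward normal `ν_j` as a vector in `ℝ^m`. -/
def normalVec (j : Fin d) : EuclideanSpace ℝ (Fin m) := WithLp.toLp 2 fun i => (P.normal j i : ℝ)

@[simp]
lemma normalVec_apply (j : Fin d) (i : Fin m) : P.normalVec j i = P.normal j i := rfl

lemma norm_normalVec (j : Fin d) : ‖P.normalVec j‖ = P.normalLength j := by
  simp [EuclideanSpace.norm_eq, normalLength]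

lemma L_eq_inner (j : Fin d) (x : EuclideanSpace ℝ (Fin m)) :
    P.L j x = inner ℝ (P.normalVec j) x + P.offset j := by
  simp [L, integralAffine, PiLp.inner_apply, mul_comm]

lemma L_add (j : Fin d) (x y : EuclideanSpace ℝ (Fin m)) :
    P.L j (x + y) = P.L j x + inner ℝ (P.normalVec j) y := by
  simp only [L_eq_inner, inner_add_right]
  ring

lemma hasFDerivAt_L (j : Fin d) (x : EuclideanSpace ℝ (Fin m)) :
    HasFDerivAt (P.L j) (innerSL ℝ (P.normalVec j)) x := by
  have h := ((innerSL ℝ (P.normalVec j)).hasFDerivAt (x := x)).add_const (P.offset j)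
  exact h.congr_of_eventuallyEq (Filter.Eventually.of_forall fun y => by simp [L_eq_inner])

lemma contDiff_L (j : Fin d) : ContDiff ℝ ∞ (P.L j) := by
  have h := ((innerSL ℝ (P.normalVec j)).contDiff (n := ∞)).add
    (contDiff_const (c := P.offset j))
  have e : P.L j = fun y => innerSL ℝ (P.normalVec j) y + P.offset j := by
    funext y
    simp [L_eq_inner]
  rw [e]
  exact h

lemma continuous_L (j : Fin d) : Continuous (P.L j) := (P.contDiff_L j).continuous

lemma mem_carrier {x : EuclideanSpace ℝ (Fin m)} : x ∈ P.carrier ↔ ∀ j, 0 ≤ P.L j x := Iff.rfl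

lemma isClosed_carrier : IsClosed P.carrier := by
  have : P.carrier = ⋂ j, {x | 0 ≤ P.L j x} := by
    ext x
    simp [mem_carrier]
  rw [this]
  exact isClosed_iInter fun j => isClosed_le continuous_const (P.continuous_L j)

lemma isCompact_carrier : IsCompact P.carrier :=
  Metric.isCompact_of_isClosed_isBounded P.isClosed_carrier P.bounded

lemma interior_carrier_nonempty : (interior P.carrier).Nonempty := P.nonempty_interior

lemma carrier_nonempty : P.carrier.Nonempty := P.interior_carrier_nonempty.mono interior_subset

lemma convex_carrier : Convex ℝ P.carrier := by
  intro x hx y hy a b ha hb hab j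
  have h1 := hx j
  have h2 := hy j
  change 0 ≤ P.L j x at h1
  change 0 ≤ P.L j y at h2
  change 0 ≤ P.L j (a • x + b • y)
  have : P.L j (a • x + b • y) = a * P.L j x + b * P.L j y := by
    simp only [L_eq_inner, inner_add_right, inner_smul_right]
    linear_combination (-P.offset j) * hab
  rw [this]
  positivity

/-- If `ν_j = 0`, then `L_j` is constant and vanishes somewhere, hence vanishes at a vertex, which
exists by compactness. This contradicts linear independence of the normals there. -/
lemma normalVec_ne_zero (j : Fin d) : P.normalVec j ≠ 0 := by
  intro h0
  obtain ⟨v, hv⟩ := P.isCompact_carrier.extremePoints_nonempty P.carrier_nonempty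
  have hnormal : P.normal j = 0 := by
    funext i
    have := congrArg (fun w : EuclideanSpace ℝ (Fin m) => w i) h0
    simpa using this
  have hL : ∀ x, P.L j x = P.offset j := fun x => by simp [L_eq_inner, h0]
  obtain ⟨x, -, hx, -⟩ := P.facet j
  have hv0 : integralAffine (P.normal j) (P.offset j) v = 0 := by
    have h1 := hL v
    have h2 := hL x
    simp only [L] at h1 h2
    rw [h1, ← h2, hx]
  exact (P.linearIndependent_vertex v hv).ne_zero ⟨j, hv0⟩ hnormal

lemma normalLength_pos (j : Fin d) : 0 < P.normalLength j := by
  rw [← norm_normalVec]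
  exact norm_pos_iff.2 (P.normalVec_ne_zero j)

/-- A small displacement along `-ν_j` strictly decreases `L_j`, so an interior point cannot have
`L_j ≤ 0`. -/
lemma mem_interior {x : EuclideanSpace ℝ (Fin m)} :
    x ∈ interior P.carrier ↔ ∀ j, 0 < P.L j x := by
  constructor
  · intro hx j
    by_contra hle
    have hcont : Continuous fun t : ℝ => x + t • P.normalVec j := by fun_prop
    have hmem : ∀ᶠ t in nhds (0 : ℝ), x + t • P.normalVec j ∈ interior P.carrier :=
      hcont.continuousAt.eventually_mem (by simpa using isOpen_interior.mem_nhds hx)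
    obtain ⟨ε, hε, hball⟩ := Metric.eventually_nhds_iff.1 hmem
    have h1 : x + (-(ε / 2)) • P.normalVec j ∈ P.carrier := interior_subset (hball (by
      rw [Real.dist_eq, sub_zero, abs_neg, abs_of_pos (by positivity)]; linarith))
    have h2 := P.mem_carrier.1 h1 j
    rw [L_add, inner_smul_right, real_inner_self_eq_norm_sq] at h2
    have h3 : 0 < ‖P.normalVec j‖ := norm_pos_iff.2 (P.normalVec_ne_zero j)
    have h4 : 0 < ε / 2 * ‖P.normalVec j‖ ^ 2 := by positivity
    push Not at hle
    linarith
  · intro hx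
    refine _root_.mem_interior.2 ⟨{x | ∀ j, 0 < P.L j x}, fun y hy j => (hy j).le, ?_, hx⟩
    have : {x | ∀ j, 0 < P.L j x} = ⋂ j, {x | 0 < P.L j x} := by
      ext x
      simp
    rw [this]
    exact isOpen_iInter_of_finite fun j => isOpen_lt continuous_const (P.continuous_L j)

lemma closure_interior_carrier : closure (interior P.carrier) = P.carrier := by
  rw [P.convex_carrier.closure_interior_eq_closure_of_nonempty_interior
    P.interior_carrier_nonempty, P.isClosed_carrier.closure_eq]

lemma uniqueDiffOn_carrier : UniqueDiffOn ℝ P.carrier :=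
  uniqueDiffOn_convex P.convex_carrier P.interior_carrier_nonempty

lemma volume_frontier_carrier : volume (frontier P.carrier) = 0 :=
  P.convex_carrier.addHaar_frontier volume

lemma setIntegral_carrier_eq (g : EuclideanSpace ℝ (Fin m) → ℝ) :
    ∫ x in P.carrier, g x = ∫ x in interior P.carrier, g x := by
  apply setIntegral_congr_set
  exact (interior_ae_eq_of_null_frontier P.volume_frontier_carrier).symm

lemma facetSet_subset (k : Fin d) : P.facetSet k ⊆ P.carrier := fun _ hx => hx.1

lemma isCompact_facetSet (k : Fin d) : IsCompact (P.facetSet k) :=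
  P.isCompact_carrier.inter_right (isClosed_eq (P.continuous_L k) continuous_const)

lemma exists_facet_point (k : Fin d) :
    ∃ p ∈ P.facetSet k, ∀ j, j ≠ k → 0 < P.L j p := by
  obtain ⟨x, hx, h0, hpos⟩ := P.facet k
  exact ⟨x, ⟨hx, h0⟩, hpos⟩

end DelzantPolytope

/-! ### Fubini coordinates along a unit vector. -/

section Slab

variable {E : Type*} [NormedAddCommGroup E] [InnerProductSpace ℝ E] [FiniteDimensional ℝ E]
  [MeasurableSpace E] [BorelSpace E]

/-- Orthogonal coordinates `(t, y) ↦ t e + y + p` adapted to the unit vector `e`. -/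
def slabEquiv (e : E) (he : ‖e‖ = 1) (p : E) : ℝ × ((ℝ ∙ e)ᗮ : Submodule ℝ E) ≃ᵐ E :=
  ((LinearIsometryEquiv.toSpanUnitSingleton (𝕜 := ℝ) e he).toHomeomorph.toMeasurableEquiv.prodCongr
    (MeasurableEquiv.refl _)).trans ((ℝ ∙ e).measurableEquivProd p).symm

lemma slabEquiv_apply (e : E) (he : ‖e‖ = 1) (p : E) (q : ℝ × ((ℝ ∙ e)ᗮ : Submodule ℝ E)) :
    slabEquiv e he p q = q.1 • e + q.2 + p := by
  rw [slabEquiv, MeasurableEquiv.trans_apply, Submodule.measurableEquivProd_symm_apply]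
  rfl

lemma measurePreserving_slabEquiv (e : E) (he : ‖e‖ = 1) (p : E) :
    MeasurePreserving (slabEquiv e he p) (volume.prod volume) volume := by
  have h1 := ((ℝ ∙ e).measurePreserving_measurableEquivProd p).symm
  rw [InnerProductSpace.euclideanHausdorffMeasure_eq_volume] at h1
  have h2 := ((LinearIsometryEquiv.toSpanUnitSingleton (𝕜 := ℝ) e he).measurePreserving).prod
    (MeasurePreserving.id (volume : Measure ((ℝ ∙ e)ᗮ : Submodule ℝ E)))
  exact h1.comp h2

end Slab

/-! ### A smooth step function. -/

open ChartMetric Filter Topology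

/-- A smooth step function: `0` for `t ≤ 1` and `1` for `t ≥ 2`. -/
def stepFn (t : ℝ) : ℝ := Real.smoothTransition (t - 1)

lemma contDiff_stepFn : ContDiff ℝ ∞ stepFn :=
  Real.smoothTransition.contDiff.comp (contDiff_id.sub contDiff_const)

lemma stepFn_of_le {t : ℝ} (ht : t ≤ 1) : stepFn t = 0 :=
  Real.smoothTransition.zero_of_nonpos (by linarith)

lemma stepFn_of_ge {t : ℝ} (ht : 2 ≤ t) : stepFn t = 1 :=
  Real.smoothTransition.one_of_one_le (by linarith)

lemma stepFn_nonneg (t : ℝ) : 0 ≤ stepFn t := Real.smoothTransition.nonneg _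

lemma stepFn_le_one (t : ℝ) : stepFn t ≤ 1 := Real.smoothTransition.le_one _

lemma continuous_deriv_stepFn : Continuous (deriv stepFn) :=
  contDiff_stepFn.continuous_deriv (by simp)

lemma deriv_stepFn_of_le {t : ℝ} (ht : t ≤ 1) : deriv stepFn t = 0 := by
  have h1 : ∀ s < (1 : ℝ), deriv stepFn s = 0 := fun s hs => by
    have : stepFn =ᶠ[𝓝 s] fun _ => 0 := by
      filter_upwards [Iio_mem_nhds hs] with r hr using stepFn_of_le (le_of_lt hr)
    rw [this.deriv_eq, deriv_const]
  have h2 : closure (Iio (1 : ℝ)) ⊆ {s | deriv stepFn s = 0} :=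
    closure_minimal h1 (isClosed_eq continuous_deriv_stepFn continuous_const)
  rw [closure_Iio] at h2
  exact h2 ht

lemma deriv_stepFn_of_ge {t : ℝ} (ht : 2 ≤ t) : deriv stepFn t = 0 := by
  have h1 : ∀ s > (2 : ℝ), deriv stepFn s = 0 := fun s hs => by
    have : stepFn =ᶠ[𝓝 s] fun _ => 1 := by
      filter_upwards [Ioi_mem_nhds hs] with r hr using stepFn_of_ge (le_of_lt hr)
    rw [this.deriv_eq, deriv_const]
  have h2 : closure (Ioi (2 : ℝ)) ⊆ {s | deriv stepFn s = 0} :=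
    closure_minimal h1 (isClosed_eq continuous_deriv_stepFn continuous_const)
  rw [closure_Ioi] at h2
  exact h2 ht

lemma hasCompactSupport_deriv_stepFn : HasCompactSupport (deriv stepFn) := by
  refine HasCompactSupport.intro (isCompact_Icc (a := (1 : ℝ)) (b := 2)) fun t ht => ?_
  rw [mem_Icc, not_and_or, not_le, not_le] at ht
  rcases ht with ht | ht
  · exact deriv_stepFn_of_le ht.le
  · exact deriv_stepFn_of_ge ht.le

/-- This unit mass gives the limits of the slab integrals coefficient one, whatever the shape of the
step. -/
lemma integral_deriv_stepFn : ∫ t, deriv stepFn t = 1 := by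
  have h1 : ∫ t, deriv stepFn t = ∫ t in (1 : ℝ)..2, deriv stepFn t := by
    rw [intervalIntegral.integral_of_le (by norm_num), ← integral_indicator measurableSet_Ioc]
    congr 1
    funext t
    by_cases ht : t ∈ Ioc (1 : ℝ) 2
    · rw [indicator_of_mem ht]
    · rw [indicator_of_notMem ht]
      rw [mem_Ioc, not_and_or, not_lt, not_le] at ht
      rcases ht with ht | ht
      · exact deriv_stepFn_of_le ht
      · exact deriv_stepFn_of_ge ht.le
  rw [h1, intervalIntegral.integral_deriv_eq_sub
    (fun t _ => contDiff_stepFn.differentiable (by simp) t)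
    (continuous_deriv_stepFn.intervalIntegrable _ _), stepFn_of_ge le_rfl, stepFn_of_le le_rfl]
  norm_num

/-! ### Cutting off near the boundary of the polytope. -/

namespace DelzantPolytope

variable {m d : ℕ} (P : DelzantPolytope m d)

/-- A smooth cutoff function supported in `{L_j ≥ ε for all j}`. -/
def cutoff (ε : ℝ) (x : EuclideanSpace ℝ (Fin m)) : ℝ := ∏ j, stepFn (P.L j x / ε)

/-- The part of the gradient of the cutoff function in the direction `ν_k`. -/
def slabCutoff (ε : ℝ) (k : Fin d) (x : EuclideanSpace ℝ (Fin m)) : ℝ :=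
  deriv stepFn (P.L k x / ε) * ∏ j ∈ Finset.univ.erase k, stepFn (P.L j x / ε)

/-- The pairing `∑_i ν_{k,i} Z_i` of a vector field with the normal `ν_k`. -/
def flux (Z : Fin m → EuclideanSpace ℝ (Fin m) → ℝ) (k : Fin d)
    (x : EuclideanSpace ℝ (Fin m)) : ℝ :=
  ∑ i, (P.normal k i : ℝ) * Z i x

lemma contDiff_step_L (ε : ℝ) (j : Fin d) : ContDiff ℝ ∞ fun x => stepFn (P.L j x / ε) :=
  contDiff_stepFn.comp ((P.contDiff_L j).div_const ε)

lemma contDiff_cutoff (ε : ℝ) : ContDiff ℝ ∞ (P.cutoff ε) :=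
  contDiff_prod fun j _ => P.contDiff_step_L ε j

lemma continuous_slabCutoff (ε : ℝ) (k : Fin d) : Continuous (P.slabCutoff ε k) :=
  (continuous_deriv_stepFn.comp ((P.continuous_L k).div_const ε)).mul
    (continuous_finsetProd _ fun j _ => (P.contDiff_step_L ε j).continuous)

variable {ε : ℝ} {x : EuclideanSpace ℝ (Fin m)}

lemma le_L_of_cutoff_ne_zero (hε : 0 < ε) (hx : P.cutoff ε x ≠ 0) (j : Fin d) : ε ≤ P.L j x := by
  have h1 := Finset.prod_ne_zero_iff.1 hx j (Finset.mem_univ j)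
  by_contra hlt
  exact h1 (stepFn_of_le ((div_le_one hε).2 (not_le.1 hlt).le))

lemma le_L_of_slabCutoff_ne_zero (hε : 0 < ε) {k : Fin d} (hx : P.slabCutoff ε k x ≠ 0)
    (j : Fin d) : ε ≤ P.L j x := by
  by_contra hlt
  have hle : P.L j x / ε ≤ 1 := (div_le_one hε).2 (not_le.1 hlt).le
  by_cases hjk : j = k
  · subst hjk
    exact (mul_ne_zero_iff.1 hx).1 (deriv_stepFn_of_le hle)
  · exact Finset.prod_ne_zero_iff.1 (mul_ne_zero_iff.1 hx).2 j (by simp [hjk]) (stepFn_of_le hle)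

lemma pderiv_cutoff (i : Fin m) :
    pderiv i (P.cutoff ε) x = ∑ k, ε⁻¹ * P.slabCutoff ε k x * P.normal k i := by
  have h1 : ∀ j, HasFDerivAt (fun x => stepFn (P.L j x / ε))
      (deriv stepFn (P.L j x / ε) • (ε⁻¹ • innerSL ℝ (P.normalVec j))) x := by
    intro j
    have h2 : HasFDerivAt (fun x => P.L j x / ε) (ε⁻¹ • innerSL ℝ (P.normalVec j)) x := by
      simpa [div_eq_inv_mul] using (P.hasFDerivAt_L j x).const_mul ε⁻¹
    exact ((contDiff_stepFn.differentiable (by simp) _).hasDerivAt).comp_hasFDerivAt x h2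
  have h3 := HasFDerivAt.finsetProd (u := Finset.univ) fun j _ => h1 j
  have h4 : fderiv ℝ (P.cutoff ε) x = _ := h3.fderiv
  rw [pderiv, h4]
  simp only [sum_apply, smul_apply, smul_eq_mul, innerSL_apply_apply,
    EuclideanSpace.inner_single_right, slabCutoff]
  refine Finset.sum_congr rfl fun k _ => ?_
  simp
  ring

/-- A function of the form `η · Y` with `η` supported in `{L_j ≥ ε}` inherits the regularity of `Y`
in the interior. -/
lemma contDiff_mul_of_support {n : ℕ∞} (hε : 0 < ε) {η Y : EuclideanSpace ℝ (Fin m) → ℝ}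
    (hη : ContDiff ℝ n η) (hsupp : ∀ x, η x ≠ 0 → ∀ j, ε ≤ P.L j x)
    (hY : ContDiffOn ℝ n Y (interior P.carrier)) : ContDiff ℝ n fun x => η x * Y x := by
  rw [contDiff_iff_contDiffAt]
  intro x
  by_cases hx : x ∈ interior P.carrier
  · exact hη.contDiffAt.mul (hY.contDiffAt (isOpen_interior.mem_nhds hx))
  · rw [P.mem_interior] at hx
    push Not at hx
    obtain ⟨j, hj⟩ := hx
    have h0 : (fun x => η x * Y x) =ᶠ[𝓝 x] fun _ => 0 := by
      filter_upwards [(isOpen_lt (P.continuous_L j) continuous_const).mem_nhds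
        (show P.L j x < ε by linarith)] with y hy
      have : η y = 0 := by
        by_contra hne
        exact absurd (hsupp y hne j) (not_le.2 hy)
      rw [this, zero_mul]
    exact contDiffAt_const.congr_of_eventuallyEq h0

lemma hasCompactSupport_mul_of_support (hε : 0 < ε) {η Y : EuclideanSpace ℝ (Fin m) → ℝ}
    (hsupp : ∀ x, η x ≠ 0 → ∀ j, ε ≤ P.L j x) : HasCompactSupport fun x => η x * Y x := by
  refine HasCompactSupport.intro P.isCompact_carrier fun x hx => ?_
  by_contra hne
  exact hx fun j => hε.le.trans (hsupp x (left_ne_zero_of_mul hne) j)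

lemma continuous_mul_of_support (hε : 0 < ε) {η Y : EuclideanSpace ℝ (Fin m) → ℝ}
    (hη : Continuous η) (hsupp : ∀ x, η x ≠ 0 → ∀ j, ε ≤ P.L j x)
    (hY : ContinuousOn Y (interior P.carrier)) : Continuous fun x => η x * Y x :=
  contDiff_zero.1 (P.contDiff_mul_of_support (n := 0) hε (contDiff_zero.2 hη) hsupp
    (contDiffOn_zero.2 hY))

/-- Integration by parts against the constant function `1`. -/
lemma integral_pderiv_eq_zero {G : EuclideanSpace ℝ (Fin m) → ℝ} (hG : ContDiff ℝ ∞ G)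
    (hc : HasCompactSupport G) (i : Fin m) : ∫ x, pderiv i G x = 0 := by
  have hint : Integrable (pderiv i G) := by
    have hc' : HasCompactSupport (pderiv i G) := hc.fderiv_apply (𝕜 := ℝ) _
    exact ((hG.continuous_fderiv (by simp)).clm_apply continuous_const).integrable_of_hasCompactSupport
      hc'
  have h := integral_mul_fderiv_eq_neg_fderiv_mul_of_integrable (𝕜 := ℝ)
    (μ := (volume : Measure (EuclideanSpace ℝ (Fin m)))) (f := fun _ => (1 : ℝ)) (g := G)
    (v := EuclideanSpace.single i 1) (by simp) (by simp only [one_mul]; exact hint)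
    (by simpa using hG.continuous.integrable_of_hasCompactSupport hc)
    (by simp) (fun x _ => hG.differentiable (by simp) x)
  simpa [pderiv] using h

variable {Z : Fin m → EuclideanSpace ℝ (Fin m) → ℝ}

lemma continuousOn_flux (hZ : ∀ i, ContDiffOn ℝ ∞ (Z i) P.carrier) (k : Fin d) :
    ContinuousOn (P.flux Z k) P.carrier :=
  continuousOn_finsetSum _ fun i _ => continuousOn_const.mul (hZ i).continuousOn

/-- The cut-off field is smooth with compact support, so its divergence integrates to zero. The
product rule splits that divergence into the cut-off divergence of `Z` and one slab term per facet,
in which the gradient of the cutoff points along `ν_k`. -/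
lemma integral_cutoff_mul_div (hε : 0 < ε) (hZ : ∀ i, ContDiffOn ℝ ∞ (Z i) P.carrier) :
    ∫ x, P.cutoff ε x * ∑ i, pderiv i (Z i) x =
      -∑ k, ε⁻¹ * ∫ x, P.slabCutoff ε k x * P.flux Z k x := by
  have hZ' : ∀ i, ContDiffOn ℝ ∞ (Z i) (interior P.carrier) := fun i =>
    (hZ i).mono interior_subset
  have hcs : ∀ x, P.cutoff ε x ≠ 0 → ∀ j, ε ≤ P.L j x := fun x => P.le_L_of_cutoff_ne_zero hε
  have hss : ∀ k x, P.slabCutoff ε k x ≠ 0 → ∀ j, ε ≤ P.L j x := fun k x =>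
    P.le_L_of_slabCutoff_ne_zero hε
  have hG : ∀ i, ContDiff ℝ ∞ fun x => P.cutoff ε x * Z i x := fun i =>
    P.contDiff_mul_of_support (n := ⊤) hε (P.contDiff_cutoff ε) hcs (hZ' i)
  have hpt : ∀ x, ∑ i, pderiv i (fun x => P.cutoff ε x * Z i x) x =
      P.cutoff ε x * ∑ i, pderiv i (Z i) x +
        ∑ k, ε⁻¹ * (P.slabCutoff ε k x * P.flux Z k x) := by
    intro x
    by_cases hx : x ∈ interior P.carrier
    · have h1 : ∀ i, pderiv i (fun x => P.cutoff ε x * Z i x) x =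
          (∑ k, ε⁻¹ * P.slabCutoff ε k x * P.normal k i) * Z i x +
            P.cutoff ε x * pderiv i (Z i) x := fun i => by
        rw [pderiv_mul _ ((P.contDiff_cutoff ε).differentiable (by simp) x)
          (differentiableAt_of_contDiffOn isOpen_interior (hZ' i) hx), P.pderiv_cutoff]
      simp only [h1, Finset.sum_add_distrib, ← Finset.mul_sum]
      rw [add_comm]
      congr 1
      simp only [flux, Finset.sum_mul, Finset.mul_sum]
      rw [Finset.sum_comm]
      exact Finset.sum_congr rfl fun k _ => Finset.sum_congr rfl fun i _ => by ring
    -- Off the interior some `L_j ≤ 0 < ε`, so the cutoff vanishes on a whole neighbourhood and the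
    -- uncontrolled values of `Z` and its derivatives do not matter.
    · rw [P.mem_interior] at hx
      push Not at hx
      obtain ⟨j, hj⟩ := hx
      have hc0 : ∀ y, P.L j y < ε → P.cutoff ε y = 0 := fun y hy => by
        by_contra hne
        exact absurd (hcs y hne j) (not_le.2 hy)
      have hs0 : ∀ k, P.slabCutoff ε k x = 0 := fun k => by
        by_contra hne
        exact absurd (hss k x hne j) (not_le.2 (by linarith))
      have h1 : ∀ i, pderiv i (fun x => P.cutoff ε x * Z i x) x = 0 := fun i => by
        rw [pderiv_congr_of_eqOn (G := fun _ => 0) (isOpen_lt (P.continuous_L j) continuous_const)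
          (show P.L j x < ε by linarith) i (fun y hy => by simp [hc0 y hy])]
        simp
      simp [h1, hs0, hc0 x (by linarith)]
  have hdiv : ContinuousOn (fun x => ∑ i, pderiv i (Z i) x) (interior P.carrier) :=
    continuousOn_finsetSum _ fun i _ => (contDiffOn_pderiv isOpen_interior i (hZ' i)).continuousOn
  have hint1 : Integrable fun x => P.cutoff ε x * ∑ i, pderiv i (Z i) x :=
    (P.continuous_mul_of_support hε (P.contDiff_cutoff ε).continuous hcs hdiv
      ).integrable_of_hasCompactSupport (P.hasCompactSupport_mul_of_support hε hcs)
  have hint2 : ∀ k, Integrable fun x => P.slabCutoff ε k x * P.flux Z k x := fun k =>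
    (P.continuous_mul_of_support hε (P.continuous_slabCutoff ε k) (hss k)
      ((P.continuousOn_flux hZ k).mono interior_subset)).integrable_of_hasCompactSupport
      (P.hasCompactSupport_mul_of_support hε (hss k))
  have hzero : ∫ x, ∑ i, pderiv i (fun x => P.cutoff ε x * Z i x) x = 0 := by
    rw [integral_finsetSum]
    · exact Finset.sum_eq_zero fun i _ =>
        integral_pderiv_eq_zero (hG i) (P.hasCompactSupport_mul_of_support hε hcs) i
    · intro i _
      exact (((hG i).continuous_fderiv (by simp)).clm_apply
        continuous_const).integrable_of_hasCompactSupport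
        ((P.hasCompactSupport_mul_of_support hε hcs).fderiv_apply (𝕜 := ℝ) _)
  simp only [hpt] at hzero
  rw [integral_add hint1 (integrable_finsetSum _ fun k _ => (hint2 k).const_mul _),
    integral_finsetSum _ fun k _ => (hint2 k).const_mul _] at hzero
  simp only [integral_const_mul] at hzero
  linarith

lemma exists_bound_of_continuousOn {Y : EuclideanSpace ℝ (Fin m) → ℝ}
    (hY : ContinuousOn Y P.carrier) : ∃ C, ∀ x ∈ P.carrier, |Y x| ≤ C := by
  obtain ⟨C, hC⟩ := P.isCompact_carrier.exists_bound_of_continuousOn hY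
  exact ⟨C, fun x hx => by simpa using hC x hx⟩

lemma cutoff_nonneg (ε : ℝ) (x : EuclideanSpace ℝ (Fin m)) : 0 ≤ P.cutoff ε x :=
  Finset.prod_nonneg fun _ _ => stepFn_nonneg _

lemma cutoff_le_one (ε : ℝ) (x : EuclideanSpace ℝ (Fin m)) : P.cutoff ε x ≤ 1 :=
  Finset.prod_le_one (fun _ _ => stepFn_nonneg _) fun _ _ => stepFn_le_one _

lemma eventually_stepFn_eq_one {a : ℝ} (ha : 0 < a) {δ b : ℕ → ℝ} (hδ : ∀ n, 0 < δ n)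
    (hδ0 : Tendsto δ atTop (𝓝 0)) (hb : Tendsto b atTop (𝓝 a)) :
    ∀ᶠ n in atTop, stepFn (b n / δ n) = 1 := by
  have h1 : Tendsto (fun n => b n - 2 * δ n) atTop (𝓝 (a - 2 * 0)) := hb.sub (hδ0.const_mul 2)
  filter_upwards [h1.eventually_const_lt (show 0 < a - 2 * 0 by linarith)] with n hn
  exact stepFn_of_ge ((le_div_iff₀ (hδ n)).2 (by linarith))

lemma eventually_stepFn_eq_zero {a : ℝ} (ha : a < 0) {δ b : ℕ → ℝ} (hδ : ∀ n, 0 < δ n)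
    (hb : Tendsto b atTop (𝓝 a)) :
    ∀ᶠ n in atTop, stepFn (b n / δ n) = 0 := by
  filter_upwards [hb.eventually_lt_const ha] with n hn
  exact stepFn_of_le ((div_neg_of_neg_of_pos hn (hδ n)).le.trans zero_le_one)

lemma tendsto_integral_cutoff_mul {D : EuclideanSpace ℝ (Fin m) → ℝ}
    (hD : ContinuousOn D (interior P.carrier)) {C : ℝ} (hC : ∀ x ∈ interior P.carrier, |D x| ≤ C)
    {δ : ℕ → ℝ} (hδ : ∀ n, 0 < δ n) (hδ0 : Tendsto δ atTop (𝓝 0)) :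
    Tendsto (fun n => ∫ x, P.cutoff (δ n) x * D x) atTop
      (𝓝 (∫ x in interior P.carrier, D x)) := by
  rw [← integral_indicator isOpen_interior.measurableSet]
  have hout : ∀ n x, x ∉ interior P.carrier → P.cutoff (δ n) x = 0 := fun n x hx => by
    by_contra hne
    exact hx (P.mem_interior.2 fun j => (hδ n).trans_le (P.le_L_of_cutoff_ne_zero (hδ n) hne j))
  have hfin : volume (interior P.carrier) ≠ ⊤ :=
    ((measure_mono interior_subset).trans_lt P.isCompact_carrier.measure_lt_top).ne
  refine tendsto_integral_of_dominated_convergence ((interior P.carrier).indicator fun _ => C)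
    (fun n => ?_) ?_ (fun n => ?_) ?_
  · exact (P.continuous_mul_of_support (hδ n) (P.contDiff_cutoff _).continuous
      (fun x => P.le_L_of_cutoff_ne_zero (hδ n)) hD).aestronglyMeasurable
  · rw [integrable_indicator_iff isOpen_interior.measurableSet]
    exact integrableOn_const hfin
  · refine Eventually.of_forall fun x => ?_
    by_cases hx : x ∈ interior P.carrier
    · rw [indicator_of_mem hx, Real.norm_eq_abs, abs_mul, abs_of_nonneg (P.cutoff_nonneg _ x)]
      exact (mul_le_of_le_one_left (abs_nonneg _) (P.cutoff_le_one _ x)).trans (hC x hx)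
    · rw [indicator_of_notMem hx, hout n x hx]
      simp
  · refine Eventually.of_forall fun x => ?_
    by_cases hx : x ∈ interior P.carrier
    · rw [indicator_of_mem hx]
      apply tendsto_nhds_of_eventually_eq
      have h1 : ∀ j, ∀ᶠ n in atTop, stepFn (P.L j x / δ n) = 1 := fun j =>
        eventually_stepFn_eq_one (P.mem_interior.1 hx j) hδ hδ0 tendsto_const_nhds
      filter_upwards [eventually_all.2 h1] with n hn
      simp [cutoff, hn]
    · rw [indicator_of_notMem hx]
      simp [hout _ x hx]

end DelzantPolytope

/-! ### Slab limits on the facets and the divergence theorem. -/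

namespace DelzantPolytope

variable {m d : ℕ} (P : DelzantPolytope m d) (k : Fin d)

/-- The unit normal of the `k`-th facet. -/
def unitNormal : EuclideanSpace ℝ (Fin m) := (P.normalLength k)⁻¹ • P.normalVec k

lemma norm_unitNormal : ‖P.unitNormal k‖ = 1 := by
  rw [unitNormal, norm_smul, norm_normalVec, norm_inv, Real.norm_of_nonneg (P.normalLength_pos k).le,
    inv_mul_cancel₀ (P.normalLength_pos k).ne']

/-- The linear hyperplane parallel to the `k`-th facet. -/
abbrev facetDirection : Submodule ℝ (EuclideanSpace ℝ (Fin m)) := (ℝ ∙ P.unitNormal k)ᗮ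

lemma finrank_facetDirection : Module.finrank ℝ (P.facetDirection k) = m - 1 := by
  have h1 := (ℝ ∙ P.unitNormal k).finrank_add_finrank_orthogonal
  have h2 : P.unitNormal k ≠ 0 := by
    rw [← norm_pos_iff, norm_unitNormal]
    exact one_pos
  rw [finrank_span_singleton h2, finrank_euclideanSpace_fin] at h1
  exact Nat.eq_sub_of_add_eq' h1

lemma inner_normalVec_unitNormal :
    inner ℝ (P.normalVec k) (P.unitNormal k) = P.normalLength k := by
  rw [unitNormal, inner_smul_right, real_inner_self_eq_norm_sq, norm_normalVec, pow_two,
    inv_mul_cancel_left₀ (P.normalLength_pos k).ne']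

lemma inner_unitNormal_facetDirection (y : P.facetDirection k) :
    inner ℝ (P.unitNormal k) (y : EuclideanSpace ℝ (Fin m)) = 0 :=
  Submodule.mem_orthogonal_singleton_iff_inner_right.1 y.2

lemma normalVec_eq_smul : P.normalVec k = P.normalLength k • P.unitNormal k := by
  rw [unitNormal, smul_smul, mul_inv_cancel₀ (P.normalLength_pos k).ne', one_smul]

lemma inner_normalVec_facetDirection (y : P.facetDirection k) :
    inner ℝ (P.normalVec k) (y : EuclideanSpace ℝ (Fin m)) = 0 := by
  rw [normalVec_eq_smul, inner_smul_left, inner_unitNormal_facetDirection, mul_zero]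

/-- A point in the relative interior of the `k`-th facet. -/
def facetPoint : EuclideanSpace ℝ (Fin m) := (P.exists_facet_point k).choose

lemma facetPoint_mem : P.facetPoint k ∈ P.facetSet k := (P.exists_facet_point k).choose_spec.1

lemma L_facetPoint_pos {j : Fin d} (hj : j ≠ k) : 0 < P.L j (P.facetPoint k) :=
  (P.exists_facet_point k).choose_spec.2 j hj

lemma L_facetPoint : P.L k (P.facetPoint k) = 0 := (P.facetPoint_mem k).2

/-- Orthogonal coordinates adapted to the `k`-th facet. -/
def facetCoord (t : ℝ) (y : P.facetDirection k) : EuclideanSpace ℝ (Fin m) :=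
  t • P.unitNormal k + y + P.facetPoint k

lemma slabEquiv_eq_facetCoord (q : ℝ × P.facetDirection k) :
    slabEquiv (P.unitNormal k) (P.norm_unitNormal k) (P.facetPoint k) q =
      P.facetCoord k q.1 q.2 :=
  slabEquiv_apply _ _ _ _

lemma L_self_facetCoord (t : ℝ) (y : P.facetDirection k) :
    P.L k (P.facetCoord k t y) = t * P.normalLength k := by
  have h0 := P.L_facetPoint k
  rw [L_eq_inner] at h0
  simp only [facetCoord, L_eq_inner, inner_add_right, inner_smul_right,
    inner_normalVec_unitNormal, inner_normalVec_facetDirection]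
  linarith

lemma norm_le_of_facetCoord (t : ℝ) (y : P.facetDirection k) :
    ‖y‖ ≤ ‖P.facetCoord k t y - P.facetPoint k‖ := by
  have h1 := norm_add_sq_eq_norm_sq_add_norm_sq_real (x := t • P.unitNormal k)
    (y := (y : EuclideanSpace ℝ (Fin m)))
    (by rw [inner_smul_left, inner_unitNormal_facetDirection, mul_zero])
  have h2 : P.facetCoord k t y - P.facetPoint k = t • P.unitNormal k + y := by
    simp [facetCoord]
  rw [h2]
  refine (sq_le_sq₀ (norm_nonneg _) (norm_nonneg _)).1 ?_
  rw [pow_two, pow_two, h1]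
  have : ‖y‖ = ‖(y : EuclideanSpace ℝ (Fin m))‖ := rfl
  rw [this]
  nlinarith [mul_self_nonneg ‖t • P.unitNormal k‖]

lemma continuous_facetCoord :
    Continuous fun q : ℝ × P.facetDirection k => P.facetCoord k q.1 q.2 := by
  unfold facetCoord
  fun_prop

lemma isometry_facetCoord_zero : Isometry (P.facetCoord k 0) := by
  refine Isometry.of_dist_eq fun y y' => ?_
  simp [facetCoord, Subtype.dist_eq]

lemma facetSet_subset_range : P.facetSet k ⊆ range (P.facetCoord k 0) := by
  intro x hx
  refine ⟨⟨x - P.facetPoint k, ?_⟩, by simp [facetCoord]⟩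
  rw [Submodule.mem_orthogonal_singleton_iff_inner_right, unitNormal, inner_smul_left]
  have h1 := hx.2
  have h2 := P.L_facetPoint k
  rw [L_eq_inner] at h1 h2
  rw [inner_sub_right, show inner ℝ (P.normalVec k) x =
    inner ℝ (P.normalVec k) (P.facetPoint k) by linarith, sub_self, mul_zero]

/-- The facet is parametrized isometrically by part of an inner product space of dimension `m - 1`,
where the normalized Hausdorff measure of that dimension is Lebesgue measure. -/
lemma restrict_facetSet_euclideanHausdorffMeasure :
    (Measure.euclideanHausdorffMeasure (m - 1)).restrict (P.facetSet k) =
      (volume.restrict (P.facetCoord k 0 ⁻¹' P.facetSet k)).map (P.facetCoord k 0) := by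
  have h1 := (P.isometry_facetCoord_zero k).map_euclideanHausdorffMeasure (d := m - 1)
  have h2 : (Measure.euclideanHausdorffMeasure (m - 1) : Measure (P.facetDirection k)) = volume := by
    rw [← P.finrank_facetDirection k]
    exact InnerProductSpace.euclideanHausdorffMeasure_eq_volume
  rw [h2] at h1
  rw [← Measure.restrict_map (P.isometry_facetCoord_zero k).continuous.measurable
    (P.isCompact_facetSet k).measurableSet, h1,
    Measure.restrict_restrict (P.isCompact_facetSet k).measurableSet,
    inter_eq_left.2 (P.facetSet_subset_range k)]

lemma measurableEmbedding_facetCoord_zero : MeasurableEmbedding (P.facetCoord k 0) :=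
  (P.isometry_facetCoord_zero k).isClosedEmbedding.measurableEmbedding

lemma setIntegral_facetSet (Y : EuclideanSpace ℝ (Fin m) → ℝ) :
    ∫ x in P.facetSet k, Y x ∂Measure.euclideanHausdorffMeasure (m - 1) =
      ∫ y, (P.facetSet k).indicator Y (P.facetCoord k 0 y) := by
  rw [P.restrict_facetSet_euclideanHausdorffMeasure k,
    (P.measurableEmbedding_facetCoord_zero k).integral_map,
    ← integral_indicator ((P.isCompact_facetSet k).measurableSet.preimage
      (P.isometry_facetCoord_zero k).continuous.measurable)]
  rfl

lemma euclideanHausdorffMeasure_facetSet_lt_top :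
    Measure.euclideanHausdorffMeasure (m - 1) (P.facetSet k) < ⊤ := by
  have h := P.restrict_facetSet_euclideanHausdorffMeasure k
  have h2 := congrArg (fun μ => μ univ) h
  simp only [Measure.restrict_apply_univ] at h2
  rw [h2, Measure.map_apply (P.isometry_facetCoord_zero k).continuous.measurable MeasurableSet.univ,
    preimage_univ, Measure.restrict_apply_univ]
  exact ((P.isometry_facetCoord_zero k).isClosedEmbedding.isCompact_preimage
    (P.isCompact_facetSet k)).measure_lt_top

/-- On the hyperplane of `F_k` the function `L_j` is affine and is positive at `facetPoint`, by
irredundancy of the facets. Its zero set is therefore a proper affine subspace, hence null. -/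
lemma ae_L_facetCoord_ne_zero :
    ∀ᵐ y : P.facetDirection k, ∀ j, j ≠ k → P.L j (P.facetCoord k 0 y) ≠ 0 := by
  rw [ae_all_iff]
  intro j
  by_cases hj : j = k
  · simp [hj]
  · have hform : ∀ y : P.facetDirection k, P.L j (P.facetCoord k 0 y) =
        inner ℝ (P.normalVec j) (y : EuclideanSpace ℝ (Fin m)) + P.L j (P.facetPoint k) := by
      intro y
      simp only [facetCoord, L_eq_inner, inner_add_right, zero_smul, zero_add]
      ring
    let s : AffineSubspace ℝ (P.facetDirection k) :=
      { carrier := {y | P.L j (P.facetCoord k 0 y) = 0}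
        smul_vsub_vadd_mem' := by
          intro c y₁ y₂ y₃ h₁ h₂ h₃
          simp only [mem_ofPred_eq, hform] at h₁ h₂ h₃ ⊢
          simp only [vsub_eq_sub, vadd_eq_add, Submodule.coe_add, Submodule.coe_smul,
            Submodule.coe_sub, inner_add_right, inner_smul_right, inner_sub_right]
          linear_combination c * h₁ - c * h₂ + h₃ }
    have hs : s ≠ ⊤ := by
      intro htop
      have h0 : (0 : P.facetDirection k) ∈ s := htop ▸ AffineSubspace.mem_top ℝ _ _
      have h1 : P.L j (P.facetCoord k 0 0) = 0 := h0
      rw [hform] at h1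
      have := P.L_facetPoint_pos k hj
      simp at h1
      linarith
    have h2 := Measure.addHaar_affineSubspace (volume : Measure (P.facetDirection k)) s hs
    filter_upwards [measure_eq_zero_iff_ae_notMem.1 h2] with y hy _ h0 using hy h0

lemma ae_mem_facetSet_pos :
    ∀ᵐ x ∂(Measure.euclideanHausdorffMeasure (m - 1)).restrict (P.facetSet k),
      x ∈ P.facetSet k ∧ ∀ j, j ≠ k → 0 < P.L j x := by
  rw [P.restrict_facetSet_euclideanHausdorffMeasure k,
    (P.measurableEmbedding_facetCoord_zero k).ae_map_iff]
  rw [ae_restrict_iff' ((P.isCompact_facetSet k).measurableSet.preimage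
      (P.isometry_facetCoord_zero k).continuous.measurable)]
  filter_upwards [P.ae_L_facetCoord_ne_zero k] with y hy hmem
  exact ⟨hmem, fun j hj => lt_of_le_of_ne (hmem.1 j) (hy j hj).symm⟩

lemma slabCutoff_facetCoord {ε : ℝ} (hε : 0 < ε) (s : ℝ) (y : P.facetDirection k) :
    P.slabCutoff ε k (P.facetCoord k (ε / P.normalLength k * s) y) =
      deriv stepFn s * ∏ j ∈ Finset.univ.erase k,
        stepFn (P.L j (P.facetCoord k (ε / P.normalLength k * s) y) / ε) := by
  have hN := P.normalLength_pos k
  rw [slabCutoff, L_self_facetCoord]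
  congr 2
  field_simp

/-- A dominating function for the slab integrals. -/
def slabBound (C R : ℝ) (q : ℝ × P.facetDirection k) : ℝ :=
  |deriv stepFn q.1| * (Metric.closedBall (0 : P.facetDirection k) R).indicator (fun _ => C) q.2

lemma integrable_slabBound (C R : ℝ) :
    Integrable (P.slabBound k C R) (volume.prod volume) := by
  apply Integrable.mul_prod (f := fun s : ℝ => |deriv stepFn s|)
    (g := (Metric.closedBall (0 : P.facetDirection k) R).indicator fun _ => C)
  · exact (continuous_deriv_stepFn.integrable_of_hasCompactSupport
      hasCompactSupport_deriv_stepFn).abs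
  · rw [integrable_indicator_iff measurableSet_closedBall]
    exact integrableOn_const (isCompact_closedBall _ _).measure_lt_top.ne

variable {Y : EuclideanSpace ℝ (Fin m) → ℝ} {C R ε : ℝ}

/-- Where the slab cutoff is nonzero the point lies in the bounded polytope, so `Y` and the
tangential coordinate are bounded. The resulting bound is independent of `ε`, as dominated
convergence requires. -/
lemma abs_slabCutoff_mul_le (hC : ∀ x ∈ P.carrier, |Y x| ≤ C)
    (hR : ∀ x ∈ P.carrier, ‖x - P.facetPoint k‖ ≤ R) (hε : 0 < ε)
    (q : ℝ × P.facetDirection k) :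
    ‖P.slabCutoff ε k (P.facetCoord k (ε / P.normalLength k * q.1) q.2) *
      Y (P.facetCoord k (ε / P.normalLength k * q.1) q.2)‖ ≤ P.slabBound k C R q := by
  have hC0 : 0 ≤ C := (abs_nonneg _).trans (hC _ (P.facetPoint_mem k).1)
  set x := P.facetCoord k (ε / P.normalLength k * q.1) q.2 with hx
  by_cases h0 : P.slabCutoff ε k x = 0
  · rw [h0, zero_mul, norm_zero]
    exact mul_nonneg (abs_nonneg _) (indicator_nonneg (fun _ _ => hC0) _)
  · have hmem : x ∈ P.carrier := fun j => hε.le.trans (P.le_L_of_slabCutoff_ne_zero hε h0 j)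
    have hball : q.2 ∈ Metric.closedBall (0 : P.facetDirection k) R := by
      rw [mem_closedBall_zero_iff]
      exact (P.norm_le_of_facetCoord k _ q.2).trans (hR x hmem)
    rw [slabBound, indicator_of_mem hball, norm_mul, Real.norm_eq_abs, Real.norm_eq_abs, hx,
      P.slabCutoff_facetCoord k hε, abs_mul, ← hx]
    have h1 : |∏ j ∈ Finset.univ.erase k, stepFn (P.L j x / ε)| ≤ 1 := by
      rw [abs_of_nonneg (Finset.prod_nonneg fun _ _ => stepFn_nonneg _)]
      exact Finset.prod_le_one (fun _ _ => stepFn_nonneg _) fun _ _ => stepFn_le_one _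
    exact mul_le_mul (mul_le_of_le_one_right (abs_nonneg _) h1) (hC x hmem) (abs_nonneg _)
      (abs_nonneg _)

/-- Substitute `t = (ε / |ν_k|) s` in the normal coordinate, so that `L_k = ε s`. The Jacobian
cancels `ε⁻¹` and leaves `|ν_k|⁻¹`, the density of `dσ` with respect to Euclidean area. -/
lemma integral_slabCutoff_mul (hY : ContinuousOn Y P.carrier) (hε : 0 < ε) :
    ε⁻¹ * ∫ x, P.slabCutoff ε k x * Y x =
      (P.normalLength k)⁻¹ * ∫ q : ℝ × P.facetDirection k,
        P.slabCutoff ε k (P.facetCoord k (ε / P.normalLength k * q.1) q.2) *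
          Y (P.facetCoord k (ε / P.normalLength k * q.1) q.2) ∂(volume.prod volume) := by
  have hN := P.normalLength_pos k
  obtain ⟨C, hC⟩ := P.exists_bound_of_continuousOn hY
  obtain ⟨R, hR⟩ := P.exists_bound_of_continuousOn (Y := fun x => ‖x - P.facetPoint k‖)
    (by fun_prop)
  have hR' : ∀ x ∈ P.carrier, ‖x - P.facetPoint k‖ ≤ R := fun x hx => (le_abs_self _).trans (hR x hx)
  set g : EuclideanSpace ℝ (Fin m) → ℝ := fun x => P.slabCutoff ε k x * Y x with hg
  have hss : ∀ x, P.slabCutoff ε k x ≠ 0 → ∀ j, ε ≤ P.L j x := fun x =>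
    P.le_L_of_slabCutoff_ne_zero hε
  have hgc : Continuous g := P.continuous_mul_of_support hε (P.continuous_slabCutoff ε k) hss
    (hY.mono interior_subset)
  have hgi : Integrable g := hgc.integrable_of_hasCompactSupport
    (P.hasCompactSupport_mul_of_support hε hss)
  have hmp := measurePreserving_slabEquiv (P.unitNormal k) (P.norm_unitNormal k) (P.facetPoint k)
  have h1 : Integrable (fun q : ℝ × P.facetDirection k => g (P.facetCoord k q.1 q.2))
      (volume.prod volume) := by
    have := (hmp.integrable_comp_emb (MeasurableEquiv.measurableEmbedding _)).2 hgi
    simpa only [Function.comp_def, slabEquiv_eq_facetCoord] using this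
  have h2 : Integrable (fun q : ℝ × P.facetDirection k =>
      g (P.facetCoord k (ε / P.normalLength k * q.1) q.2)) (volume.prod volume) := by
    refine (P.integrable_slabBound k C R).mono' ?_ (Eventually.of_forall fun q =>
      P.abs_slabCutoff_mul_le k hC hR' hε q)
    refine (hgc.comp ((P.continuous_facetCoord k).comp
      (((continuous_const.mul continuous_fst)).prodMk continuous_snd))).aestronglyMeasurable
  have h3 : ∫ x, g x = ∫ q : ℝ × P.facetDirection k, g (P.facetCoord k q.1 q.2)
      ∂(volume.prod volume) := by
    rw [← hmp.integral_comp (MeasurableEquiv.measurableEmbedding _)]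
    simp only [slabEquiv_eq_facetCoord]
  rw [h3, integral_prod _ h1, integral_prod _ h2]
  have h4 := Measure.integral_comp_mul_left
    (fun t => ∫ y, g (P.facetCoord k t y)) (ε / P.normalLength k)
  rw [h4, abs_of_pos (by positivity), smul_eq_mul]
  field_simp

lemma tendsto_slabCutoff_mul (hY : ContinuousOn Y P.carrier) {δ : ℕ → ℝ} (hδ : ∀ n, 0 < δ n)
    (hδ0 : Tendsto δ atTop (𝓝 0)) (s : ℝ) {y : P.facetDirection k}
    (hy : ∀ j, j ≠ k → P.L j (P.facetCoord k 0 y) ≠ 0) :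
    Tendsto (fun n => P.slabCutoff (δ n) k (P.facetCoord k (δ n / P.normalLength k * s) y) *
      Y (P.facetCoord k (δ n / P.normalLength k * s) y)) atTop
      (𝓝 (deriv stepFn s * (P.facetSet k).indicator Y (P.facetCoord k 0 y))) := by
  have hN := P.normalLength_pos k
  simp only [P.slabCutoff_facetCoord k (hδ _)]
  -- For `s ≤ 1` the derivative of the step vanishes. For `s > 1` the approximating points have `L_k
  -- > 0`, hence approach the facet from inside the polytope, and continuity of `Y` within the
  -- polytope suffices.
  rcases le_or_gt s 1 with hs | hs
  · simp [deriv_stepFn_of_le hs]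
  have htend : Tendsto (fun n => P.facetCoord k (δ n / P.normalLength k * s) y) atTop
      (𝓝 (P.facetCoord k 0 y)) := by
    have h1 : Tendsto (fun n => (δ n / P.normalLength k * s, y)) atTop (𝓝 ((0 : ℝ), y)) := by
      refine Tendsto.prodMk_nhds ?_ tendsto_const_nhds
      simpa using (hδ0.div_const (P.normalLength k)).mul_const s
    have h2 := (P.continuous_facetCoord k).tendsto ((0 : ℝ), y)
    have h3 := h2.comp h1
    exact h3
  have hL : ∀ j, Tendsto (fun n => P.L j (P.facetCoord k (δ n / P.normalLength k * s) y)) atTop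
      (𝓝 (P.L j (P.facetCoord k 0 y))) := fun j => ((P.continuous_L j).tendsto _).comp htend
  -- If some other `L_j` is negative, the limit point is off the facet and one factor of the cutoff
  -- is eventually `0`; otherwise all the other factors are eventually `1`.
  by_cases hneg : ∃ j, j ≠ k ∧ P.L j (P.facetCoord k 0 y) < 0
  · obtain ⟨j, hjk, hj⟩ := hneg
    have hnm : P.facetCoord k 0 y ∉ P.facetSet k := fun hmem => absurd (hmem.1 j) (not_le.2 hj)
    rw [indicator_of_notMem hnm, mul_zero]
    apply tendsto_nhds_of_eventually_eq
    filter_upwards [eventually_stepFn_eq_zero hj hδ (hL j)] with n hn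
    rw [Finset.prod_eq_zero (i := j) (by simp [hjk]) hn]
    ring
  · push Not at hneg
    have hpos : ∀ j, j ≠ k → 0 < P.L j (P.facetCoord k 0 y) := fun j hj =>
      lt_of_le_of_ne (hneg j hj) (hy j hj).symm
    have hk0 : P.L k (P.facetCoord k 0 y) = 0 := by rw [L_self_facetCoord, zero_mul]
    have hmem : P.facetCoord k 0 y ∈ P.facetSet k := by
      refine ⟨fun j => ?_, hk0⟩
      by_cases hj : j = k
      · subst hj
        exact hk0.ge
      · exact (hpos j hj).le
    rw [indicator_of_mem hmem]
    have hev : ∀ j, ∀ᶠ n in atTop, 0 ≤ P.L j (P.facetCoord k (δ n / P.normalLength k * s) y) := by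
      intro j
      by_cases hj : j = k
      · subst hj
        refine Eventually.of_forall fun n => ?_
        rw [L_self_facetCoord]
        have := hδ n
        positivity
      · exact ((hL j).eventually_const_lt (hpos j hj)).mono fun n hn => hn.le
    have hYt : Tendsto (fun n => Y (P.facetCoord k (δ n / P.normalLength k * s) y)) atTop
        (𝓝 (Y (P.facetCoord k 0 y))) := by
      refine (hY _ hmem.1).tendsto.comp (tendsto_nhdsWithin_iff.2 ⟨htend, ?_⟩)
      filter_upwards [eventually_all.2 hev] with n hn using hn
    have hprod : ∀ᶠ n in atTop, ∏ j ∈ Finset.univ.erase k,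
        stepFn (P.L j (P.facetCoord k (δ n / P.normalLength k * s) y) / δ n) = 1 := by
      have h1 : ∀ j, ∀ᶠ n in atTop, j ≠ k →
          stepFn (P.L j (P.facetCoord k (δ n / P.normalLength k * s) y) / δ n) = 1 := by
        intro j
        by_cases hj : j = k
        · simp [hj]
        · exact (eventually_stepFn_eq_one (hpos j hj) hδ hδ0 (hL j)).mono fun n hn _ => hn
      filter_upwards [eventually_all.2 h1] with n hn
      exact Finset.prod_eq_one fun j hj => hn j (Finset.ne_of_mem_erase hj)
    have hlim := (hYt.const_mul (deriv stepFn s))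
    refine hlim.congr' ?_
    filter_upwards [hprod] with n hn
    rw [hn, mul_one]

/-- Dominated convergence in the rescaled coordinates. The limit integrand is a product, whose
normal factor integrates to `1`. -/
lemma tendsto_integral_slabCutoff_mul (hY : ContinuousOn Y P.carrier) {δ : ℕ → ℝ}
    (hδ : ∀ n, 0 < δ n) (hδ0 : Tendsto δ atTop (𝓝 0)) :
    Tendsto (fun n => (δ n)⁻¹ * ∫ x, P.slabCutoff (δ n) k x * Y x) atTop
      (𝓝 ((P.normalLength k)⁻¹ *
        ∫ x in P.facetSet k, Y x ∂Measure.euclideanHausdorffMeasure (m - 1))) := by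
  have h1 : ∫ x in P.facetSet k, Y x ∂Measure.euclideanHausdorffMeasure (m - 1) =
      ∫ q : ℝ × P.facetDirection k, deriv stepFn q.1 *
        (P.facetSet k).indicator Y (P.facetCoord k 0 q.2) ∂(volume.prod volume) := by
    rw [integral_prod_mul (fun s => deriv stepFn s)
      (fun y => (P.facetSet k).indicator Y (P.facetCoord k 0 y)), integral_deriv_stepFn, one_mul,
      setIntegral_facetSet]
  simp only [fun n => P.integral_slabCutoff_mul k hY (hδ n)]
  rw [h1]
  refine Tendsto.const_mul _ ?_
  obtain ⟨C, hC⟩ := P.exists_bound_of_continuousOn hY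
  obtain ⟨R, hR⟩ := P.exists_bound_of_continuousOn (Y := fun x => ‖x - P.facetPoint k‖)
    (by fun_prop)
  refine tendsto_integral_of_dominated_convergence (P.slabBound k C R) (fun n => ?_)
    (P.integrable_slabBound k C R) (fun n => Eventually.of_forall fun q =>
      P.abs_slabCutoff_mul_le k hC (fun x hx => (le_abs_self _).trans (hR x hx)) (hδ n) q) ?_
  · have hgc := P.continuous_mul_of_support (hδ n) (P.continuous_slabCutoff (δ n) k)
      (fun x => P.le_L_of_slabCutoff_ne_zero (hδ n)) (hY.mono interior_subset)
    exact (hgc.comp ((P.continuous_facetCoord k).comp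
      (((continuous_const.mul continuous_fst)).prodMk continuous_snd))).aestronglyMeasurable
  · filter_upwards [Measure.quasiMeasurePreserving_snd.ae (P.ae_L_facetCoord_ne_zero k)] with q hq
    exact P.tendsto_slabCutoff_mul k hY hδ hδ0 q.1 hq

/-- The divergence theorem on a polytope. -/
theorem integral_div_eq {Z : Fin m → EuclideanSpace ℝ (Fin m) → ℝ}
    (hZ : ∀ i, ContDiffOn ℝ ∞ (Z i) P.carrier) :
    ∫ x in interior P.carrier, ∑ i, pderiv i (Z i) x =
      -∑ k, (P.normalLength k)⁻¹ *
        ∫ x in P.facetSet k, P.flux Z k x ∂Measure.euclideanHausdorffMeasure (m - 1) := by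
  -- The divergence is bounded on the interior because it is the restriction of a function
  -- continuous on the compact polytope.
  have hW : ContinuousOn (fun x => ∑ i, fderivWithin ℝ (Z i) P.carrier x
      (EuclideanSpace.single i 1)) P.carrier :=
    continuousOn_finsetSum _ fun i _ =>
      ((hZ i).continuousOn_fderivWithin P.uniqueDiffOn_carrier (by simp)).clm_apply
        continuousOn_const
  obtain ⟨C, hC⟩ := P.exists_bound_of_continuousOn hW
  have heq : EqOn (fun x => ∑ i, fderivWithin ℝ (Z i) P.carrier x (EuclideanSpace.single i 1))
      (fun x => ∑ i, pderiv i (Z i) x) (interior P.carrier) := fun x hx => by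
    simp only [pderiv, fderivWithin_of_mem_nhds (mem_interior_iff_mem_nhds.1 hx)]
  have hD : ContinuousOn (fun x => ∑ i, pderiv i (Z i) x) (interior P.carrier) :=
    (hW.mono interior_subset).congr heq.symm
  have hδ : ∀ n : ℕ, (0 : ℝ) < 1 / ((n : ℝ) + 1) := fun n => by positivity
  have hδ0 := tendsto_one_div_add_atTop_nhds_zero_nat (𝕜 := ℝ)
  have h1 := P.tendsto_integral_cutoff_mul hD (C := C)
    (fun x hx => (congrArg abs (heq hx)).symm.trans_le (hC x (interior_subset hx))) hδ hδ0
  have h2 := (tendsto_finsetSum Finset.univ fun k _ =>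
    P.tendsto_integral_slabCutoff_mul k (P.continuousOn_flux hZ k) hδ hδ0).neg
  refine tendsto_nhds_unique h1 (h2.congr fun n => ?_)
  rw [P.integral_cutoff_mul_div (hδ n) hZ]

end DelzantPolytope

/-! ### Determinants of matrices with rank-one poles. -/

section RankOne

variable {ι κ : Type*} [Fintype ι] [DecidableEq ι]

/-- The determinant is affine in the coefficient of a rank-one term: by the Schur complement it is
that of a bordered matrix whose last column is affine in `a`. No invertibility of `A` is needed. -/
lemma det_add_smul_vecMulVec {R : Type*} [CommRing R] (A : Matrix ι ι R) (v w : ι → R) (a : R) :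
    (A + a • Matrix.vecMulVec v w).det =
      A.det + a * ((A + Matrix.vecMulVec v w).det - A.det) := by
  let N : Matrix (ι ⊕ Unit) (ι ⊕ Unit) R :=
    Matrix.fromBlocks A 0 (Matrix.of fun _ j => w j) 1
  let c₁ : ι ⊕ Unit → R := Sum.elim (-v) 0
  let c₀ : ι ⊕ Unit → R := Sum.elim 0 1
  have key : ∀ b : R, (A + b • Matrix.vecMulVec v w).det =
      b * (N.updateCol (Sum.inr ()) c₁).det + (N.updateCol (Sum.inr ()) c₀).det := by
    intro b
    have h1 : (A + b • Matrix.vecMulVec v w) =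
        A - (Matrix.of fun i (_ : Unit) => -(b * v i)) * (Matrix.of fun (_ : Unit) j => w j) := by
      ext i j
      simp [Matrix.mul_apply, Matrix.vecMulVec_apply, mul_assoc]
    rw [h1, ← Matrix.det_fromBlocks_one₂₂, ← Matrix.det_updateCol_smul, ← Matrix.det_updateCol_add]
    congr 1
    ext i j
    obtain i | i := i <;> obtain j | j := j <;>
      simp [N, c₁, c₀]
  have h0 := key 0
  have h1 := key 1
  simp only [zero_smul, add_zero, zero_mul, zero_add, one_smul, one_mul] at h0 h1
  rw [key a, h1, h0]
  ring

lemma contDiffOn_det {E : Type*} [NormedAddCommGroup E] [NormedSpace ℝ E] {C : Set E}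
    {G : E → Matrix ι ι ℝ} (hG : ∀ i j, ContDiffOn ℝ ∞ (fun x => G x i j) C) :
    ContDiffOn ℝ ∞ (fun x => (G x).det) C := by
  simp only [Matrix.det_apply]
  exact ContDiffOn.sum fun σ _ => (contDiffOn_prod fun i _ => hG _ _).const_smul _

/-- The determinant of a smooth matrix plus `∑_j ℓ_j⁻¹ v_j w_jᵀ` becomes smooth after multiplication
by `∏_j ℓ_j`. -/
lemma exists_contDiffOn_prod_mul_det {E : Type*} [NormedAddCommGroup E] [NormedSpace ℝ E]
    {C O : Set E} {ℓ : κ → E → ℝ} (hℓ : ∀ j, ContDiffOn ℝ ∞ (ℓ j) C)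
    (hℓO : ∀ j, ∀ x ∈ O, ℓ j x ≠ 0) (v w : κ → ι → ℝ) (s : Finset κ) :
    ∀ G : E → Matrix ι ι ℝ, (∀ i j, ContDiffOn ℝ ∞ (fun x => G x i j) C) →
      ∃ q : E → ℝ, ContDiffOn ℝ ∞ q C ∧ ∀ x ∈ O,
        (∏ j ∈ s, ℓ j x) * (G x + ∑ j ∈ s, (ℓ j x)⁻¹ • Matrix.vecMulVec (v j) (w j)).det = q x := by
  classical
  induction s using Finset.induction_on with
  | empty => exact fun G hG => ⟨fun x => (G x).det, contDiffOn_det hG, fun x _ => by simp⟩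
  | insert k s hk ih =>
    intro G hG
    obtain ⟨q, hq, hqO⟩ := ih G hG
    obtain ⟨r, hr, hrO⟩ := ih (fun x => G x + Matrix.vecMulVec (v k) (w k)) (fun i j => by
      simp only [Matrix.add_apply]
      exact (hG i j).add contDiffOn_const)
    -- Affinity in the coefficient `ℓ_k⁻¹` gives `ℓ_k det(M + ℓ_k⁻¹ v wᵀ) = ℓ_k det M + (det(M + v
    -- wᵀ) - det M)`. The induction hypothesis handles the two determinants, with `G` and with `G +
    -- v wᵀ`.
    refine ⟨fun x => ℓ k x * q x + (r x - q x), ((hℓ k).mul hq).add (hr.sub hq), fun x hx => ?_⟩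
    have h0 := hℓO k x hx
    simp only
    rw [← hqO x hx, ← hrO x hx, Finset.prod_insert hk, Finset.sum_insert hk, add_comm (_ • _),
      ← add_assoc, det_add_smul_vecMulVec, add_right_comm (G x)]
    field_simp

end RankOne

/-! ### Boundary behaviour of the inverse Hessian. -/

namespace DelzantPolytope

variable {m d : ℕ} (P : DelzantPolytope m d)

/-- Partial derivatives up to the boundary of the polytope. -/
def bdryDeriv (i : Fin m) (F : EuclideanSpace ℝ (Fin m) → ℝ) (x : EuclideanSpace ℝ (Fin m)) : ℝ :=
  fderivWithin ℝ F P.carrier x (EuclideanSpace.single i 1)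

variable {F : EuclideanSpace ℝ (Fin m) → ℝ} {x : EuclideanSpace ℝ (Fin m)}

lemma contDiffOn_bdryDeriv (i : Fin m) (hF : ContDiffOn ℝ ∞ F P.carrier) :
    ContDiffOn ℝ ∞ (P.bdryDeriv i F) P.carrier :=
  (hF.fderivWithin P.uniqueDiffOn_carrier (by simp)).clm_apply contDiffOn_const

lemma bdryDeriv_eq (i : Fin m) (hx : x ∈ interior P.carrier) :
    P.bdryDeriv i F x = pderiv i F x := by
  rw [bdryDeriv, pderiv, fderivWithin_of_mem_nhds (mem_interior_iff_mem_nhds.1 hx)]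

/-- The points where all `L_j` with `j ≠ k` are positive. -/
def facetNhd (k : Fin d) : Set (EuclideanSpace ℝ (Fin m)) := {x | ∀ j, j ≠ k → 0 < P.L j x}

lemma isOpen_facetNhd (k : Fin d) : IsOpen (P.facetNhd k) := by
  have : P.facetNhd k = ⋂ j, {x | j ≠ k → 0 < P.L j x} := by
    ext x
    simp [facetNhd]
  rw [this]
  refine isOpen_iInter_of_finite fun j => ?_
  by_cases hj : j = k
  · simp [hj]
  · simpa [hj] using isOpen_lt continuous_const (P.continuous_L j)

/-- The interior is dense in the polytope, so identities pass to the boundary by continuity. The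
open set `O` admits functions that are regular only near one facet. -/
lemma eqOn_of_eqOn_interior {F G : EuclideanSpace ℝ (Fin m) → ℝ} {O : Set (EuclideanSpace ℝ (Fin m))}
    (hO : IsOpen O) (hF : ContinuousOn F (P.carrier ∩ O)) (hG : ContinuousOn G (P.carrier ∩ O))
    (h : EqOn F G (interior P.carrier)) : EqOn F G (P.carrier ∩ O) := by
  refine (h.mono inter_subset_left).of_subset_closure hF hG
    (inter_subset_inter_left O interior_subset) ?_
  rintro y ⟨hy, hyO⟩
  rw [← P.closure_interior_carrier] at hy
  rw [inter_comm]
  exact hO.inter_closure ⟨hyO, hy⟩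

variable {u : EuclideanSpace ℝ (Fin m) → ℝ}

namespace IsSymplecticPotential

variable {P} (hu : P.IsSymplecticPotential u)
include hu

lemma contDiffOn_interior : ContDiffOn ℝ ∞ u (interior P.carrier) := by
  obtain ⟨h, hh, huh⟩ := hu.exists_smooth
  refine ContDiffOn.congr ?_ fun x hx => huh x (interior_subset hx)
  refine (contDiffOn_const.mul (ContDiffOn.sum fun j _ => ?_)).add (hh.mono interior_subset)
  exact (P.contDiff_L j).contDiffOn.mul ((P.contDiff_L j).contDiffOn.log fun x hx =>
    (P.mem_interior.1 hx j).ne')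

/-- The Hessian of a symplectic potential is smooth up to the boundary apart from its poles
`½ ∑_j ν_j ν_jᵀ / L_j`. -/
lemma exists_hessian_eq : ∃ G : EuclideanSpace ℝ (Fin m) → Matrix (Fin m) (Fin m) ℝ,
    (∀ i j, ContDiffOn ℝ ∞ (fun x => G x i j) P.carrier) ∧
    ∀ x ∈ interior P.carrier, hessian u x = G x + ∑ k, (P.L k x)⁻¹ •
      Matrix.vecMulVec (fun i => (1 / 2 : ℝ) * P.normal k i) (fun i => (P.normal k i : ℝ)) := by
  obtain ⟨h, hh, huh⟩ := hu.exists_smooth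
  refine ⟨fun x => Matrix.of fun i j => P.bdryDeriv i (P.bdryDeriv j h) x, fun i j =>
    P.contDiffOn_bdryDeriv i (P.contDiffOn_bdryDeriv j hh), fun x hx => ?_⟩
  have hhi := hh.mono (interior_subset (s := P.carrier))
  have h1 : ∀ j, ∀ y ∈ interior P.carrier, pderiv j u y =
      (1 / 2) * ∑ k, (P.normal k j : ℝ) * (Real.log (P.L k y) + 1) + P.bdryDeriv j h y := by
    intro j y hy
    have hxlog : ∀ k, HasFDerivAt (fun y => P.L k y * Real.log (P.L k y))
        ((Real.log (P.L k y) + 1) • innerSL ℝ (P.normalVec k)) y := fun k =>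
      (Real.hasDerivAt_mul_log (P.mem_interior.1 hy k).ne').comp_hasFDerivAt y (P.hasFDerivAt_L k y)
    have hp : ∀ k, pderiv j (fun y => P.L k y * Real.log (P.L k y)) y =
        (P.normal k j : ℝ) * (Real.log (P.L k y) + 1) := fun k => by
      simp [pderiv, (hxlog k).fderiv, EuclideanSpace.inner_single_right, mul_comm]
    rw [pderiv_congr_of_eqOn isOpen_interior hy j fun y hy => huh y (interior_subset hy),
      pderiv_add _ ((DifferentiableAt.fun_sum fun k _ => (hxlog k).differentiableAt).const_mul _)
        (differentiableAt_of_contDiffOn isOpen_interior hhi hy),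
      pderiv_const_mul _ _ (DifferentiableAt.fun_sum fun k _ => (hxlog k).differentiableAt),
      pderiv_sum _ _ fun k _ => (hxlog k).differentiableAt, P.bdryDeriv_eq j hy]
    simp only [hp]
  ext i j
  have hlog : ∀ k, HasFDerivAt (fun y => (P.normal k j : ℝ) * (Real.log (P.L k y) + 1))
      ((P.normal k j : ℝ) • ((P.L k x)⁻¹ • innerSL ℝ (P.normalVec k))) x := fun k =>
    (((P.hasFDerivAt_L k x).log (P.mem_interior.1 hx k).ne').add_const 1).const_mul _
  have hp : ∀ k, pderiv i (fun y => (P.normal k j : ℝ) * (Real.log (P.L k y) + 1)) x =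
      (P.normal k j : ℝ) * ((P.L k x)⁻¹ * P.normal k i) := fun k => by
    simp [pderiv, (hlog k).fderiv, EuclideanSpace.inner_single_right]
  have hbd : DifferentiableAt ℝ (P.bdryDeriv j h) x :=
    differentiableAt_of_contDiffOn isOpen_interior
      ((P.contDiffOn_bdryDeriv j hh).mono interior_subset) hx
  change pderiv i (pderiv j u) x = _
  rw [pderiv_congr_of_eqOn isOpen_interior hx i (h1 j),
    pderiv_add _ ((DifferentiableAt.fun_sum fun k _ => (hlog k).differentiableAt).const_mul _) hbd,
    pderiv_const_mul _ _ (DifferentiableAt.fun_sum fun k _ => (hlog k).differentiableAt),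
    pderiv_sum _ _ fun k _ => (hlog k).differentiableAt]
  simp only [hp, Matrix.add_apply, Matrix.sum_apply, Matrix.smul_apply, Matrix.vecMulVec_apply,
    smul_eq_mul, Matrix.of_apply, P.bdryDeriv_eq i hx]
  rw [add_comm, Finset.mul_sum]
  congr 1
  exact Finset.sum_congr rfl fun k _ => by ring

/-- The inverse Hessian of a symplectic potential extends smoothly to the polytope. -/
lemma exists_inv_extension : ∃ K : EuclideanSpace ℝ (Fin m) → Matrix (Fin m) (Fin m) ℝ,
    (∀ i j, ContDiffOn ℝ ∞ (fun x => K x i j) P.carrier) ∧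
    ∀ x ∈ interior P.carrier, (hessian u x)⁻¹ = K x := by
  obtain ⟨G, hG, hUG⟩ := hu.exists_hessian_eq
  obtain ⟨δ, hδ, -, hdet⟩ := hu.exists_det
  -- By the determinant condition the inverse is `δ (∏ L_k)` times the adjugate, so it suffices that
  -- `∏ L_k` clears the poles of each cofactor.
  have hq : ∀ i j, ∃ q : EuclideanSpace ℝ (Fin m) → ℝ, ContDiffOn ℝ ∞ q P.carrier ∧
      ∀ x ∈ interior P.carrier, (∏ k, P.L k x) * (hessian u x).adjugate i j = q x := by
    intro i j
    obtain ⟨q, hq, hqO⟩ := exists_contDiffOn_prod_mul_det (C := P.carrier)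
      (O := interior P.carrier) (ℓ := P.L) (fun k => (P.contDiff_L k).contDiffOn)
      (fun k x hx => (P.mem_interior.1 hx k).ne')
      -- A cofactor is a determinant with row `j` replaced by a basis vector. Setting entry `j` of
      -- the left vectors to zero removes the poles from that row and keeps each pole of rank at
      -- most one.
      (fun k => Function.update (fun i => (1 / 2 : ℝ) * P.normal k i) j 0)
      (fun k i => (P.normal k i : ℝ)) Finset.univ
      (fun x => (G x).updateRow j (Pi.single i 1)) (fun a b => by
        by_cases ha : a = j
        · subst ha
          simp only [Matrix.updateRow_self]
          exact contDiffOn_const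
        · simp only [Matrix.updateRow_ne ha]
          exact hG a b)
    refine ⟨q, hq, fun x hx => ?_⟩
    rw [← hqO x hx, Matrix.adjugate_apply, hUG x hx]
    congr 2
    ext a b
    by_cases ha : a = j
    · subst ha
      simp [Matrix.sum_apply, Matrix.vecMulVec_apply]
    · simp [Matrix.sum_apply, Matrix.vecMulVec_apply, Matrix.updateRow_ne ha,
        Function.update_of_ne ha]
  choose q hq hqO using hq
  refine ⟨fun x => Matrix.of fun i j => δ x * q i j x, fun i j => hδ.mul (hq i j), fun x hx => ?_⟩
  ext i j
  change _ = δ x * q i j x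
  rw [Matrix.inv_def, hdet x hx, Matrix.smul_apply, Ring.inverse_eq_inv', inv_inv, smul_eq_mul,
    ← hqO i j x hx, mul_assoc]

lemma isHessianPair : IsHessianPair (hessian u) (fun x => (hessian u x)⁻¹) (interior P.carrier) := by
  obtain ⟨K, hK, hKeq⟩ := hu.exists_inv_extension
  have hsm := hu.contDiffOn_interior
  have hsymm : ∀ x ∈ interior P.carrier, ∀ i j, hessian u x i j = hessian u x j i :=
    fun x hx i j => pderiv_pderiv_comm isOpen_interior hsm hx i j
  refine ⟨isOpen_interior, fun i j => contDiffOn_pderiv isOpen_interior i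
    (contDiffOn_pderiv isOpen_interior j hsm), fun i j => ?_, fun x hx => ?_, hsymm,
    fun x hx i j => ?_, fun x hx i j k => ?_⟩
  · exact ((hK i j).mono interior_subset).congr fun x hx => by rw [hKeq x hx]
  · exact Matrix.mul_nonsing_inv _ (isUnit_iff_ne_zero.2 (hu.posDef x hx).det_pos.ne')
  · have ht : (hessian u x).transpose = hessian u x := by
      ext a b
      exact hsymm x hx b a
    have h2 := Matrix.transpose_nonsing_inv (hessian u x)
    rw [ht] at h2
    exact congrFun (congrFun h2.symm i) j
  · exact pderiv_pderiv_comm isOpen_interior (contDiffOn_pderiv isOpen_interior k hsm) hx i j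

variable {K : EuclideanSpace ℝ (Fin m) → Matrix (Fin m) (Fin m) ℝ}
  (hK : ∀ i j, ContDiffOn ℝ ∞ (fun x => K x i j) P.carrier)
  (hKeq : ∀ x ∈ interior P.carrier, (hessian u x)⁻¹ = K x)
include hK hKeq

lemma extension_symm (hx : x ∈ P.carrier) (i j : Fin m) : K x i j = K x j i := by
  have h := P.eqOn_of_eqOn_interior isOpen_univ ((hK i j).continuousOn.mono inter_subset_left)
    ((hK j i).continuousOn.mono inter_subset_left) fun y hy => by
      rw [← hKeq y hy]
      exact hu.isHessianPair.right_symm y hy i j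
  exact h ⟨hx, mem_univ x⟩

/-- Near the relative interior of the `k`-th facet, `K ν_k = L_k Y` for a smooth vector field `Y`
with `⟨ν_k, Y⟩ = 2` on the facet. -/
lemma exists_normal_eq_mul (k : Fin d) : ∃ Y : Fin m → EuclideanSpace ℝ (Fin m) → ℝ,
    (∀ i, ContDiffOn ℝ ∞ (Y i) (P.carrier ∩ P.facetNhd k)) ∧
    (∀ i, ∀ x ∈ P.carrier ∩ P.facetNhd k,
      ∑ j, K x i j * P.normal k j = P.L k x * Y i x) ∧
    ∀ x ∈ P.facetSet k ∩ P.facetNhd k, ∑ i, (P.normal k i : ℝ) * Y i x = 2 := by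
  obtain ⟨G, hG, hUG⟩ := hu.exists_hessian_eq
  set N := P.normalLength k ^ 2 with hN
  have hNpos : 0 < N := pow_pos (P.normalLength_pos k) 2
  have hNsum : ∑ i, (P.normal k i : ℝ) * P.normal k i = N := by
    rw [hN, normalLength, Real.sq_sqrt (Finset.sum_nonneg fun i _ => sq_nonneg _)]
    exact Finset.sum_congr rfl fun i _ => (pow_two _).symm
  -- The Hessian without its `k`-th pole, smooth where the other `L_l` are positive.
  let B : Fin m → Fin m → EuclideanSpace ℝ (Fin m) → ℝ := fun a b x => G x a b +
    ∑ l ∈ Finset.univ.erase k, (P.L l x)⁻¹ * ((1 / 2 : ℝ) * P.normal l a * P.normal l b)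
  have hB : ∀ a b, ContDiffOn ℝ ∞ (B a b) (P.carrier ∩ P.facetNhd k) := fun a b =>
    ((hG a b).mono inter_subset_left).add (ContDiffOn.sum fun l hl =>
      ((P.contDiff_L l).contDiffOn.inv fun x hx =>
        (hx.2 l (Finset.ne_of_mem_erase hl)).ne').mul contDiffOn_const)
  have hK' : ∀ i j, ContDiffOn ℝ ∞ (fun x => K x i j) (P.carrier ∩ P.facetNhd k) := fun i j =>
    (hK i j).mono inter_subset_left
  -- Applying `K U = 1` to `ν_k`, with `U = ν_k ν_kᵀ / (2 L_k) + B`, gives `(N / (2 L_k)) K ν_k + K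
  -- B ν_k = ν_k`. Solving for `K ν_k` yields `L_k Y` with this `Y`.
  let Y : Fin m → EuclideanSpace ℝ (Fin m) → ℝ := fun i x =>
    2 / N * (P.normal k i - ∑ a, ∑ b, K x i a * B a b x * P.normal k b)
  have hY : ∀ i, ContDiffOn ℝ ∞ (Y i) (P.carrier ∩ P.facetNhd k) := fun i =>
    contDiffOn_const.mul (contDiffOn_const.sub (ContDiffOn.sum fun a _ => ContDiffOn.sum fun b _ =>
      ((hK' i a).mul (hB a b)).mul contDiffOn_const))
  have hint : ∀ i, EqOn (fun x => ∑ j, K x i j * P.normal k j) (fun x => P.L k x * Y i x)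
      (interior P.carrier) := by
    intro i x hx
    have hLk := P.mem_interior.1 hx k
    have hentry : ∀ a b, hessian u x a b =
        (P.L k x)⁻¹ * ((1 / 2 : ℝ) * P.normal k a * P.normal k b) + B a b x := by
      intro a b
      rw [hUG x hx]
      simp only [Matrix.add_apply, Matrix.sum_apply, Matrix.smul_apply, Matrix.vecMulVec_apply,
        smul_eq_mul, B]
      rw [← Finset.add_sum_erase Finset.univ _ (Finset.mem_univ k)]
      ring
    have hmul : ∀ b, ∑ a, K x i a * hessian u x a b = (1 : Matrix (Fin m) (Fin m) ℝ) i b := by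
      intro b
      rw [← hu.isHessianPair.mul_eq_one' hx, hKeq x hx, Matrix.mul_apply]
    have hsum : ∑ b, (∑ a, K x i a * hessian u x a b) * P.normal k b = P.normal k i := by
      simp only [hmul, Matrix.one_apply]
      simp
    have hexp : ∑ b, (∑ a, K x i a * hessian u x a b) * P.normal k b =
        (P.L k x)⁻¹ * (1 / 2) * (∑ j, K x i j * P.normal k j) * N +
          ∑ a, ∑ b, K x i a * B a b x * P.normal k b := by
      rw [← hNsum]
      simp only [hentry, Finset.sum_mul, Finset.mul_sum]
      rw [Finset.sum_comm]
      rw [Finset.sum_comm (f := fun i_1 i_2 => (P.L k x)⁻¹ * (1 / 2) * (K x i i_2 * ↑(P.normal k i_2)) *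
        (↑(P.normal k i_1) * ↑(P.normal k i_1))), ← Finset.sum_add_distrib]
      refine Finset.sum_congr rfl fun a _ => ?_
      rw [← Finset.sum_add_distrib]
      exact Finset.sum_congr rfl fun b _ => by ring
    rw [hsum] at hexp
    simp only [Y]
    rw [hexp]
    field_simp
    ring
  have hcar : ∀ i, EqOn (fun x => ∑ j, K x i j * P.normal k j) (fun x => P.L k x * Y i x)
      (P.carrier ∩ P.facetNhd k) := fun i =>
    P.eqOn_of_eqOn_interior (P.isOpen_facetNhd k)
      (continuousOn_finsetSum _ fun j _ => (hK' i j).continuousOn.mul continuousOn_const)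
      ((P.continuous_L k).continuousOn.mul (hY i).continuousOn) (hint i)
  refine ⟨Y, hY, fun i x hx => hcar i hx, fun x hx => ?_⟩
  -- On the facet `L_k = 0`, so `K ν_k = 0`. By symmetry of `K`, the term `K B ν_k` drops out of
  -- `⟨ν_k, Y⟩`, leaving `(2 / N) |ν_k|² = 2`.
  have hzero : ∀ a, ∑ i, (P.normal k i : ℝ) * K x i a = 0 := by
    intro a
    have h1 := hcar a ⟨hx.1.1, hx.2⟩
    simp only at h1
    rw [hx.1.2, zero_mul] at h1
    rw [← h1]
    exact Finset.sum_congr rfl fun i _ => by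
      rw [hu.extension_symm hK hKeq hx.1.1 i a, mul_comm]
  have h2 : ∑ i, (P.normal k i : ℝ) * ∑ a, ∑ b, K x i a * B a b x * P.normal k b = 0 := by
    have : ∑ i, (P.normal k i : ℝ) * ∑ a, ∑ b, K x i a * B a b x * P.normal k b =
        ∑ a, ∑ b, (∑ i, (P.normal k i : ℝ) * K x i a) * (B a b x * P.normal k b) := by
      simp only [Finset.mul_sum, Finset.sum_mul]
      rw [Finset.sum_comm]
      refine Finset.sum_congr rfl fun a _ => ?_
      rw [Finset.sum_comm]
      exact Finset.sum_congr rfl fun b _ => Finset.sum_congr rfl fun i _ => by ring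
    rw [this]
    simp [hzero]
  have h3 : ∑ i, (P.normal k i : ℝ) * Y i x =
      2 / N * (∑ i, (P.normal k i : ℝ) * P.normal k i -
        ∑ i, (P.normal k i : ℝ) * ∑ a, ∑ b, K x i a * B a b x * P.normal k b) := by
    simp only [Y]
    rw [← Finset.sum_sub_distrib, Finset.mul_sum]
    exact Finset.sum_congr rfl fun i _ => by ring
  rw [h3, h2, hNsum]
  field_simp
  ring

/-- First boundary condition: `K ν_k = 0` on the `k`-th facet. -/
lemma sum_extension_mul_normal (k : Fin d) (hx : x ∈ P.facetSet k ∩ P.facetNhd k) (i : Fin m) :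
    ∑ j, K x i j * P.normal k j = 0 := by
  obtain ⟨Y, -, hY, -⟩ := hu.exists_normal_eq_mul hK hKeq k
  rw [hY i x ⟨hx.1.1, hx.2⟩, hx.1.2, zero_mul]

/-- Second boundary condition: the divergence of `K ν_k` equals `2` on the `k`-th facet. -/
lemma sum_bdryDeriv_extension_mul_normal (k : Fin d) (hx : x ∈ P.facetSet k ∩ P.facetNhd k) :
    ∑ i, ∑ j, P.bdryDeriv i (fun y => K y i j) x * P.normal k j = 2 := by
  obtain ⟨Y, hYs, hY, hY2⟩ := hu.exists_normal_eq_mul hK hKeq k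
  have hxc : x ∈ P.carrier ∩ P.facetNhd k := ⟨hx.1.1, hx.2⟩
  have huniq : UniqueDiffWithinAt ℝ P.carrier x := P.uniqueDiffOn_carrier x hx.1.1
  have huniq' : UniqueDiffWithinAt ℝ (P.carrier ∩ P.facetNhd k) x :=
    huniq.inter ((P.isOpen_facetNhd k).mem_nhds hx.2)
  rw [← hY2 x hx]
  refine Finset.sum_congr rfl fun i _ => ?_
  have hdK : ∀ j, DifferentiableWithinAt ℝ (fun y => K y i j) P.carrier x := fun j =>
    (hK i j).differentiableOn (by simp) x hx.1.1
  have h1 : ∑ j, P.bdryDeriv i (fun y => K y i j) x * P.normal k j =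
      P.bdryDeriv i (fun y => ∑ j, K y i j * P.normal k j) x := by
    simp only [bdryDeriv]
    rw [fderivWithin_fun_sum huniq (fun j _ => (hdK j).mul_const _), sum_apply]
    refine Finset.sum_congr rfl fun j _ => ?_
    rw [fderivWithin_mul_const huniq (hdK j)]
    simp [mul_comm]
  have h2 : fderivWithin ℝ (fun y => ∑ j, K y i j * P.normal k j) P.carrier x =
      fderivWithin ℝ (fun y => P.L k y * Y i y) (P.carrier ∩ P.facetNhd k) x := by
    rw [← fderivWithin_inter ((P.isOpen_facetNhd k).mem_nhds hx.2)]
    exact fderivWithin_congr (fun y hy => hY i y hy) (hY i x hxc)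
  -- Where `L_k = 0`, the product rule for `L_k Y_i` leaves only `(∂_i L_k) Y_i = ν_{k,i} Y_i`.
  rw [h1, bdryDeriv, h2, fderivWithin_fun_mul huniq'
    (P.hasFDerivAt_L k x).differentiableAt.differentiableWithinAt
    ((hYs i).differentiableOn (by simp) x hxc),
    (P.hasFDerivAt_L k x).hasFDerivWithinAt.fderivWithin huniq', hx.1.2]
  simp [EuclideanSpace.inner_single_right, mul_comm]

end IsSymplecticPotential

end DelzantPolytope

/-! ### Hessians of convex functions and traces of positive matrices. -/

section Convexity

variable {ι : Type} [Fintype ι] [DecidableEq ι]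

/-- The Hessian of a convex function is positive semidefinite. -/
lemma ConvexOn.posSemidef_hessian {C O : Set (EuclideanSpace ℝ ι)}
    {φ : EuclideanSpace ℝ ι → ℝ} (hφ : ConvexOn ℝ C φ) (hO : IsOpen O) (hOC : O ⊆ C)
    (hs : ContDiffOn ℝ ∞ φ O) {x : EuclideanSpace ℝ ι} (hx : x ∈ O) : (hessian φ x).PosSemidef := by
  refine Matrix.PosSemidef.of_dotProduct_mulVec_nonneg ?_ fun v => ?_
  · ext i j
    exact pderiv_pderiv_comm hO hs hx j i
  -- On the line through `x` in direction `v` the function is convex with monotone derivative, so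
  -- its second derivative `vᵀ (Hess φ) v` at `x` is nonnegative.
  let e : EuclideanSpace ℝ ι := WithLp.toLp 2 v
  have hline : ∀ t : ℝ, HasDerivAt (fun t : ℝ => x + t • e) e t := fun t => by
    simpa using ((hasDerivAt_id t).smul_const e).const_add x
  have hcont : Continuous fun t : ℝ => x + t • e := by fun_prop
  obtain ⟨r, hr, hball⟩ := Metric.isOpen_iff.1 (hO.preimage hcont) 0 (by simpa using hx)
  have hmem : ∀ t ∈ Metric.ball (0 : ℝ) r, x + t • e ∈ O := fun t ht => hball ht
  have hconv : ConvexOn ℝ (Metric.ball (0 : ℝ) r) fun t => φ (x + t • e) := by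
    refine ⟨convex_ball _ _, fun s hs' t ht a b ha hb hab => ?_⟩
    have h1 := hφ.2 (hOC (hmem s hs')) (hOC (hmem t ht)) ha hb hab
    have h2 : a • (x + s • e) + b • (x + t • e) = x + (a • s + b • t) • e := by
      rw [smul_add, smul_add, smul_smul, smul_smul, add_smul, smul_eq_mul, smul_eq_mul,
        add_add_add_comm, ← add_smul a b x, hab, one_smul]
    rwa [h2] at h1
  have hderiv : ∀ t ∈ Metric.ball (0 : ℝ) r, HasDerivAt (fun t => φ (x + t • e))
      (∑ j, v j * pderiv j φ (x + t • e)) t := fun t ht => by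
    have h1 := (differentiableAt_of_contDiffOn hO hs (hmem t ht)).hasFDerivAt.comp_hasDerivAt t
      (hline t)
    rw [fderiv_apply_eq_sum_pderiv] at h1
    exact h1
  have hmono := hconv.monotoneOn_deriv fun t ht => (hderiv t ht).differentiableAt
  have hmono' : MonotoneOn (fun t => ∑ j, v j * pderiv j φ (x + t • e)) (Metric.ball (0 : ℝ) r) :=
    hmono.congr fun t ht => (hderiv t ht).deriv
  have h0 : (0 : ℝ) ∈ Metric.ball (0 : ℝ) r := Metric.mem_ball_self hr
  have hx0 : x + (0 : ℝ) • e = x := by simp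
  have hsecond : HasDerivAt (fun t : ℝ => ∑ j, v j * pderiv j φ (x + t • e))
      (∑ j, v j * ∑ i, v i * pderiv i (pderiv j φ) x) 0 := by
    refine HasDerivAt.fun_sum fun j _ => HasDerivAt.const_mul _ ?_
    have hd : DifferentiableAt ℝ (pderiv j φ) (x + (0 : ℝ) • e) := by
      rw [hx0]
      exact differentiableAt_of_contDiffOn hO (contDiffOn_pderiv hO j hs) hx
    have h1 := hd.hasFDerivAt.comp_hasDerivAt (0 : ℝ) (hline 0)
    rw [fderiv_apply_eq_sum_pderiv, hx0] at h1
    exact h1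
  have hnn := hmono'.derivWithin_nonneg (x := 0)
  rw [derivWithin_of_mem_nhds (Metric.isOpen_ball.mem_nhds h0), hsecond.deriv] at hnn
  refine hnn.trans_eq ?_
  simp only [dotProduct, Matrix.mulVec, star_trivial, Finset.mul_sum]
  rw [Finset.sum_comm]
  refine Finset.sum_congr rfl fun i _ => Finset.sum_congr rfl fun j _ => ?_
  change _ = v i * (pderiv i (pderiv j φ) x * v j)
  ring

lemma sum_mul_sum_vecMulVec {κ : Type*} [Fintype κ] (H : Matrix ι ι ℝ) (v : κ → ι → ℝ) :
    ∑ i, ∑ j, H i j * (∑ k, Matrix.vecMulVec (v k) (star (v k))) i j =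
      ∑ k, star (v k) ⬝ᵥ (H.mulVec (v k)) := by
  simp only [Matrix.sum_apply, Matrix.vecMulVec_apply, dotProduct, Matrix.mulVec, star_trivial,
    Finset.mul_sum]
  rw [Finset.sum_comm_cycle]
  exact Finset.sum_congr rfl fun k _ => Finset.sum_congr rfl fun i _ =>
    Finset.sum_congr rfl fun j _ => by ring

/-- Decomposing `Φ = ∑ v vᵀ` turns the pairing into `∑ vᵀ H v`. -/
lemma Matrix.PosDef.sum_mul_nonneg {H Φ : Matrix ι ι ℝ} (hH : H.PosDef) (hΦ : Φ.PosSemidef) :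
    0 ≤ ∑ i, ∑ j, H i j * Φ i j := by
  obtain ⟨k, v, rfl⟩ := Matrix.posSemidef_iff_eq_sum_vecMulVec.1 hΦ
  rw [sum_mul_sum_vecMulVec]
  exact Finset.sum_nonneg fun l _ => hH.posSemidef.dotProduct_mulVec_nonneg _

/-- In the same decomposition every nonnegative term `vᵀ H v` vanishes, and definiteness of `H`
forces every `v = 0`. -/
lemma Matrix.PosDef.eq_zero_of_sum_mul_eq_zero {H Φ : Matrix ι ι ℝ} (hH : H.PosDef)
    (hΦ : Φ.PosSemidef) (h : ∑ i, ∑ j, H i j * Φ i j = 0) : Φ = 0 := by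
  obtain ⟨k, v, rfl⟩ := Matrix.posSemidef_iff_eq_sum_vecMulVec.1 hΦ
  rw [sum_mul_sum_vecMulVec, Finset.sum_eq_zero_iff_of_nonneg
    fun l _ => hH.posSemidef.dotProduct_mulVec_nonneg _] at h
  refine Finset.sum_eq_zero fun l _ => ?_
  have : v l = 0 := by
    by_contra hne
    exact (hH.dotProduct_mulVec_pos hne).ne' (h l (Finset.mem_univ l))
  simp [this]

/-- A function with vanishing Hessian on an open convex set is affine there. -/
lemma exists_affineMap_of_hessian_eq_zero {O : Set (EuclideanSpace ℝ ι)}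
    {φ : EuclideanSpace ℝ ι → ℝ} (hO : IsOpen O) (hconv : Convex ℝ O) (hne : O.Nonempty)
    (hs : ContDiffOn ℝ ∞ φ O) (h0 : ∀ x ∈ O, hessian φ x = 0) :
    ∃ a : EuclideanSpace ℝ ι →ᵃ[ℝ] ℝ, EqOn φ a O := by
  obtain ⟨p, hp⟩ := hne
  have hfd : ∀ {F : EuclideanSpace ℝ ι → ℝ} {x}, (∀ i, pderiv i F x = 0) → fderiv ℝ F x = 0 := by
    intro F x hF
    ext v
    rw [fderiv_apply_eq_sum_pderiv]
    simp [hF]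
  have hconst : ∀ j, ∀ x ∈ O, pderiv j φ x = pderiv j φ p := fun j x hx =>
    hO.is_const_of_fderiv_eq_zero (𝕜 := ℝ) hconv.isPreconnected
      ((contDiffOn_pderiv hO j hs).differentiableOn (by simp))
      (fun y hy => hfd fun i => congrFun (congrFun (h0 y hy) i) j) hx hp
  let ℓ := fderiv ℝ φ p
  have hsub : ∀ x ∈ O, φ x - ℓ x = φ p - ℓ p := fun x hx =>
    hO.is_const_of_fderiv_eq_zero (𝕜 := ℝ) (f := fun x => φ x - ℓ x) hconv.isPreconnected
      ((hs.differentiableOn (by simp)).sub ℓ.differentiableOn)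
      (fun y hy => by
        change fderiv ℝ (fun x => φ x - ℓ x) y = 0
        rw [fderiv_fun_sub (differentiableAt_of_contDiffOn hO hs hy) ℓ.differentiableAt,
          ContinuousLinearMap.fderiv, sub_eq_zero]
        ext v
        rw [fderiv_apply_eq_sum_pderiv, fderiv_apply_eq_sum_pderiv]
        exact Finset.sum_congr rfl fun j _ => by rw [hconst j y hy]) hx hp
  refine ⟨(ℓ : EuclideanSpace ℝ ι →ₗ[ℝ] ℝ).toAffineMap + AffineMap.const ℝ _ (φ p - ℓ p),
    fun x hx => ?_⟩
  have := hsub x hx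
  simp only [AffineMap.coe_add, Pi.add_apply, LinearMap.coe_toAffineMap, AffineMap.const_apply,
    ContinuousLinearMap.coe_coe]
  linarith

lemma hessian_affineMap (a : EuclideanSpace ℝ ι →ᵃ[ℝ] ℝ) (x : EuclideanSpace ℝ ι) :
    hessian a x = 0 := by
  ext i j
  have : pderiv j a = fun _ => a.linear (EuclideanSpace.single j 1) :=
    funext fun y => pderiv_affineMap a j y
  change pderiv i (pderiv j a) x = 0
  rw [this, pderiv_const]

lemma hessian_congr_of_eqOn {O : Set (EuclideanSpace ℝ ι)} {F G : EuclideanSpace ℝ ι → ℝ}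
    (hO : IsOpen O) (h : EqOn F G O) {x : EuclideanSpace ℝ ι} (hx : x ∈ O) :
    hessian F x = hessian G x := by
  ext i j
  exact pderiv_congr_of_eqOn hO hx i fun y hy => pderiv_congr_of_eqOn hO hy j h

end Convexity

/-! ### The Donaldson–Futaki invariant as a trace integral. -/

namespace DelzantPolytope

variable {m d : ℕ} (P : DelzantPolytope m d)

lemma integral_boundaryMeasure {g : EuclideanSpace ℝ (Fin m) → ℝ} (hg : ContinuousOn g P.carrier) :
    ∫ x, g x ∂P.boundaryMeasure = ∑ k, (P.normalLength k)⁻¹ *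
      ∫ x in P.facetSet k, g x ∂Measure.euclideanHausdorffMeasure (m - 1) := by
  have hint : ∀ k, IntegrableOn g (P.facetSet k) (Measure.euclideanHausdorffMeasure (m - 1)) := by
    intro k
    obtain ⟨C, hC⟩ := P.exists_bound_of_continuousOn hg
    have hmeas := (P.isCompact_facetSet k).measurableSet
    have : IsFiniteMeasure
        ((Measure.euclideanHausdorffMeasure (m - 1)).restrict (P.facetSet k)) :=
      ⟨by simpa using P.euclideanHausdorffMeasure_facetSet_lt_top k⟩
    refine Integrable.of_bound
      ((hg.mono (P.facetSet_subset k)).aestronglyMeasurable hmeas) C ?_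
    filter_upwards [ae_restrict_mem hmeas] with x hx using hC x hx.1
  rw [boundaryMeasure, integral_finsetSum_measure]
  · refine Finset.sum_congr rfl fun k _ => ?_
    rw [integral_smul_measure, ENNReal.toReal_ofReal (inv_nonneg.2 (P.normalLength_pos k).le),
      smul_eq_mul]
  · exact fun k _ => (hint k).smul_measure ENNReal.ofReal_ne_top

section Futaki

variable {f : EuclideanSpace ℝ (Fin m) →ᵃ[ℝ] ℝ} {u φ : EuclideanSpace ℝ (Fin m) → ℝ}

lemma contDiffOn_rpow_affine (hf : ∀ x ∈ P.carrier, 0 < f x) (p : ℝ) :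
    ContDiffOn ℝ ∞ (fun x => f x ^ p) P.carrier :=
  (contDiff_affineMap f).contDiffOn.rpow_const_of_ne fun x hx => (hf x hx).ne'

/-- Integration by parts against the weighted inverse Hessian of a symplectic potential. -/
theorem integral_mul_div_div_eq (hf : ∀ x ∈ P.carrier, 0 < f x) (p : ℝ)
    (hu : P.IsSymplecticPotential u) (hφ : ContDiffOn ℝ ∞ φ P.carrier) :
    ∫ x in interior P.carrier, (φ x * (∑ i, ∑ j,
        pderiv i (pderiv j fun y => f y ^ p * (hessian u y)⁻¹ i j) x) -
        f x ^ p * ∑ i, ∑ j, (hessian u x)⁻¹ i j * hessian φ x i j) =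
      -(2 * ∫ x, f x ^ p * φ x ∂P.boundaryMeasure) := by
  obtain ⟨K, hK, hKeq⟩ := hu.exists_inv_extension
  have hpair := hu.isHessianPair
  have hw := P.contDiffOn_rpow_affine hf p
  have hw' := P.contDiffOn_rpow_affine hf (p - 1)
  let a : Fin m → ℝ := fun j => f.linear (EuclideanSpace.single j 1)
  -- In the interior this is `φ div(f^p H) - f^p H ∇φ`. Its divergence is the integrand, because the
  -- two terms with one derivative on `φ` cancel by symmetry of `H`. The extension `K` and
  -- derivatives within the polytope make the field smooth up to the boundary.
  let Z : Fin m → EuclideanSpace ℝ (Fin m) → ℝ := fun i x =>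
    φ x * ∑ j, (p * a j * (f x ^ (p - 1) * K x i j) +
      f x ^ p * P.bdryDeriv j (fun y => K y i j) x) -
    ∑ j, f x ^ p * K x i j * P.bdryDeriv j φ x
  have hZ : ∀ i, ContDiffOn ℝ ∞ (Z i) P.carrier := fun i =>
    (hφ.mul (ContDiffOn.sum fun j _ => (contDiffOn_const.mul (hw'.mul (hK i j))).add
      (hw.mul (P.contDiffOn_bdryDeriv j (hK i j))))).sub
      (ContDiffOn.sum fun j _ => (hw.mul (hK i j)).mul (P.contDiffOn_bdryDeriv j hφ))
  have hdivthm := P.integral_div_eq hZ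
  -- Away from the other facets, hence almost everywhere on `F_k`, the condition `K ν_k = 0` kills
  -- the terms with derivatives of `f` or `φ`. The remaining one is `f^p φ` times the divergence of
  -- `K ν_k`, which is `2`.
  have hflux : ∀ k, ∫ x in P.facetSet k, P.flux Z k x ∂Measure.euclideanHausdorffMeasure (m - 1) =
      2 * ∫ x in P.facetSet k, f x ^ p * φ x ∂Measure.euclideanHausdorffMeasure (m - 1) := by
    intro k
    rw [← integral_const_mul]
    refine integral_congr_ae ?_
    filter_upwards [P.ae_mem_facetSet_pos k] with x hx
    have hx' : x ∈ P.facetSet k ∩ P.facetNhd k := hx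
    have b1 : ∀ j, ∑ i, (P.normal k i : ℝ) * K x i j = 0 := fun j => by
      rw [← hu.sum_extension_mul_normal hK hKeq k hx' j]
      exact Finset.sum_congr rfl fun i _ => by
        rw [hu.extension_symm hK hKeq hx.1.1 i j, mul_comm]
    have b2 : ∑ j, ∑ i, (P.normal k i : ℝ) * P.bdryDeriv j (fun y => K y i j) x = 2 := by
      rw [← hu.sum_bdryDeriv_extension_mul_normal hK hKeq k hx']
      refine Finset.sum_congr rfl fun i _ => Finset.sum_congr rfl fun j _ => ?_
      have : P.bdryDeriv i (fun y => K y j i) x = P.bdryDeriv i (fun y => K y i j) x := by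
        rw [bdryDeriv, bdryDeriv, fderivWithin_congr
          (fun y hy => hu.extension_symm hK hKeq hy j i) (hu.extension_symm hK hKeq hx.1.1 j i)]
      rw [this, mul_comm]
    have expand : P.flux Z k x = φ x * (∑ j, p * a j * f x ^ (p - 1) *
          (∑ i, (P.normal k i : ℝ) * K x i j) + f x ^ p *
          ∑ j, ∑ i, (P.normal k i : ℝ) * P.bdryDeriv j (fun y => K y i j) x) -
        ∑ j, f x ^ p * P.bdryDeriv j φ x * ∑ i, (P.normal k i : ℝ) * K x i j := by
      simp only [flux, Z, mul_sub, Finset.sum_sub_distrib, Finset.mul_sum]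
      rw [Finset.sum_comm, ← Finset.sum_add_distrib, Finset.mul_sum]
      congr 1
      · refine Finset.sum_congr rfl fun j _ => ?_
        rw [← Finset.sum_add_distrib, Finset.mul_sum]
        exact Finset.sum_congr rfl fun i _ => by ring
      · rw [Finset.sum_comm]
        exact Finset.sum_congr rfl fun j _ => Finset.sum_congr rfl fun i _ => by ring
    rw [expand]
    simp only [b1, b2, mul_zero, Finset.sum_const_zero]
    ring
  have hdiv : EqOn (fun x => ∑ i, pderiv i (Z i) x) (fun x => φ x * (∑ i, ∑ j,
        pderiv i (pderiv j fun y => f y ^ p * (hessian u y)⁻¹ i j) x) -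
        f x ^ p * ∑ i, ∑ j, (hessian u x)⁻¹ i j * hessian φ x i j) (interior P.carrier) := by
    intro x hx
    let V : Fin m → Fin m → EuclideanSpace ℝ (Fin m) → ℝ := fun i j y =>
      f y ^ p * (hessian u y)⁻¹ i j
    have hV : ∀ i j, ContDiffOn ℝ ∞ (V i j) (interior P.carrier) := fun i j =>
      (hw.mono interior_subset).mul (hpair.contDiffOn_right i j)
    have hVd : ∀ i j, DifferentiableAt ℝ (V i j) x := fun i j =>
      differentiableAt_of_contDiffOn isOpen_interior (hV i j) hx
    have hVdd : ∀ i j, DifferentiableAt ℝ (pderiv j (V i j)) x := fun i j =>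
      differentiableAt_of_contDiffOn isOpen_interior
        (contDiffOn_pderiv isOpen_interior j (hV i j)) hx
    have hφi := hφ.mono (interior_subset (s := P.carrier))
    have hφd : DifferentiableAt ℝ φ x := differentiableAt_of_contDiffOn isOpen_interior hφi hx
    have hφdd : ∀ j, DifferentiableAt ℝ (pderiv j φ) x := fun j =>
      differentiableAt_of_contDiffOn isOpen_interior (contDiffOn_pderiv isOpen_interior j hφi) hx
    have hZV : ∀ i, EqOn (Z i) (fun y => φ y * ∑ j, pderiv j (V i j) y -
        ∑ j, V i j y * pderiv j φ y) (interior P.carrier) := by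
      intro i y hy
      simp only [Z, V]
      congr 1
      · congr 1
        refine Finset.sum_congr rfl fun j _ => ?_
        rw [hpair.pderiv_rpow_mul_right f p hy (hf y (interior_subset hy)), P.bdryDeriv_eq j hy,
          hKeq y hy]
        rw [pderiv_congr_of_eqOn (G := fun y => (hessian u y)⁻¹ i j) isOpen_interior hy j
          fun y' hy' => congrFun (congrFun (hKeq y' hy').symm i) j]
      · exact Finset.sum_congr rfl fun j _ => by rw [hKeq y hy, P.bdryDeriv_eq j hy]
    have hpd : ∀ i, pderiv i (Z i) x = pderiv i φ x * ∑ j, pderiv j (V i j) x +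
        φ x * ∑ j, pderiv i (pderiv j (V i j)) x -
        ∑ j, (pderiv i (V i j) x * pderiv j φ x + V i j x * pderiv i (pderiv j φ) x) := by
      intro i
      rw [pderiv_congr_of_eqOn isOpen_interior hx i (hZV i),
        pderiv_sub _ (hφd.fun_mul (DifferentiableAt.fun_sum fun j _ => hVdd i j))
          (DifferentiableAt.fun_sum fun j _ => (hVd i j).fun_mul (hφdd j)),
        pderiv_mul _ hφd (DifferentiableAt.fun_sum fun j _ => hVdd i j),
        pderiv_sum _ _ (fun j _ => hVdd i j),
        pderiv_sum _ _ (fun j _ => (hVd i j).fun_mul (hφdd j))]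
      simp only [pderiv_mul i (hVd i _) (hφdd _)]
    have hsw : ∑ i, ∑ j, pderiv i (V i j) x * pderiv j φ x =
        ∑ i, pderiv i φ x * ∑ j, pderiv j (V i j) x := by
      rw [Finset.sum_comm]
      refine Finset.sum_congr rfl fun i _ => ?_
      rw [Finset.mul_sum]
      refine Finset.sum_congr rfl fun j _ => ?_
      rw [pderiv_congr_of_eqOn (G := V i j) isOpen_interior hx j fun y hy => by
        simp only [V, hpair.right_symm y hy j i], mul_comm]
    simp only [hpd, Finset.sum_sub_distrib, Finset.sum_add_distrib, hsw, ← Finset.mul_sum]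
    have hlast : ∑ i, ∑ j, V i j x * pderiv i (pderiv j φ) x =
        f x ^ p * ∑ i, ∑ j, (hessian u x)⁻¹ i j * hessian φ x i j := by
      simp only [Finset.mul_sum, V]
      exact Finset.sum_congr rfl fun i _ => Finset.sum_congr rfl fun j _ => by
        rw [mul_assoc]
        rfl
    rw [hlast]
    ring
  rw [← setIntegral_congr_fun isOpen_interior.measurableSet hdiv, hdivthm,
    P.integral_boundaryMeasure (hw.mul hφ).continuousOn, Finset.mul_sum]
  congr 1
  refine Finset.sum_congr rfl fun k _ => ?_
  rw [hflux k]
  ring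

variable (hf : ∀ x ∈ P.carrier, 0 < f x) {n c : ℝ} (hu : P.IsSymplecticPotential u)
  (hc : ∀ z : EuclideanSpace ℝ (Fin m ⊕ Fin m), momentCoord z ∈ interior P.carrier →
      gfknScalarCurvature (toricMetric u) (fun w => f (momentCoord w)) (-2) n z = c)
include hf hu

include hc in
-- The curvature hypothesis, read on the slice `θ = 0`, becomes the linear equation for the inverse
-- Hessian that is paired with `φ`.
lemma sum_pderiv_pderiv_eq {x : EuclideanSpace ℝ (Fin m)} (hx : x ∈ interior P.carrier) :
    ∑ i, ∑ j, pderiv i (pderiv j fun y => f y ^ (1 - n) * (hessian u y)⁻¹ i j) x =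
      -(c * f x ^ (-1 - n)) := by
  have hz : momentCoord (momentSection m x) ∈ interior P.carrier := by simpa using hx
  have h1 := hu.isHessianPair.gfknScalarCurvature_blockMetric f n
    (fun x hx => hf x (interior_subset hx)) hz
  have h2 := hc _ hz
  change gfknScalarCurvature (blockMetric (hessian u) fun x => (hessian u x)⁻¹) _ _ _ _ = c at h2
  rw [h2, momentCoord_momentSection] at h1
  have hpos := hf x (interior_subset hx)
  have hr : f x ^ (-1 - n) = (f x ^ (1 + n))⁻¹ := by
    rw [← Real.rpow_neg hpos.le]
    ring_nf
  have hne : f x ^ (1 + n) ≠ 0 := (Real.rpow_pos_of_pos hpos _).ne'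
  rw [h1, hr]
  field_simp

lemma integrableOn_trace (hφ : ContDiffOn ℝ ∞ φ P.carrier) (p : ℝ) :
    IntegrableOn (fun x => f x ^ p * ∑ i, ∑ j, (hessian u x)⁻¹ i j * hessian φ x i j)
      (interior P.carrier) := by
  obtain ⟨K, hK, hKeq⟩ := hu.exists_inv_extension
  have hcont : ContinuousOn (fun x => f x ^ p * ∑ i, ∑ j, K x i j *
      P.bdryDeriv i (P.bdryDeriv j φ) x) P.carrier :=
    (P.contDiffOn_rpow_affine hf p).continuousOn.mul (continuousOn_finsetSum _ fun i _ =>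
      continuousOn_finsetSum _ fun j _ => (hK i j).continuousOn.mul
        (P.contDiffOn_bdryDeriv i (P.contDiffOn_bdryDeriv j hφ)).continuousOn)
  refine ((hcont.integrableOn_compact P.isCompact_carrier).mono_set interior_subset).congr_fun
    (fun x hx => ?_) isOpen_interior.measurableSet
  simp only [hKeq x hx, P.bdryDeriv_eq _ hx]
  congr 1
  refine Finset.sum_congr rfl fun i _ => Finset.sum_congr rfl fun j _ => ?_
  rw [pderiv_congr_of_eqOn isOpen_interior hx i fun y hy => P.bdryDeriv_eq j hy]
  rfl

include hc in
/-- The Futaki pairing of a smooth function `φ` as an integral of the trace of its Hessian. -/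
theorem futaki_eq_integral_trace (hφ : ContDiffOn ℝ ∞ φ P.carrier) :
    2 * (∫ x, f x ^ (1 - n) * φ x ∂P.boundaryMeasure) -
        c * ∫ x in P.carrier, f x ^ (-1 - n) * φ x =
      ∫ x in interior P.carrier,
        f x ^ (1 - n) * ∑ i, ∑ j, (hessian u x)⁻¹ i j * hessian φ x i j := by
  have h1 := P.integral_mul_div_div_eq hf (1 - n) hu hφ
  have hcongr : EqOn (fun x => φ x * (∑ i, ∑ j,
        pderiv i (pderiv j fun y => f y ^ (1 - n) * (hessian u y)⁻¹ i j) x) -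
        f x ^ (1 - n) * ∑ i, ∑ j, (hessian u x)⁻¹ i j * hessian φ x i j)
      (fun x => -c * (f x ^ (-1 - n) * φ x) -
        f x ^ (1 - n) * ∑ i, ∑ j, (hessian u x)⁻¹ i j * hessian φ x i j)
      (interior P.carrier) := fun x hx => by
    simp only [P.sum_pderiv_pderiv_eq hf hu hc hx]
    ring
  have hint : IntegrableOn (fun x => f x ^ (-1 - n) * φ x) (interior P.carrier) :=
    (((P.contDiffOn_rpow_affine hf _).mul hφ).continuousOn.integrableOn_compact
      P.isCompact_carrier).mono_set interior_subset
  rw [setIntegral_congr_fun isOpen_interior.measurableSet hcongr,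
    integral_sub (hint.const_mul _) (P.integrableOn_trace hf hu hφ _), integral_const_mul] at h1
  rw [P.setIntegral_carrier_eq]
  linarith

omit hu in
lemma setIntegral_rpow_pos (p : ℝ) : 0 < ∫ x in P.carrier, f x ^ p := by
  have hpos : ∀ x ∈ P.carrier, 0 < f x ^ p := fun x hx => Real.rpow_pos_of_pos (hf x hx) p
  rw [setIntegral_pos_iff_support_of_nonneg_ae]
  · have : Function.support (fun x => f x ^ p) ∩ P.carrier = P.carrier :=
      inter_eq_right.2 fun x hx => (hpos x hx).ne'
    rw [this]
    exact (isOpen_interior.measure_pos volume P.interior_carrier_nonempty).trans_le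
      (measure_mono interior_subset)
  · filter_upwards [ae_restrict_mem P.isClosed_carrier.measurableSet] with x hx using (hpos x hx).le
  · exact (P.contDiffOn_rpow_affine hf p).continuousOn.integrableOn_compact P.isCompact_carrier

include hc in
-- The test function `φ = 1` has zero Hessian, so the Futaki pairing vanishes; solving for `c` is
-- possible because the weight is positive.
lemma eq_constC : c = P.constC f n := by
  have h1 := P.futaki_eq_integral_trace hf hu hc (φ := fun _ => 1) contDiffOn_const
  have h0 : ∀ x, hessian (fun _ : EuclideanSpace ℝ (Fin m) => (1 : ℝ)) x = 0 := fun x =>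
    hessian_affineMap (AffineMap.const ℝ _ (1 : ℝ)) x
  simp only [h0, Matrix.zero_apply, mul_zero, Finset.sum_const_zero, mul_one, integral_zero] at h1
  rw [constC, eq_div_iff (P.setIntegral_rpow_pos hf _).ne']
  linarith

/-- The trace integral of a convex function is nonnegative and vanishes only for affine functions. -/
lemma integral_trace_nonneg_and_eq_zero_iff (hφ : ContDiffOn ℝ ∞ φ P.carrier)
    (hconv : ConvexOn ℝ P.carrier φ) (p : ℝ) :
    0 ≤ ∫ x in interior P.carrier,
      f x ^ p * ∑ i, ∑ j, (hessian u x)⁻¹ i j * hessian φ x i j ∧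
    (∫ x in interior P.carrier, f x ^ p * ∑ i, ∑ j, (hessian u x)⁻¹ i j * hessian φ x i j = 0 ↔
      ∃ a : EuclideanSpace ℝ (Fin m) →ᵃ[ℝ] ℝ, EqOn φ a P.carrier) := by
  have hφi := hφ.mono (interior_subset (s := P.carrier))
  have hpsd : ∀ x ∈ interior P.carrier, (hessian φ x).PosSemidef := fun x hx =>
    hconv.posSemidef_hessian isOpen_interior interior_subset hφi hx
  have hw : ∀ x ∈ interior P.carrier, 0 < f x ^ p := fun x hx =>
    Real.rpow_pos_of_pos (hf x (interior_subset hx)) p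
  have hnn : ∀ x ∈ interior P.carrier,
      0 ≤ f x ^ p * ∑ i, ∑ j, (hessian u x)⁻¹ i j * hessian φ x i j := fun x hx =>
    mul_nonneg (hw x hx).le ((hu.posDef x hx).inv.sum_mul_nonneg (hpsd x hx))
  refine ⟨setIntegral_nonneg isOpen_interior.measurableSet hnn, fun h0 => ?_, ?_⟩
  · rw [setIntegral_eq_zero_iff_of_nonneg_ae
      ((ae_restrict_mem isOpen_interior.measurableSet).mono hnn)
      (P.integrableOn_trace hf hu hφ p)] at h0
    have hcont : ContinuousOn (fun x => f x ^ p * ∑ i, ∑ j, (hessian u x)⁻¹ i j * hessian φ x i j)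
        (interior P.carrier) :=
      ((P.contDiffOn_rpow_affine hf p).continuousOn.mono interior_subset).mul
        (continuousOn_finsetSum _ fun i _ => continuousOn_finsetSum _ fun j _ =>
          (hu.isHessianPair.contDiffOn_right i j).continuousOn.mul
            (contDiffOn_pderiv isOpen_interior i
              (contDiffOn_pderiv isOpen_interior j hφi)).continuousOn)
    -- A continuous integrand that vanishes almost everywhere on an open set vanishes at every
    -- point, so the pointwise rigidity of the trace applies throughout the interior.
    have hzero := Measure.eqOn_open_of_ae_eq h0 isOpen_interior hcont continuousOn_const
    have hhess : ∀ x ∈ interior P.carrier, hessian φ x = 0 := fun x hx =>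
      (hu.posDef x hx).inv.eq_zero_of_sum_mul_eq_zero (hpsd x hx)
        ((mul_eq_zero.1 (hzero hx)).resolve_left (hw x hx).ne')
    obtain ⟨a, ha⟩ := exists_affineMap_of_hessian_eq_zero isOpen_interior
      P.convex_carrier.interior P.interior_carrier_nonempty hφi hhess
    refine ⟨a, fun x hx => P.eqOn_of_eqOn_interior isOpen_univ
      (hφ.continuousOn.mono inter_subset_left) (contDiff_affineMap a).continuous.continuousOn ha
      ⟨hx, mem_univ x⟩⟩
  · rintro ⟨a, ha⟩
    refine setIntegral_eq_zero_of_forall_eq_zero fun x hx => ?_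
    rw [hessian_congr_of_eqOn isOpen_interior (ha.mono interior_subset) hx, hessian_affineMap]
    simp

end Futaki

end DelzantPolytope

end

theorem theorem5p1 {m d : ℕ} (P : DelzantPolytope m d)
    (f : EuclideanSpace ℝ (Fin m) →ᵃ[ℝ] ℝ) (hf : ∀ x ∈ P.carrier, 0 < f x)
    (n : ℝ) (hn0 : n ≠ 0) (hn1 : n ≠ 1) (hn2 : n ≠ 2)
    (u : EuclideanSpace ℝ (Fin m) → ℝ) (hu : P.IsSymplecticPotential u)
    (c : ℝ)
    (hc : ∀ z : EuclideanSpace ℝ (Fin m ⊕ Fin m), momentCoord z ∈ interior P.carrier →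
      ChartMetric.gfknScalarCurvature (toricMetric u) (fun w => f (momentCoord w)) (-2) n z = c) :
    c = P.constC f n ∧
    ∀ φ : EuclideanSpace ℝ (Fin m) → ℝ, ContDiffOn ℝ ∞ φ P.carrier → ConvexOn ℝ P.carrier φ →
      0 ≤ P.donaldsonFutaki f n φ ∧
      (P.donaldsonFutaki f n φ = 0 ↔
        ∃ a : EuclideanSpace ℝ (Fin m) →ᵃ[ℝ] ℝ, EqOn φ a P.carrier) := by
  have hceq := P.eq_constC hf hu hc
  refine ⟨hceq, fun φ hφ hconv => ?_⟩
  have hDF := P.futaki_eq_integral_trace hf hu hc hφ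
  rw [hceq] at hDF
  rw [DelzantPolytope.donaldsonFutaki, hDF]
  exact P.integral_trace_nonneg_and_eq_zero_iff hf hu hφ hconv (1 - n)
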